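/- Let $\mathcal M$ be a finite set of $m$ indivisible items and let $\mathcal N=\{1,\dots,n\}$ be a set of agents. Agent $i$ has an entitlement $b_i>0$, with $\sum_i b_i=1$, and a valuation $v_i:2^{\mathcal M}\to\mathbb R_{\ge 0}$ that is normalized ($v_i(\emptyset)=0$), monotone, and submodular. A valuation $v$ is additive if $v(S)=\sum_{j\in S}v(\{j\})$ for all $S$, and unit-demand if $v(S)=\max_{j\in S}v(\{j\})$ for all $S\neq\emptyset$. The AnyPrice share of agent $i$ is $$APS_i=\min_{p}\ \max\Big\{v_i(S)\ :\ S\subseteq\mathcal M,\ \sum_{j\in S}p_j\le b_i\Big\},$$ where $p$ ranges over the non-negative price vectors on $\mathcal M$ with $\sum_{j}p_j=1$. There is a single polynomial-time algorithm which, given $n$, $m$, the entitlements, and value-query access to the valuations (a query names an agent $i$ and a set $S$, and is answered by $v_i(S)$ in unit time), outputs on every such instance a partition $(A_1,\dots,A_n)$ of $\mathcal M$ such that simultaneously 1. $v_i(A_i)\ge\frac13\,APS_i$ for every agent $i$; 2. $v_i(A_i)\ge\frac35\,APS_i$ for every agent $i$ whose valuation is additive; 3. $v_i(A_i)\ge APS_i$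 for every agent $i$ whose valuation is unit-demand. Here polynomial time means the following, for one fixed program of a random access machine with arithmetic operations $+,-,\cdot,/$ and comparisons on numbers. (a) For arbitrary real valuations and entitlements, the number of machine operations and value queries is polynomial in $n$, $m$ and $\log K$, where $K\ge1$ is any upper bound on the ratios $v_i(\mathcal M)/v_i(S)$ over all agents $i$ and all $S\subseteq\mathcal M$ with $v_i(S)>0$. (b) If all values $v_i(S)$ and all entitlements are rational numbers that are written with at most $L$ binary digits, then also the total bit length of all numbers computed by the program during its run (logarithmic cost) is polynomial in $n$, $m$ and $L$. -/

import Mathlib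

noncomputable section

namespace FairAlloc

/-! ### Allocation instances, classes of valuations, and the AnyPrice share -/

/-- An allocation instance with agents `Fin n` and items `Fin m`: normalized monotone valuations
(hence non-negative) and positive entitlements that sum up to one. -/
structure Instance (n m : ℕ) where
  val : Fin n → Finset (Fin m) → ℝ
  ent : Fin n → ℝ
  val_empty : ∀ i, val i ∅ = 0
  val_mono : ∀ i S T, S ⊆ T → val i S ≤ val i T
  ent_pos : ∀ i, 0 < ent i
  ent_sum : ∑ i, ent i = 1

/-- Submodular set functions. -/
def IsSubmodular {m : ℕ} (v : Finset (Fin m) → ℝ) : Prop :=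
  ∀ S T, v (S ∪ T) + v (S ∩ T) ≤ v S + v T

/-- Additive set functions: a bundle is worth the sum of the values of its items. -/
def IsAdditive {m : ℕ} (v : Finset (Fin m) → ℝ) : Prop :=
  ∀ S, v S = ∑ j ∈ S, v {j}

/-- Unit-demand set functions: the empty bundle is worth nothing, and every other bundle is worth
the maximum value of one of its items. -/
def IsUnitDemand {m : ℕ} (v : Finset (Fin m) → ℝ) : Prop :=
  v ∅ = 0 ∧ ∀ S : Finset (Fin m), S.Nonempty →
    IsGreatest ((fun j => v {j}) '' (S : Set (Fin m))) (v S)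

/-- The AnyPrice share for entitlement `b` and valuation `v`: the minimum, over all non-negative
prices that sum up to one, of the maximum value of an affordable bundle. Only finitely many values
occur, so that for `0 ≤ b` and `0 < m` the supremum and the infimum are attained. -/
def anyPrice {m : ℕ} (b : ℝ) (v : Finset (Fin m) → ℝ) : ℝ :=
  ⨅ p : stdSimplex ℝ (Fin m),
    sSup (v '' {S : Finset (Fin m) | ∑ j ∈ S, (p : Fin m → ℝ) j ≤ b})

/-- The AnyPrice share of agent `i`. -/
def Instance.aps {n m : ℕ} (I : Instance n m) (i : Fin n) : ℝ :=
  anyPrice (I.ent i) (I.val i)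

/-- The bundle of agent `i`, if every item `j` is given to agent `A j`. -/
def bundle {n m : ℕ} (A : Fin m → Fin n) (i : Fin n) : Finset (Fin m) :=
  Finset.univ.filter fun j => A j = i

/-! ### The machine model: random access programs with a value oracle

Programs work on finitely many named arrays (a scalar variable is a cell of an array) of two sorts:
arrays of natural numbers, which also serve as addresses, and arrays of numbers. -/

/-- The memory: `idx a j` is cell `j` of the array `a` of natural numbers, and `num a j` is cell
`j` of the array `a` of numbers. -/
structure Store where
  idx : ℕ → ℕ → ℕ
  num : ℕ → ℕ → ℝ

/-- Expressions for natural numbers: constants, cells, addition, truncated subtraction. -/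
inductive IExpr where
  | const (k : ℕ)
  | get (a : ℕ) (e : IExpr)
  | add (e f : IExpr)
  | sub (e f : IExpr)

/-- Expressions for numbers: conversion of a natural number, cells, field operations
(the machine's convention is that division by zero returns zero). -/
inductive NExpr where
  | ofIdx (e : IExpr)
  | get (a : ℕ) (e : IExpr)
  | add (x y : NExpr)
  | sub (x y : NExpr)
  | mul (x y : NExpr)
  | div (x y : NExpr)

/-- Tests: comparison of natural numbers, comparison of numbers, Boolean connectives. -/
inductive BExpr where
  | ile (e f : IExpr)
  | nle (x y : NExpr)
  | not (b : BExpr)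
  | and (b c : BExpr)

/-- Programs. `setIdx a e f` is the assignment `a[e] := f` in an array of natural numbers,
`setNum a e x` is `a[e] := x` in an array of numbers, `query a e i q` stores in cell `e` of the
array `a` of numbers the value, to agent `i`, of the bundle of those items `j` for which cell `j`
of the array `q` of natural numbers is not zero, and `loop b c` is `while b do c`. -/
inductive Prog where
  | skip
  | setIdx (a : ℕ) (e f : IExpr)
  | setNum (a : ℕ) (e : IExpr) (x : NExpr)
  | query (a : ℕ) (e i : IExpr) (q : ℕ)
  | seq (c d : Prog)
  | ite (b : BExpr) (c d : Prog)
  | loop (b : BExpr) (c : Prog)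

def IExpr.eval (s : Store) : IExpr → ℕ
  | .const k => k
  | .get a e => s.idx a (e.eval s)
  | .add e f => e.eval s + f.eval s
  | .sub e f => e.eval s - f.eval s

def NExpr.eval (s : Store) : NExpr → ℝ
  | .ofIdx e => (e.eval s : ℝ)
  | .get a e => s.num a (e.eval s)
  | .add x y => x.eval s + y.eval s
  | .sub x y => x.eval s - y.eval s
  | .mul x y => x.eval s * y.eval s
  | .div x y => x.eval s / y.eval s

def BExpr.eval (s : Store) : BExpr → Prop
  | .ile e f => e.eval s ≤ f.eval s
  | .nle x y => x.eval s ≤ y.eval s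
  | .not b => ¬ b.eval s
  | .and b c => b.eval s ∧ c.eval s

/-! The cost of a computation depends on a weight function `w`: every operation costs the weight
of its result (its operands having been charged when they were computed). The address of a cell
is charged as well. -/

def IExpr.cost (w : ℝ → ℕ) (s : Store) : IExpr → ℕ
  | .const k => w k
  | .get a e => e.cost w s + w ((IExpr.get a e).eval s)
  | .add e f => e.cost w s + f.cost w s + w ((IExpr.add e f).eval s)
  | .sub e f => e.cost w s + f.cost w s + w ((IExpr.sub e f).eval s)

def NExpr.cost (w : ℝ → ℕ) (s : Store) : NExpr → ℕ
  | .ofIdx e => e.cost w s + w (e.eval s)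
  | .get a e => e.cost w s + w ((NExpr.get a e).eval s)
  | .add x y => x.cost w s + y.cost w s + w ((NExpr.add x y).eval s)
  | .sub x y => x.cost w s + y.cost w s + w ((NExpr.sub x y).eval s)
  | .mul x y => x.cost w s + y.cost w s + w ((NExpr.mul x y).eval s)
  | .div x y => x.cost w s + y.cost w s + w ((NExpr.div x y).eval s)

def BExpr.cost (w : ℝ → ℕ) (s : Store) : BExpr → ℕ
  | .ile e f => e.cost w s + f.cost w s + 1
  | .nle x y => x.cost w s + y.cost w s + 1
  | .not b => b.cost w s + 1
  | .and b c => b.cost w s + c.cost w s + 1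

/-- The store after the assignment `a[j] := k` in an array of natural numbers. -/
def Store.putIdx (s : Store) (a j k : ℕ) : Store where
  idx := fun a' j' => if a' = a ∧ j' = j then k else s.idx a' j'
  num := s.num

/-- The store after the assignment `a[j] := x` in an array of numbers. -/
def Store.putNum (s : Store) (a j : ℕ) (x : ℝ) : Store where
  idx := s.idx
  num := fun a' j' => if a' = a ∧ j' = j then x else s.num a' j'

/-- `Exec w O c s s' t`: started in the store `s`, the program `c` halts in the store `s'` after a
computation of cost `t`, for the weight function `w` and the oracle `O`, which is asked with the
name of an agent and the contents of an array. A query takes one unit of time, to which the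
weights of the addresses and of the answer are added. -/
inductive Exec (w : ℝ → ℕ) (O : ℕ → (ℕ → ℕ) → ℝ) : Prog → Store → Store → ℕ → Prop where
  | skip (s : Store) : Exec w O .skip s s 1
  | setIdx (a : ℕ) (e f : IExpr) (s : Store) :
      Exec w O (.setIdx a e f) s (s.putIdx a (e.eval s) (f.eval s))
        (e.cost w s + f.cost w s + 1)
  | setNum (a : ℕ) (e : IExpr) (x : NExpr) (s : Store) :
      Exec w O (.setNum a e x) s (s.putNum a (e.eval s) (x.eval s))
        (e.cost w s + x.cost w s + 1)
  | query (a : ℕ) (e i : IExpr) (q : ℕ) (s : Store) :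
      Exec w O (.query a e i q) s (s.putNum a (e.eval s) (O (i.eval s) (s.idx q)))
        (e.cost w s + i.cost w s + w (O (i.eval s) (s.idx q)) + 1)
  | seq (c d : Prog) (s s' s'' : Store) (t t' : ℕ) :
      Exec w O c s s' t → Exec w O d s' s'' t' → Exec w O (.seq c d) s s'' (t + t')
  | ite_true (b : BExpr) (c d : Prog) (s s' : Store) (t : ℕ) :
      b.eval s → Exec w O c s s' t → Exec w O (.ite b c d) s s' (b.cost w s + t)
  | ite_false (b : BExpr) (c d : Prog) (s s' : Store) (t : ℕ) :
      ¬ b.eval s → Exec w O d s s' t → Exec w O (.ite b c d) s s' (b.cost w s + t)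
  | loop_true (b : BExpr) (c : Prog) (s s' s'' : Store) (t t' : ℕ) :
      b.eval s → Exec w O c s s' t → Exec w O (.loop b c) s' s'' t' →
        Exec w O (.loop b c) s s'' (b.cost w s + t + t')
  | loop_false (b : BExpr) (c : Prog) (s : Store) :
      ¬ b.eval s → Exec w O (.loop b c) s s (b.cost w s)

/-- Uniform cost: every operation takes unit time. -/
def unitWeight : ℝ → ℕ := fun _ => 1

/-- The number `x` is a fraction of integers that can be written down with `L` binary digits
(not counting the sign). -/
def HasBits (x : ℝ) (L : ℕ) : Prop :=
  ∃ (a : ℤ) (d : ℕ), 0 < d ∧ x = (a : ℝ) / (d : ℝ) ∧ a.natAbs.size + d.size ≤ L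

/-- Logarithmic cost: the weight of a rational number is its length in binary notation, plus one.
(This is used only for rational inputs, and then all the numbers that a program computes are
rational.) -/
def bitWeight : ℝ → ℕ := fun x => sInf {L | HasBits x L} + 1

/-- The value oracle of an instance. -/
def Instance.oracle {n m : ℕ} (I : Instance n m) : ℕ → (ℕ → ℕ) → ℝ := fun i q =>
  if h : i < n then I.val ⟨i, h⟩ (Finset.univ.filter fun j : Fin m => q j ≠ 0) else 0

/-- The initial store: the number `n` of agents and the number `m` of items are in cell `0` of the
arrays `0` and `1` of natural numbers, the entitlements are in the array `0` of numbers, and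
all the other cells hold zero. -/
def Instance.input {n m : ℕ} (I : Instance n m) : Store where
  idx := fun a j => if j = 0 then (if a = 0 then n else if a = 1 then m else 0) else 0
  num := fun a j => if h : a = 0 ∧ j < n then I.ent ⟨j, h.2⟩ else 0

/-- On the instance `I`, the program `c` halts after a computation of cost `t` and outputs the
allocation `A`: the recipient of item `j` is in cell `j` of the array `2` of natural numbers. -/
def Outputs (w : ℝ → ℕ) (c : Prog) {n m : ℕ} (I : Instance n m) (A : Fin m → Fin n) (t : ℕ) :
    Prop :=
  ∃ s : Store, Exec w I.oracle c I.input s t ∧ ∀ j : Fin m, s.idx 2 j = A j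

end FairAlloc

end

open FairAlloc

/-! The allocation comes from a bidding game. Each agent has a target z and her entitlement b as
budget; in each round she bids according to the gain of her best free item, and the highest bidder
takes her best item and pays her bid.

The payments serve as prices. Nobody overspends (`AgentInv.pay`), so the items of the others cost at
most 1 - b. If an agent ends below her goal (z/3 if submodular, 3z/5 if additive), she has paid at
most 7b/8, so all prices add up to at most 1 - b/8. Lost items cost at least her bids, so every
bundle of price at most (1 - b/8)b is worth at most (1 - b/50)z to her. After scaling, the prices
show that her share is at most (1 - b/50)z (`InvSub.anyPrice_le`, `InvAdd.anyPrice_le`), and her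
target can be lowered safely. Unit-demand agents need no target: one bid of the whole budget secures
the share (`InvUD.anyPrice_le`).

A submodular agent pays 3b/(2z) per unit of gain: the bundle T is worth less than z/3 from her own
items plus 2z/3 from marginals. An additive agent pays 5b/(4z) per unit until she has 2z/5, then
half the rate that would exhaust her remaining budget at the goal; very valuable items get larger
bids. The resulting estimates on bundles are `sum_le_of_one_big` and `sum_le_of_late`.

Let P be the set of items of positive value. If b|P| < 1, the share is 0. Otherwise b ≥ 1/m, the
target starts at the value of all items, and the factor 1 - 1/(50m) is a valid reduction; the share
is at least the least positive value of an item, so each agent reduces at most 50mk times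
(`reductions_le`). The game is replayed until everybody is satisfied (`wp_allocate`).

The program is verified with weakest preconditions that also bound iterations and the complexity of
all stored numbers (`exec_of_wp`). An abstract `Grading` treats uniform and logarithmic cost alike.
Stored numbers are bounded formulas in values, entitlements and targets, so their lengths do not
accumulate. -/

noncomputable section

/-! ### Cost bounds and program logic for the machine. -/

namespace FairAlloc

/-! ### Graded classes of numbers and the cost of expressions -/

/-- `G B x` bounds the complexity of the number `x` by `B`; the grading is compatible with the
arithmetic operations and bounds the weight function `w`. -/
structure Grading (w : ℝ → ℕ) (G : ℕ → ℝ → Prop) : Prop where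
  mono : ∀ {a b : ℕ} {x : ℝ}, a ≤ b → G a x → G b x
  nat : ∀ {B k : ℕ}, k ≤ 2 ^ B → G B (k : ℝ)
  add : ∀ {a b : ℕ} {x y : ℝ}, G a x → G b y → G (a + b + 1) (x + y)
  sub : ∀ {a b : ℕ} {x y : ℝ}, G a x → G b y → G (a + b + 1) (x - y)
  mul : ∀ {a b : ℕ} {x y : ℝ}, G a x → G b y → G (a + b + 1) (x * y)
  div : ∀ {a b : ℕ} {x y : ℝ}, G a x → G b y → G (a + b + 1) (x / y)
  weight : ∀ {B : ℕ} {x : ℝ}, G B x → w x ≤ 2 * B + 3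

/-- A constant counts with its value, so that size times `B + 1` bounds the binary exponent of
everything an expression can evaluate to. -/
def IExpr.sz : IExpr → ℕ
  | .const k => k + 1
  | .get _ e => e.sz + 1
  | .add e f => e.sz + f.sz + 1
  | .sub e f => e.sz + f.sz + 1

def NExpr.sz : NExpr → ℕ
  | .ofIdx e => e.sz + 1
  | .get _ e => e.sz + 1
  | .add x y => x.sz + y.sz + 1
  | .sub x y => x.sz + y.sz + 1
  | .mul x y => x.sz + y.sz + 1
  | .div x y => x.sz + y.sz + 1

def BExpr.sz : BExpr → ℕ
  | .ile e f => e.sz + f.sz + 1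
  | .nle x y => x.sz + y.sz + 1
  | .not b => b.sz + 1
  | .and b c => b.sz + c.sz + 1

/-- All cells of the store hold numbers of complexity at most `B`. -/
structure Bdd (G : ℕ → ℝ → Prop) (B : ℕ) (s : Store) : Prop where
  idx : ∀ a j, s.idx a j ≤ 2 ^ B
  num : ∀ a j, G B (s.num a j)

theorem IExpr.eval_le {G : ℕ → ℝ → Prop} {B : ℕ} {s : Store} (hs : Bdd G B s) (e : IExpr) :
    e.eval s ≤ 2 ^ (e.sz * (B + 1)) := by
  induction e with
  | const k =>
    simp only [IExpr.eval, IExpr.sz]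
    calc k ≤ 2 ^ k := Nat.lt_two_pow_self.le
      _ ≤ _ := Nat.pow_le_pow_right (by norm_num) (by nlinarith)
  | get a e ih =>
    simp only [IExpr.eval, IExpr.sz]
    exact (hs.idx _ _).trans (Nat.pow_le_pow_right (by norm_num) (by nlinarith))
  | add e f ihe ihf =>
    simp only [IExpr.eval, IExpr.sz]
    have h1 : 2 ^ (e.sz * (B + 1)) ≤ 2 ^ ((e.sz + f.sz) * (B + 1)) :=
      Nat.pow_le_pow_right (by norm_num) (by nlinarith)
    have h2 : 2 ^ (f.sz * (B + 1)) ≤ 2 ^ ((e.sz + f.sz) * (B + 1)) :=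
      Nat.pow_le_pow_right (by norm_num) (by nlinarith)
    calc _ ≤ 2 ^ ((e.sz + f.sz) * (B + 1)) * 2 := by omega
      _ = 2 ^ ((e.sz + f.sz) * (B + 1) + 1) := (pow_succ _ _).symm
      _ ≤ _ := Nat.pow_le_pow_right (by norm_num) (by nlinarith)
  | sub e f ihe ihf =>
    simp only [IExpr.eval, IExpr.sz]
    exact (Nat.sub_le _ _).trans (ihe.trans
      (Nat.pow_le_pow_right (by norm_num) (by nlinarith)))

theorem NExpr.eval_grade {w : ℝ → ℕ} {G : ℕ → ℝ → Prop} (hG : Grading w G) {B : ℕ} {s : Store}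
    (hs : Bdd G B s) (x : NExpr) : G (x.sz * (B + 1)) (x.eval s) := by
  induction x with
  | ofIdx e =>
    exact hG.nat ((e.eval_le hs).trans
      (Nat.pow_le_pow_right (by norm_num) (by simp only [NExpr.sz]; nlinarith)))
  | get a e => exact hG.mono (by simp only [NExpr.sz]; nlinarith) (hs.num _ _)
  | add x y hx hy => exact hG.mono (by simp only [NExpr.sz]; nlinarith) (hG.add hx hy)
  | sub x y hx hy => exact hG.mono (by simp only [NExpr.sz]; nlinarith) (hG.sub hx hy)
  | mul x y hx hy => exact hG.mono (by simp only [NExpr.sz]; nlinarith) (hG.mul hx hy)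
  | div x y hx hy => exact hG.mono (by simp only [NExpr.sz]; nlinarith) (hG.div hx hy)

/-- `S` stands for the size of the enclosing expression: one common bound for the weights of all
subexpressions makes the induction additive. -/
theorem IExpr.cost_le' {w : ℝ → ℕ} {G : ℕ → ℝ → Prop} (hG : Grading w G) {B : ℕ} {s : Store}
    (hs : Bdd G B s) (e : IExpr) (S : ℕ) (hS : e.sz ≤ S) :
    e.cost w s ≤ e.sz * (2 * (S * (B + 1)) + 3) := by
  have key : ∀ e : IExpr, e.sz ≤ S → w (e.eval s) ≤ 2 * (S * (B + 1)) + 3 := fun e he =>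
    (hG.weight (hG.nat (e.eval_le hs))).trans (by nlinarith [Nat.mul_le_mul_right (B + 1) he])
  induction e with
  | const k =>
    have := key (.const k) hS
    simp only [IExpr.cost, IExpr.sz, IExpr.eval] at *
    nlinarith
  | get a e ih =>
    have := key _ hS
    have := ih (by simp only [IExpr.sz] at hS; omega)
    simp only [IExpr.cost, IExpr.sz] at *
    nlinarith
  | add e f ihe ihf =>
    have := key _ hS
    have := ihe (by simp only [IExpr.sz] at hS; omega)
    have := ihf (by simp only [IExpr.sz] at hS; omega)
    simp only [IExpr.cost, IExpr.sz] at *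
    nlinarith
  | sub e f ihe ihf =>
    have := key _ hS
    have := ihe (by simp only [IExpr.sz] at hS; omega)
    have := ihf (by simp only [IExpr.sz] at hS; omega)
    simp only [IExpr.cost, IExpr.sz] at *
    nlinarith

theorem NExpr.cost_le' {w : ℝ → ℕ} {G : ℕ → ℝ → Prop} (hG : Grading w G) {B : ℕ} {s : Store}
    (hs : Bdd G B s) (x : NExpr) (S : ℕ) (hS : x.sz ≤ S) :
    x.cost w s ≤ x.sz * (2 * (S * (B + 1)) + 3) := by
  have key : ∀ x : NExpr, x.sz ≤ S → w (x.eval s) ≤ 2 * (S * (B + 1)) + 3 := fun x hx =>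
    (hG.weight (x.eval_grade hG hs)).trans (by nlinarith [Nat.mul_le_mul_right (B + 1) hx])
  induction x with
  | ofIdx e =>
    have := key _ hS
    have := e.cost_le' hG hs S (by simp only [NExpr.sz] at hS; omega)
    simp only [NExpr.cost, NExpr.sz, NExpr.eval] at *
    nlinarith
  | get a e =>
    have := key _ hS
    have := e.cost_le' hG hs S (by simp only [NExpr.sz] at hS; omega)
    simp only [NExpr.cost, NExpr.sz] at *
    nlinarith
  | add x y ihx ihy | sub x y ihx ihy | mul x y ihx ihy | div x y ihx ihy =>
    have := key _ hS
    have := ihx (by simp only [NExpr.sz] at hS; omega)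
    have := ihy (by simp only [NExpr.sz] at hS; omega)
    simp only [NExpr.cost, NExpr.sz] at *
    nlinarith

theorem BExpr.cost_le' {w : ℝ → ℕ} {G : ℕ → ℝ → Prop} (hG : Grading w G) {B : ℕ} {s : Store}
    (hs : Bdd G B s) (b : BExpr) (S : ℕ) (hS : b.sz ≤ S) :
    b.cost w s ≤ b.sz * (2 * (S * (B + 1)) + 3) := by
  induction b with
  | ile e f =>
    have := e.cost_le' hG hs S (by simp only [BExpr.sz] at hS; omega)
    have := f.cost_le' hG hs S (by simp only [BExpr.sz] at hS; omega)
    simp only [BExpr.cost, BExpr.sz] at *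
    nlinarith
  | nle x y =>
    have := x.cost_le' hG hs S (by simp only [BExpr.sz] at hS; omega)
    have := y.cost_le' hG hs S (by simp only [BExpr.sz] at hS; omega)
    simp only [BExpr.cost, BExpr.sz] at *
    nlinarith
  | not b ih =>
    have := ih (by simp only [BExpr.sz] at hS; omega)
    simp only [BExpr.cost, BExpr.sz] at *
    nlinarith
  | and b c ihb ihc =>
    have := ihb (by simp only [BExpr.sz] at hS; omega)
    have := ihc (by simp only [BExpr.sz] at hS; omega)
    simp only [BExpr.cost, BExpr.sz] at *
    nlinarith

/-- A bound for the cost of an expression of size `S` in a store of complexity `B`. -/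
def exprTime (B S : ℕ) : ℕ := S * (2 * (S * (B + 1)) + 3)

/-- A bound for the cost of a program all of whose loops make at most `N` iterations. -/
def Prog.time (B N : ℕ) : Prog → ℕ
  | .skip => 1
  | .setIdx _ e f => exprTime B e.sz + exprTime B f.sz + 1
  | .setNum _ e x => exprTime B e.sz + exprTime B x.sz + 1
  | .query _ e i _ => exprTime B e.sz + exprTime B i.sz + (2 * B + 3) + 1
  | .seq c d => c.time B N + d.time B N
  | .ite b c d => exprTime B b.sz + (c.time B N + d.time B N)
  | .loop b c => N * (exprTime B b.sz + c.time B N) + exprTime B b.sz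

theorem exists_polynomial_exprTime (S : ℕ) :
    ∃ p : Polynomial ℕ, ∀ B M, B ≤ M → exprTime B S ≤ p.eval M := by
  refine ⟨Polynomial.C S * (2 * (Polynomial.C S * (Polynomial.X + 1)) + 3), fun B M h => ?_⟩
  simp only [exprTime, Polynomial.eval_mul, Polynomial.eval_C, Polynomial.eval_add,
    Polynomial.eval_X, Polynomial.eval_one, Polynomial.eval_ofNat]
  gcongr

theorem Prog.exists_polynomial_time (c : Prog) :
    ∃ p : Polynomial ℕ, ∀ B N M, B ≤ M → N ≤ M → c.time B N ≤ p.eval M := by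
  induction c with
  | skip => exact ⟨1, fun B N M _ _ => by simp [Prog.time]⟩
  | setIdx a e f =>
    obtain ⟨p, hp⟩ := exists_polynomial_exprTime e.sz
    obtain ⟨q, hq⟩ := exists_polynomial_exprTime f.sz
    refine ⟨p + q + 1, fun B N M hB _ => ?_⟩
    simp only [Prog.time, Polynomial.eval_add, Polynomial.eval_one]
    gcongr
    exacts [hp _ _ hB, hq _ _ hB]
  | setNum a e f =>
    obtain ⟨p, hp⟩ := exists_polynomial_exprTime e.sz
    obtain ⟨q, hq⟩ := exists_polynomial_exprTime f.sz
    refine ⟨p + q + 1, fun B N M hB _ => ?_⟩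
    simp only [Prog.time, Polynomial.eval_add, Polynomial.eval_one]
    gcongr
    exacts [hp _ _ hB, hq _ _ hB]
  | query a e f _ =>
    obtain ⟨p, hp⟩ := exists_polynomial_exprTime e.sz
    obtain ⟨q, hq⟩ := exists_polynomial_exprTime f.sz
    refine ⟨p + q + (2 * Polynomial.X + 3) + 1, fun B N M hB _ => ?_⟩
    simp only [Prog.time, Polynomial.eval_add, Polynomial.eval_one, Polynomial.eval_mul,
      Polynomial.eval_X, Polynomial.eval_ofNat]
    gcongr
    exacts [hp _ _ hB, hq _ _ hB]
  | seq c d hc hd =>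
    obtain ⟨p, hp⟩ := hc
    obtain ⟨q, hq⟩ := hd
    refine ⟨p + q, fun B N M hB hN => ?_⟩
    simp only [Prog.time, Polynomial.eval_add]
    exact add_le_add (hp _ _ _ hB hN) (hq _ _ _ hB hN)
  | ite b c d hc hd =>
    obtain ⟨p, hp⟩ := hc
    obtain ⟨q, hq⟩ := hd
    obtain ⟨r, hr⟩ := exists_polynomial_exprTime b.sz
    refine ⟨r + (p + q), fun B N M hB hN => ?_⟩
    simp only [Prog.time, Polynomial.eval_add]
    exact add_le_add (hr _ _ hB) (add_le_add (hp _ _ _ hB hN) (hq _ _ _ hB hN))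
  | loop b c hc =>
    obtain ⟨p, hp⟩ := hc
    obtain ⟨r, hr⟩ := exists_polynomial_exprTime b.sz
    refine ⟨Polynomial.X * (r + p) + r, fun B N M hB hN => ?_⟩
    simp only [Prog.time, Polynomial.eval_add, Polynomial.eval_mul, Polynomial.eval_X]
    exact add_le_add (Nat.mul_le_mul hN (add_le_add (hr _ _ hB) (hp _ _ _ hB hN))) (hr _ _ hB)

/-! ### Weakest preconditions -/

/-- The program, started in `s`, halts with `Q`; all its loops make at most `N` iterations, all the
natural numbers it writes are at most `N`, and all the other numbers it writes satisfy `K`. -/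
def wp (O : ℕ → (ℕ → ℕ) → ℝ) (K : ℝ → Prop) (N : ℕ) : Prog → (Store → Prop) → Store → Prop
  | .skip, Q, s => Q s
  | .setIdx a e f, Q, s => f.eval s ≤ N ∧ Q (s.putIdx a (e.eval s) (f.eval s))
  | .setNum a e x, Q, s => K (x.eval s) ∧ Q (s.putNum a (e.eval s) (x.eval s))
  | .query a e i q, Q, s =>
      K (O (i.eval s) (s.idx q)) ∧ Q (s.putNum a (e.eval s) (O (i.eval s) (s.idx q)))
  | .seq c d, Q, s => wp O K N c (fun s' => wp O K N d Q s') s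
  | .ite b c d, Q, s => (b.eval s → wp O K N c Q s) ∧ (¬ b.eval s → wp O K N d Q s)
  | .loop b c, Q, s => ∃ J : ℕ → Store → Prop, J 0 s ∧ ∀ k s', J k s' →
      (b.eval s' → k < N ∧ wp O K N c (J (k + 1)) s') ∧ (¬ b.eval s' → Q s')

section

variable {O : ℕ → (ℕ → ℕ) → ℝ} {K : ℝ → Prop} {N : ℕ}

theorem wp_mono {c : Prog} {Q Q' : Store → Prop} (h : ∀ s, Q s → Q' s) {s : Store}
    (hc : wp O K N c Q s) : wp O K N c Q' s := by
  induction c generalizing Q Q' s with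
  | skip => exact h _ hc
  | setIdx => exact ⟨hc.1, h _ hc.2⟩
  | setNum => exact ⟨hc.1, h _ hc.2⟩
  | query => exact ⟨hc.1, h _ hc.2⟩
  | seq c d ihc ihd => exact ihc (fun s hs => ihd h hs) hc
  | ite b c d ihc ihd => exact ⟨fun hb => ihc h (hc.1 hb), fun hb => ihd h (hc.2 hb)⟩
  | loop b c ih =>
    obtain ⟨J, h0, hJ⟩ := hc
    exact ⟨J, h0, fun k s' hs => ⟨(hJ k s' hs).1, fun hb => h _ ((hJ k s' hs).2 hb)⟩⟩

theorem Bdd.putIdx {G : ℕ → ℝ → Prop} {B : ℕ} {s : Store} (hs : Bdd G B s) (a j k : ℕ)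
    (hk : k ≤ 2 ^ B) : Bdd G B (s.putIdx a j k) := by
  refine ⟨fun a' j' => ?_, hs.num⟩
  simp only [Store.putIdx]
  split_ifs
  exacts [hk, hs.idx _ _]

theorem Bdd.putNum {G : ℕ → ℝ → Prop} {B : ℕ} {s : Store} (hs : Bdd G B s) (a j : ℕ) (x : ℝ)
    (hx : G B x) : Bdd G B (s.putNum a j x) := by
  refine ⟨hs.idx, fun a' j' => ?_⟩
  simp only [Store.putNum]
  split_ifs
  exacts [hx, hs.num _ _]

/-- Soundness of `wp`. All cells keep complexity at most `B` throughout the run, so each evaluation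
has a cost bounded in terms of `B` and the program text alone. -/
theorem exec_of_wp {w : ℝ → ℕ} {G : ℕ → ℝ → Prop} (hG : Grading w G) {B : ℕ} (hN : N ≤ 2 ^ B)
    {c : Prog} {Q : Store → Prop} {s : Store} (hs : Bdd G B s) (hc : wp O (G B) N c Q s) :
    ∃ s' t, Exec w O c s s' t ∧ t ≤ c.time B N ∧ Bdd G B s' ∧ Q s' := by
  induction c generalizing Q s with
  | skip => exact ⟨s, 1, .skip s, le_rfl, hs, hc⟩
  | setIdx a e f =>
    refine ⟨_, _, .setIdx a e f s, ?_, hs.putIdx _ _ _ (hc.1.trans hN), hc.2⟩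
    have := e.cost_le' hG hs _ le_rfl
    have := f.cost_le' hG hs _ le_rfl
    simp only [Prog.time, exprTime]
    omega
  | setNum a e f =>
    refine ⟨_, _, .setNum a e f s, ?_, hs.putNum _ _ _ hc.1, hc.2⟩
    have := e.cost_le' hG hs _ le_rfl
    have := f.cost_le' hG hs _ le_rfl
    simp only [Prog.time, exprTime]
    omega
  | query a e i q =>
    refine ⟨_, _, .query a e i q s, ?_, hs.putNum _ _ _ hc.1, hc.2⟩
    have := e.cost_le' hG hs _ le_rfl
    have := i.cost_le' hG hs _ le_rfl
    have := hG.weight hc.1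
    simp only [Prog.time, exprTime]
    omega
  | seq c d ihc ihd =>
    obtain ⟨s1, t1, h1, ht1, hs1, hd⟩ := ihc hs hc
    obtain ⟨s2, t2, h2, ht2, hs2, hQ⟩ := ihd hs1 hd
    exact ⟨s2, _, .seq _ _ _ _ _ _ _ h1 h2, add_le_add ht1 ht2, hs2, hQ⟩
  | ite b c d ihc ihd =>
    have hb := b.cost_le' hG hs _ le_rfl
    by_cases h : b.eval s
    · obtain ⟨s1, t1, h1, ht1, hs1, hQ⟩ := ihc hs (hc.1 h)
      refine ⟨s1, _, .ite_true _ _ _ _ _ _ h h1, ?_, hs1, hQ⟩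
      simp only [Prog.time, exprTime]
      omega
    · obtain ⟨s1, t1, h1, ht1, hs1, hQ⟩ := ihd hs (hc.2 h)
      refine ⟨s1, _, .ite_false _ _ _ _ _ _ h h1, ?_, hs1, hQ⟩
      simp only [Prog.time, exprTime]
      omega
  | loop b c ih =>
    obtain ⟨J, h0, hJ⟩ := hc
    -- Induction on the number `r` of iterations still allowed; at `r = 0` the test must fail, since
    -- entering the body requires `k < N`.
    have key : ∀ r k s, k + r = N → Bdd G B s → J k s → ∃ s' t, Exec w O (.loop b c) s s' t ∧
        t ≤ r * (exprTime B b.sz + c.time B N) + exprTime B b.sz ∧ Bdd G B s' ∧ Q s' := by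
      intro r
      induction r with
      | zero =>
        intro k s hk hs hjs
        by_cases h : b.eval s
        · exact absurd ((hJ k s hjs).1 h).1 (by omega)
        · exact ⟨s, _, .loop_false _ _ _ h,
            by have := b.cost_le' hG hs _ le_rfl; simp only [exprTime]; omega,
            hs, (hJ k s hjs).2 h⟩
      | succ r ihr =>
        intro k s hk hs hjs
        have hb := b.cost_le' hG hs _ le_rfl
        by_cases h : b.eval s
        · obtain ⟨s1, t1, h1, ht1, hs1, hj1⟩ := ih hs ((hJ k s hjs).1 h).2
          obtain ⟨s2, t2, h2, ht2, hs2, hQ⟩ := ihr (k + 1) s1 (by omega) hs1 hj1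
          refine ⟨s2, _, .loop_true _ _ _ _ _ _ _ h h1 h2, ?_, hs2, hQ⟩
          rw [Nat.succ_mul]
          simp only [exprTime] at *
          omega
        · refine ⟨s, _, .loop_false _ _ _ h, ?_, hs, (hJ k s hjs).2 h⟩
          simp only [exprTime] at *
          omega
    exact key N 0 s (by omega) hs h0

/-! ### Frames -/

/-- The arrays of natural numbers that a program may change. -/
def Prog.modI : Prog → List ℕ
  | .skip => []
  | .setIdx a _ _ => [a]
  | .setNum _ _ _ => []
  | .query _ _ _ _ => []
  | .seq c d => c.modI ++ d.modI
  | .ite _ c d => c.modI ++ d.modI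
  | .loop _ c => c.modI

/-- The arrays of numbers that a program may change. -/
def Prog.modN : Prog → List ℕ
  | .skip => []
  | .setIdx _ _ _ => []
  | .setNum a _ _ => [a]
  | .query a _ _ _ => [a]
  | .seq c d => c.modN ++ d.modN
  | .ite _ c d => c.modN ++ d.modN
  | .loop _ c => c.modN

/-- The stores `s` and `s'` agree on all arrays that `c` does not change. -/
structure Frame (c : Prog) (s s' : Store) : Prop where
  idx : ∀ a, a ∉ c.modI → s'.idx a = s.idx a
  num : ∀ a, a ∉ c.modN → s'.num a = s.num a

theorem Frame.rfl {c : Prog} {s : Store} : Frame c s s := ⟨fun _ _ => by rfl, fun _ _ => by rfl⟩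

theorem Frame.trans {c : Prog} {s s' s'' : Store} (h : Frame c s s') (h' : Frame c s' s'') :
    Frame c s s'' :=
  ⟨fun a ha => (h'.idx a ha).trans (h.idx a ha), fun a ha => (h'.num a ha).trans (h.num a ha)⟩

theorem Frame.weaken {c d : Prog} {s s' : Store} (h : Frame c s s') (hI : c.modI ⊆ d.modI)
    (hN : c.modN ⊆ d.modN) : Frame d s s' :=
  ⟨fun a ha => h.idx a fun h' => ha (hI h'), fun a ha => h.num a fun h' => ha (hN h')⟩

/-- The arrays a program may change are read off its text, so invariance of all the others can be
added to any postcondition for free. -/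
theorem wp_frame {c : Prog} {Q : Store → Prop} {s : Store} (hc : wp O K N c Q s) :
    wp O K N c (fun s' => Frame c s s' ∧ Q s') s := by
  induction c generalizing Q s with
  | skip => exact ⟨Frame.rfl, hc⟩
  | setIdx a e f =>
    refine ⟨hc.1, ⟨fun a' ha' => ?_, fun a' ha' => by rfl⟩, hc.2⟩
    simp only [Prog.modI, List.mem_singleton] at ha'
    funext j
    simp [Store.putIdx, ha']
  | setNum a e f =>
    refine ⟨hc.1, ⟨fun a' ha' => by rfl, fun a' ha' => ?_⟩, hc.2⟩
    simp only [Prog.modN, List.mem_singleton] at ha'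
    funext j
    simp [Store.putNum, ha']
  | query a e f =>
    refine ⟨hc.1, ⟨fun a' ha' => by rfl, fun a' ha' => ?_⟩, hc.2⟩
    simp only [Prog.modN, List.mem_singleton] at ha'
    funext j
    simp [Store.putNum, ha']
  | seq c d ihc ihd =>
    refine wp_mono (c := c) (fun s1 h1 => ?_) (ihc hc)
    refine wp_mono (fun s2 h2 => ?_) (ihd h1.2)
    exact ⟨(h1.1.weaken (List.subset_append_left _ _) (List.subset_append_left _ _)).trans
      (h2.1.weaken (List.subset_append_right _ _) (List.subset_append_right _ _)), h2.2⟩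
  | ite b c d ihc ihd =>
    exact ⟨fun hb => wp_mono (fun s1 h1 => ⟨h1.1.weaken (List.subset_append_left _ _)
        (List.subset_append_left _ _), h1.2⟩) (ihc (hc.1 hb)),
      fun hb => wp_mono (fun s1 h1 => ⟨h1.1.weaken (List.subset_append_right _ _)
        (List.subset_append_right _ _), h1.2⟩) (ihd (hc.2 hb))⟩
  | loop b c ih =>
    obtain ⟨J, h0, hJ⟩ := hc
    refine ⟨fun k s' => Frame c s s' ∧ J k s', ⟨Frame.rfl, h0⟩, fun k s' hs => ?_⟩
    obtain ⟨h1, h2⟩ := hJ k s' hs.2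
    exact ⟨fun hb => ⟨(h1 hb).1, wp_mono (fun s2 h2 => ⟨hs.1.trans h2.1, h2.2⟩) (ih (h1 hb).2)⟩,
      fun hb => ⟨⟨hs.1.idx, hs.1.num⟩, h2 hb⟩⟩

/-- Sequencing, with the frame of the first program. -/
theorem wp_seq {c d : Prog} {Q : Store → Prop} {s : Store} (P : Store → Prop)
    (hc : wp O K N c P s) (hd : ∀ s', Frame c s s' → P s' → wp O K N d Q s') :
    wp O K N (.seq c d) Q s :=
  wp_mono (fun s' h => hd s' h.1 h.2) (wp_frame hc)

/-- `for ctr < bd do body`, where the bound is in cell `0` of the array `bd`. -/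
def forLoop (ctr bd : ℕ) (body : Prog) : Prog :=
  .seq (.setIdx ctr (.const 0) (.const 0))
    (.loop (.not (.ile (.get bd (.const 0)) (.get ctr (.const 0))))
      (.seq body (.setIdx ctr (.const 0) (.add (.get ctr (.const 0)) (.const 1)))))

@[simp] theorem Store.putIdx_idx (s : Store) (a j k a' j' : ℕ) :
    (s.putIdx a j k).idx a' j' = if a' = a ∧ j' = j then k else s.idx a' j' := by rfl

@[simp] theorem Store.putIdx_num (s : Store) (a j k : ℕ) : (s.putIdx a j k).num = s.num := by rfl

@[simp] theorem Store.putNum_num (s : Store) (a j : ℕ) (x : ℝ) (a' j' : ℕ) :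
    (s.putNum a j x).num a' j' = if a' = a ∧ j' = j then x else s.num a' j' := by rfl

@[simp] theorem Store.putNum_idx (s : Store) (a j : ℕ) (x : ℝ) :
    (s.putNum a j x).idx = s.idx := by rfl

theorem Store.putIdx_idx_of_ne (s : Store) {a a' : ℕ} (h : a' ≠ a) (j k : ℕ) :
    (s.putIdx a j k).idx a' = s.idx a' := by
  funext j'
  simp [h]

theorem Store.putNum_num_of_ne (s : Store) {a a' : ℕ} (h : a' ≠ a) (j : ℕ) (x : ℝ) :
    (s.putNum a j x).num a' = s.num a' := by
  funext j'
  simp [h]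

/-- The body touches neither the counter nor the bound, so the counter is the iteration number. The
invariant is demanded after the increment of the counter. -/
theorem wp_forLoop {ctr bd : ℕ} {body : Prog} {Q : Store → Prop} {s : Store}
    (J : ℕ → Store → Prop) (M : ℕ) (hM : s.idx bd 0 = M) (hMN : M ≤ N)
    (hctr : ctr ∉ body.modI) (hbd : bd ∉ body.modI) (hne : bd ≠ ctr)
    (h0 : J 0 (s.putIdx ctr 0 0))
    (hstep : ∀ k < M, ∀ s1, Frame (forLoop ctr bd body) s s1 → s1.idx ctr 0 = k → J k s1 →
      wp O K N body (fun s2 => J (k + 1) (s2.putIdx ctr 0 (k + 1))) s1)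
    (hQ : ∀ s1, Frame (forLoop ctr bd body) s s1 → J M s1 → Q s1) :
    wp O K N (forLoop ctr bd body) Q s := by
  have hF : Frame (forLoop ctr bd body) s (s.putIdx ctr 0 0) :=
    ⟨fun a ha => Store.putIdx_idx_of_ne _ (fun h => ha (by simp [forLoop, Prog.modI, h])) _ _,
      fun a _ => by rfl⟩
  refine ⟨Nat.zero_le _, fun k s1 => k ≤ M ∧ s1.idx ctr 0 = k ∧
    Frame (forLoop ctr bd body) s s1 ∧ J k s1, ⟨Nat.zero_le _, by simp [IExpr.eval], hF, h0⟩, ?_⟩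
  rintro k s1 ⟨hkM, hk, hf, hj⟩
  have hb1 : s1.idx bd 0 = M := by
    rw [hf.idx bd (by simp [forLoop, Prog.modI, hbd, hne]), hM]
  simp only [BExpr.eval, IExpr.eval, hb1, hk, not_le, not_lt]
  refine ⟨fun hlt => ⟨hlt.trans_le hMN, ?_⟩, fun hle => hQ s1 hf ?_⟩
  · refine wp_mono (c := body) (fun s2 h2 => ?_) (wp_frame (hstep k hlt s1 hf hk hj))
    obtain ⟨hf2, hj2⟩ := h2
    have hc2 : s2.idx ctr 0 = k := by rw [hf2.idx ctr hctr, hk]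
    simp only [wp, IExpr.eval, hc2]
    refine ⟨by omega, by omega, by simp, ?_, hj2⟩
    refine hf.trans ((hf2.weaken (by simp [forLoop, Prog.modI])
      (by simp [forLoop, Prog.modN])).trans ⟨fun a ha => Store.putIdx_idx_of_ne _
        (fun h => ha (by simp [forLoop, Prog.modI, h])) _ _, fun a _ => by rfl⟩)
  · have : k = M := by omega
    exact this ▸ hj

end

/-! ### Executions are deterministic -/

/-- The weights may differ: this identifies the outcomes of the uniform and the logarithmic runs, so
that a single allocation serves both time bounds. -/
theorem Exec.unique {w w' : ℝ → ℕ} {O : ℕ → (ℕ → ℕ) → ℝ} {c : Prog} {s s1 s2 : Store} {t1 t2 : ℕ}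
    (h1 : Exec w O c s s1 t1) (h2 : Exec w' O c s s2 t2) : s1 = s2 := by
  induction h1 generalizing s2 t2 with
  | skip | setIdx | setNum | query => cases h2; rfl
  | seq c d s s' s'' t t' _ _ ihc ihd =>
    cases h2 with
    | seq _ _ _ r _ _ _ hc hd =>
      obtain rfl := ihc hc
      exact ihd hd
  | ite_true b c d s s' t hb _ ih =>
    cases h2 with
    | ite_true _ _ _ _ _ _ _ h => exact ih h
    | ite_false _ _ _ _ _ _ hb' _ => exact absurd hb hb'
  | ite_false b c d s s' t hb _ ih =>
    cases h2 with
    | ite_true _ _ _ _ _ _ hb' _ => exact absurd hb' hb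
    | ite_false _ _ _ _ _ _ _ h => exact ih h
  | loop_true b c s s' s'' t t' hb _ _ ihc ihd =>
    cases h2 with
    | loop_true _ _ _ _ _ _ _ _ hc hd =>
      obtain rfl := ihc hc
      exact ihd hd
    | loop_false _ _ _ hb' => exact absurd hb hb'
  | loop_false b c s hb =>
    cases h2 with
    | loop_true _ _ _ _ _ _ _ hb' _ _ => exact absurd hb' hb
    | loop_false _ _ _ _ => rfl

/-! ### The two gradings -/

theorem grading_unitWeight : Grading unitWeight fun _ _ => True where
  mono _ _ := trivial
  nat _ := trivial
  add _ _ := trivial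
  sub _ _ := trivial
  mul _ _ := trivial
  div _ _ := trivial
  weight _ := by simp only [unitWeight]; omega

/-- The number `x` is a fraction of integers of absolute value at most `2 ^ B`. -/
def FracBits (B : ℕ) (x : ℝ) : Prop :=
  ∃ (a : ℤ) (d : ℕ), 0 < d ∧ x = (a : ℝ) / (d : ℝ) ∧ a.natAbs ≤ 2 ^ B ∧ d ≤ 2 ^ B

theorem HasBits.fracBits {x : ℝ} {L : ℕ} (h : HasBits x L) : FracBits L x := by
  obtain ⟨a, d, hd, hx, hs⟩ := h
  exact ⟨a, d, hd, hx, (Nat.size_le.1 (by omega)).le, (Nat.size_le.1 (by omega)).le⟩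

theorem FracBits.bitWeight_le {x : ℝ} {B : ℕ} (h : FracBits B x) : bitWeight x ≤ 2 * B + 3 := by
  obtain ⟨a, d, hd, hx, ha, hdB⟩ := h
  have key : ∀ k : ℕ, k ≤ 2 ^ B → k.size ≤ B + 1 := fun k hk =>
    Nat.size_le.2 (hk.trans_lt (Nat.pow_lt_pow_right (by norm_num) (by omega)))
  have : sInf {L | HasBits x L} ≤ 2 * B + 2 :=
    Nat.sInf_le ⟨a, d, hd, hx, by have := key _ ha; have := key _ hdB; omega⟩
  simp only [bitWeight]
  omega

/-- The two summands in the bound on `p` are what the numerator of a sum of fractions needs; they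
account for the extra one in the level. -/
theorem FracBits.of_eq {a b : ℕ} {x : ℝ} (p : ℤ) (q : ℕ) (hq : 0 < q) (hx : x = p / q)
    (hp : p.natAbs ≤ 2 ^ (a + b) + 2 ^ (a + b)) (hq' : q ≤ 2 ^ (a + b)) :
    FracBits (a + b + 1) x :=
  ⟨p, q, hq, hx, by rw [pow_succ]; omega, hq'.trans (Nat.pow_le_pow_right (by norm_num) (by omega))⟩

theorem grading_bitWeight : Grading bitWeight FracBits where
  mono := by
    rintro a b x hab ⟨p, q, hq, hx, hp, hq'⟩
    have : 2 ^ a ≤ 2 ^ b := Nat.pow_le_pow_right (by norm_num) hab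
    exact ⟨p, q, hq, hx, hp.trans this, hq'.trans this⟩
  nat := by
    intro B k hk
    exact ⟨k, 1, one_pos, by simp, by simpa using hk, Nat.one_le_two_pow⟩
  add := by
    rintro a b x y ⟨p, q, hq, rfl, hp, hq'⟩ ⟨p', q', hq1, rfl, hp', hq1'⟩
    refine .of_eq (p * q' + p' * q) (q * q') (by positivity) ?_ ?_ ?_
    · push_cast; field_simp
    · refine (Int.natAbs_add_le _ _).trans ?_
      rw [Int.natAbs_mul, Int.natAbs_mul, Int.natAbs_natCast, Int.natAbs_natCast]
      refine add_le_add ?_ ?_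
      · rw [pow_add]; exact Nat.mul_le_mul hp hq1'
      · rw [pow_add, mul_comm]; exact Nat.mul_le_mul hq' hp'
    · rw [pow_add]; exact Nat.mul_le_mul hq' hq1'
  sub := by
    rintro a b x y ⟨p, q, hq, rfl, hp, hq'⟩ ⟨p', q', hq1, rfl, hp', hq1'⟩
    refine .of_eq (p * q' - p' * q) (q * q') (by positivity) ?_ ?_ ?_
    · push_cast; field_simp
    · refine (Int.natAbs_sub_le _ _).trans ?_
      rw [Int.natAbs_mul, Int.natAbs_mul, Int.natAbs_natCast, Int.natAbs_natCast]
      refine add_le_add ?_ ?_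
      · rw [pow_add]; exact Nat.mul_le_mul hp hq1'
      · rw [pow_add, mul_comm]; exact Nat.mul_le_mul hq' hp'
    · rw [pow_add]; exact Nat.mul_le_mul hq' hq1'
  mul := by
    rintro a b x y ⟨p, q, hq, rfl, hp, hq'⟩ ⟨p', q', hq1, rfl, hp', hq1'⟩
    refine .of_eq (p * p') (q * q') (by positivity) ?_ ?_ ?_
    · push_cast; field_simp
    · rw [Int.natAbs_mul, pow_add]
      exact (Nat.mul_le_mul hp hp').trans (Nat.le_add_right _ _)
    · rw [pow_add]; exact Nat.mul_le_mul hq' hq1'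
  div := by
    rintro a b x y ⟨p, q, hq, rfl, hp, hq'⟩ ⟨p', q', hq1, rfl, hp', hq1'⟩
    rcases eq_or_ne p' 0 with rfl | h0
    · exact .of_eq 0 1 one_pos (by simp) (by simp) Nat.one_le_two_pow
    -- Moving the sign of `p'` into the numerator keeps the denominator a positive natural number.
    · refine .of_eq (p * q' * p'.sign) (q * p'.natAbs) (by positivity) ?_ ?_ ?_
      · have hs : ((p'.natAbs : ℕ) : ℝ) * (p'.sign : ℝ) = p' := by
          rw [← Int.cast_natCast, ← Int.cast_mul, mul_comm, Int.sign_mul_natAbs]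
        have hs2 : (p'.sign : ℝ) * (p'.sign : ℝ) = 1 := by
          rcases lt_or_gt_of_ne h0 with h | h
          · simp [Int.sign_eq_neg_one_of_neg h]
          · simp [Int.sign_eq_one_of_pos h]
        have h1 : ((p'.natAbs : ℕ) : ℝ) ≠ 0 := by positivity
        have h2 : (p'.sign : ℝ) ≠ 0 := fun h => by simp [h] at hs2
        have h3 : (q : ℝ) ≠ 0 := by positivity
        have h4 : (q' : ℝ) ≠ 0 := by positivity
        rw [← hs]
        push_cast
        field_simp
        linear_combination (-(p : ℝ)) * hs2
      · rw [Int.natAbs_mul, Int.natAbs_sign_of_ne_zero h0, mul_one, Int.natAbs_mul,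
          Int.natAbs_natCast, pow_add]
        exact (Nat.mul_le_mul hp hq1').trans (Nat.le_add_right _ _)
      · rw [pow_add]; exact Nat.mul_le_mul hq' hp'
  weight h := h.bitWeight_le

end FairAlloc

end

/-! ### The AnyPrice share, and recognition of the classes of valuations. -/

noncomputable section

namespace FairAlloc

/-! ### Bounds for the AnyPrice share -/

section AnyPrice

variable {m : ℕ} {v : Finset (Fin m) → ℝ} {b : ℝ}

theorem bddAbove_affordable (p : Fin m → ℝ) :
    BddAbove (v '' {S : Finset (Fin m) | ∑ j ∈ S, p j ≤ b}) :=
  ((Set.toFinite _).image v).bddAbove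

/-- Prices of total at most `c` may be used with budget `c * b`: after division by `c` the missing
mass is put on one item, which only makes bundles dearer. -/
theorem anyPrice_le (h0 : v ∅ = 0) (hb : 0 ≤ b) {p : Fin m → ℝ} (hp : ∀ j, 0 ≤ p j) {c V : ℝ}
    (hc : 0 < c) (hpc : ∑ j, p j ≤ c) (hV : ∀ T, ∑ j ∈ T, p j ≤ c * b → v T ≤ V) :
    anyPrice b v ≤ V := by
  rcases Nat.eq_zero_or_pos m with rfl | hm
  -- Without items there are no price vectors, and the infimum of an empty family of reals is 0.
  · have : IsEmpty (stdSimplex ℝ (Fin 0)) := ⟨fun q => by simpa using q.2.2⟩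
    rw [anyPrice, Real.iInf_of_isEmpty, ← h0]
    exact hV ∅ (by simpa using by positivity)
  · let j0 : Fin m := ⟨0, hm⟩
    let r : ℝ := 1 - (∑ j, p j) / c
    have hr : 0 ≤ r := sub_nonneg.2 ((div_le_one hc).2 hpc)
    let q : Fin m → ℝ := fun j => p j / c + if j = j0 then r else 0
    have hpq : ∀ j, p j / c ≤ q j := fun j => by
      simp only [q]
      split_ifs <;> linarith
    have hq : q ∈ stdSimplex ℝ (Fin m) := by
      refine ⟨fun j => (div_nonneg (hp j) hc.le).trans (hpq j), ?_⟩
      simp only [q, Finset.sum_add_distrib, Finset.sum_ite_eq', Finset.mem_univ, if_true,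
        ← Finset.sum_div, r]
      ring
    have hbelow : BddBelow (Set.range fun p : stdSimplex ℝ (Fin m) =>
        sSup (v '' {S : Finset (Fin m) | ∑ j ∈ S, (p : Fin m → ℝ) j ≤ b})) := by
      refine ⟨0, ?_⟩
      rintro _ ⟨p, rfl⟩
      exact le_csSup (bddAbove_affordable _) ⟨∅, by simpa using hb, h0⟩
    refine (ciInf_le hbelow ⟨q, hq⟩).trans (csSup_le ⟨v ∅, ∅, by simpa using hb, rfl⟩ ?_)
    rintro _ ⟨T, hT, rfl⟩
    refine hV T ?_
    have h1 : ∑ j ∈ T, p j / c ≤ b := (Finset.sum_le_sum fun j _ => hpq j).trans hT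
    rw [← Finset.sum_div, div_le_iff₀ hc] at h1
    linarith

theorem le_anyPrice (hm : 0 < m) {V : ℝ}
    (hV : ∀ p ∈ stdSimplex ℝ (Fin m), ∃ T, ∑ j ∈ T, p j ≤ b ∧ V ≤ v T) : V ≤ anyPrice b v := by
  have : Nonempty (stdSimplex ℝ (Fin m)) := ⟨⟨_, single_mem_stdSimplex ℝ (⟨0, hm⟩ : Fin m)⟩⟩
  refine le_ciInf fun p => ?_
  obtain ⟨T, hT, hVT⟩ := hV p p.2
  exact hVT.trans (le_csSup (bddAbove_affordable _) ⟨T, hT, rfl⟩)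

theorem anyPrice_le_univ (h0 : v ∅ = 0) (hmono : ∀ S T, S ⊆ T → v S ≤ v T) (hb : 0 ≤ b) :
    anyPrice b v ≤ v Finset.univ :=
  anyPrice_le h0 hb (p := 0) (fun _ => le_rfl) one_pos (by simp)
    fun T _ => hmono _ _ (Finset.subset_univ T)

/-- The items of positive value. -/
def posItems (v : Finset (Fin m) → ℝ) : Finset (Fin m) := Finset.univ.filter fun j => 0 < v {j}

theorem mem_posItems {j : Fin m} : j ∈ posItems v ↔ 0 < v {j} := by simp [posItems]

theorem le_add_sum_marginals (hsub : IsSubmodular v) (X T : Finset (Fin m)) :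
    v (X ∪ T) ≤ v X + ∑ j ∈ T, (v (insert j X) - v X) := by
  classical
  induction T using Finset.induction_on with
  | empty => simp
  | insert a T ha ih =>
    rw [Finset.sum_insert ha]
    by_cases haX : a ∈ X
    · rw [Finset.union_insert, Finset.insert_eq_self.2 (Finset.mem_union_left _ haX),
        Finset.insert_eq_self.2 haX]
      linarith
    · have h := hsub (X ∪ T) (insert a X)
      have h1 : X ∪ T ∪ insert a X = X ∪ insert a T := by
        ext j; simp only [Finset.mem_union, Finset.mem_insert]; tauto
      have h2 : (X ∪ T) ∩ insert a X = X := by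
        ext j
        simp only [Finset.mem_inter, Finset.mem_union, Finset.mem_insert]
        constructor
        · rintro ⟨hl | hl, rfl | hr⟩
          exacts [hl, hl, absurd hl ha, hr]
        · exact fun h => ⟨.inl h, .inr h⟩
      rw [h1, h2] at h
      linarith

theorem marginal_anti (hsub : IsSubmodular v) (hmono : ∀ S T, S ⊆ T → v S ≤ v T)
    {X Y : Finset (Fin m)} (hXY : X ⊆ Y) (j : Fin m) :
    v (insert j Y) - v Y ≤ v (insert j X) - v X := by
  by_cases hj : j ∈ Y
  · rw [Finset.insert_eq_self.2 hj]
    linarith [hmono X (insert j X) (Finset.subset_insert _ _)]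
  · have h := hsub Y (insert j X)
    have h1 : Y ∪ insert j X = insert j Y := by
      rw [Finset.union_insert, Finset.union_eq_left.2 hXY]
    have h2 : Y ∩ insert j X = X := by
      rw [Finset.inter_insert_of_notMem hj, Finset.inter_eq_right.2 hXY]
    rw [h1, h2] at h
    linarith

theorem le_sum_singletons (h0 : v ∅ = 0) (hsub : IsSubmodular v) (T : Finset (Fin m)) :
    v T ≤ ∑ j ∈ T, v {j} := by
  have := le_add_sum_marginals hsub ∅ T
  simpa [h0] using this

/-- Price 1 on each positive item puts all of them out of reach of the budget, and by submodularity
a bundle of worthless items is worthless. -/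
theorem anyPrice_le_zero (h0 : v ∅ = 0)
    (hsub : IsSubmodular v) (hb : 0 ≤ b) (h : b * (posItems v).card < 1) : anyPrice b v ≤ 0 := by
  have hz : ∀ T : Finset (Fin m), (∀ j ∈ T, j ∉ posItems v) → v T ≤ 0 := fun T hT =>
    (le_sum_singletons h0 hsub T).trans (Finset.sum_nonpos fun j hj =>
      not_lt.1 fun h => hT j hj (mem_posItems.2 h))
  rcases Finset.eq_empty_or_nonempty (posItems v) with he | hne
  · exact anyPrice_le h0 hb (p := 0) (fun _ => le_rfl) one_pos (by simp)
      fun T _ => hz T (by simp [he])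
  · have hP : (0 : ℝ) < (posItems v).card := by exact_mod_cast hne.card_pos
    refine anyPrice_le h0 hb (p := fun j => if j ∈ posItems v then 1 else 0)
      (fun j => by positivity) hP (by simp) fun T hT => hz T fun j hj hjP => ?_
    have : (1 : ℝ) ≤ ∑ j ∈ T, if j ∈ posItems v then (1 : ℝ) else 0 := by
      refine le_trans ?_ (Finset.single_le_sum (f := fun j => if j ∈ posItems v then (1 : ℝ) else 0)
        (fun j _ => by positivity) hj)
      simp [hjP]
    linarith [mul_comm b ((posItems v).card : ℝ)]

/-- By averaging, prices of total 1 cannot exceed `b` on every positive item, so one of these is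
affordable. -/
theorem le_anyPrice_of_posItems (h : 1 ≤ b * (posItems v).card) {V : ℝ}
    (hV : ∀ j, 0 < v {j} → V ≤ v {j}) : V ≤ anyPrice b v := by
  have hne : (posItems v).Nonempty := by
    rw [Finset.nonempty_iff_ne_empty]
    intro h'
    rw [h'] at h
    norm_num at h
  have hP : (0 : ℝ) < (posItems v).card := by exact_mod_cast hne.card_pos
  obtain ⟨i, -⟩ := id hne
  refine le_anyPrice i.pos fun p hp => ?_
  by_contra! hcon
  have h1 : ∑ j ∈ posItems v, b < ∑ j ∈ posItems v, p j := by
    refine Finset.sum_lt_sum_of_nonempty hne fun j hj => ?_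
    by_contra! hlt
    have := hcon {j} (by simpa using hlt)
    exact absurd (hV j (mem_posItems.1 hj)) (not_le.2 this)
  have h2 : ∑ j ∈ posItems v, p j ≤ 1 := by
    rw [← hp.2]
    exact Finset.sum_le_sum_of_subset_of_nonneg (Finset.subset_univ _) fun j _ _ => hp.1 j
  rw [Finset.sum_const, nsmul_eq_mul] at h1
  linarith [mul_comm b ((posItems v).card : ℝ)]

theorem one_le_mul_of_posItems (hb : 0 ≤ b) (h : 1 ≤ b * (posItems v).card) : 1 ≤ b * m := by
  have : ((posItems v).card : ℝ) ≤ m := by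
    exact_mod_cast (Finset.card_le_univ _).trans (Fintype.card_fin m).le
  nlinarith

end AnyPrice

/-! ### Recognizing unit-demand and additive valuations -/

section Classes

variable {m : ℕ} {v : Finset (Fin m) → ℝ}

/-- The bundle of all items that are not more valuable than the item `j` is worth `v {j}`. -/
def UnitDemandTest (v : Finset (Fin m) → ℝ) : Prop :=
  ∀ j, v (Finset.univ.filter fun k => v {k} ≤ v {j}) ≤ v {j}

theorem IsUnitDemand.test (h : IsUnitDemand v) : UnitDemandTest v := by
  intro j
  obtain ⟨k, hk, hkv⟩ := (h.2 (Finset.univ.filter fun k => v {k} ≤ v {j}) ⟨j, by simp⟩).1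
  simp only [Finset.coe_filter, Finset.mem_univ, true_and, Set.mem_ofPred_eq] at hk
  rw [← hkv]
  exact hk

/-- The test involves only `m` bundles but controls all: `T` lies in the bundle of the items that do
not exceed its best item. -/
theorem UnitDemandTest.le (h : UnitDemandTest v) (h0 : v ∅ = 0)
    (hmono : ∀ S T, S ⊆ T → v S ≤ v T) {V : ℝ} (hV : 0 ≤ V) {T : Finset (Fin m)}
    (hT : ∀ j ∈ T, v {j} ≤ V) : v T ≤ V := by
  rcases T.eq_empty_or_nonempty with rfl | hne
  · rwa [h0]
  · obtain ⟨j, hj, hmax⟩ := T.exists_max_image (fun j => v {j}) hne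
    exact ((hmono _ _ fun k hk => by simpa using hmax k hk).trans (h j)).trans (hT j hj)

/-- The sum of the single values is an upper bound on `S` and on `Sᶜ`; no loss on the whole set
leaves no room for a loss on either part. -/
theorem isAdditive_of_sum_le (h0 : v ∅ = 0) (hsub : IsSubmodular v)
    (h : ∑ j, v {j} ≤ v Finset.univ) : IsAdditive v := by
  intro S
  refine le_antisymm (le_sum_singletons h0 hsub S) ?_
  have h1 := hsub S Sᶜ
  rw [Finset.union_compl, Finset.inter_compl, h0] at h1
  have h2 := le_sum_singletons h0 hsub Sᶜ
  rw [← Finset.sum_add_sum_compl S] at h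
  linarith

end Classes

end FairAlloc

end

/-! ### Bidding rules; unit-demand and submodular agents. -/

noncomputable section

namespace FairAlloc

/-! ### Bids -/

/-- The bid of a unit-demand agent with entitlement `b`, if her bundle is worth `x` and the best
free item increases this by `d`. -/
def bidUnitDemand (b x d : ℝ) : ℝ := if x ≤ 0 then (if d ≤ 0 then 0 else b) else 0

/-- The bid of a submodular agent who aims at a third of `z`. -/
def bidSubmodular (b z x d : ℝ) : ℝ :=
  if z ≤ 3 * x then 0 else if z ≤ 3 * d then b else 3 * d * b / (2 * z)

/-- The bid of an additive agent with less than two fifths of `z`, if the best free item has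
value `d`. -/
def earlyBid (b z d : ℝ) : ℝ :=
  if 3 * z ≤ 5 * d then b else if 2 * z ≤ 5 * d then b / 2 else 5 * d * b / (4 * z)

/-- The bid of an additive agent who had value `x₀` and remaining budget `β` when her bundle
reached two fifths of `z`. -/
def lateBid (z x₀ β d : ℝ) : ℝ :=
  if 3 * z - 5 * x₀ ≤ 5 * d then β else 5 * d * β / (2 * (3 * z - 5 * x₀))

/-- The bid of an additive agent who aims at three fifths of `z`. -/
def bidAdditive (b z x x₀ β d : ℝ) : ℝ :=
  if 3 * z ≤ 5 * x then 0 else if 2 * z ≤ 5 * x then lateBid z x₀ β d else earlyBid b z d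

/-- The budget that is left to an additive agent when she buys an item of value `d` and so
increases the value of her bundle to `x`. -/
def budgetAfter (b z x d : ℝ) : ℝ :=
  if 2 * z ≤ 5 * d then b / 2 else b * (1 - 5 * x / (4 * z))

section Invariants

variable {m : ℕ} {v : Finset (Fin m) → ℝ} {b z : ℝ} {X R : Finset (Fin m)} {p : Fin m → ℝ}

theorem sum_update_of_notMem' {j : Fin m} (hj : j ∉ X) (π : ℝ) :
    ∑ k ∈ X, Function.update p j π k = ∑ k ∈ X, p k :=
  Finset.sum_congr rfl fun k hk => Function.update_of_ne (by rintro rfl; exact hj hk) _ _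

theorem sum_insert_update {j : Fin m} (hj : j ∉ X) (π : ℝ) :
    ∑ k ∈ insert j X, Function.update p j π k = ∑ k ∈ X, p k + π := by
  rw [Finset.sum_insert hj, sum_update_of_notMem' hj, Function.update_self, add_comm]

/-! #### Unit-demand agents -/

/-- The invariant for a unit-demand agent who owns `X` while the items in `R` are free and the
others have been sold at prices `p`. -/
structure InvUD (v : Finset (Fin m) → ℝ) (b : ℝ) (X R : Finset (Fin m)) (p : Fin m → ℝ) :
    Prop where
  pay : ∑ j ∈ X, p j ≤ b
  pay_zero : v X ≤ 0 → ∑ j ∈ X, p j ≤ 0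
  sold : ∀ j, j ∉ R → j ∉ X → v X < v {j} → b ≤ p j
  free : 0 < v X → ∀ r ∈ R, v {r} ≤ v X

/-- She pays at most once, on her first positive gain. As that gain is the best possible, no free
item is worth more than her bundle afterwards. -/
theorem InvUD.own (hmono : ∀ S T, S ⊆ T → v S ≤ v T) (h0 : v ∅ = 0) (h : InvUD v b X R p)
    {j : Fin m} (hjX : j ∉ X) {d : ℝ} (hd : ∀ r ∈ R, v (insert r X) - v X ≤ d)
    (hjd : v (insert j X) - v X = d) :
    InvUD v b (insert j X) (R.erase j) (Function.update p j (bidUnitDemand b (v X) d)) := by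
  have hd0 : v X ≤ v (insert j X) := hmono _ _ (Finset.subset_insert _ _)
  have hsold : ∀ k, k ∉ R.erase j → k ∉ insert j X → v (insert j X) < v {k} →
      b ≤ Function.update p j (bidUnitDemand b (v X) d) k := by
    intro k hkR hkX hk
    simp only [Finset.mem_insert, not_or] at hkX
    rw [Function.update_of_ne hkX.1]
    exact h.sold k (fun hk' => hkR (Finset.mem_erase.2 ⟨hkX.1, hk'⟩)) hkX.2 (hd0.trans_lt hk)
  have hp := h.pay
  have hp0 := h.pay_zero
  refine ⟨?_, ?_, hsold, ?_⟩
  · rw [sum_insert_update hjX, bidUnitDemand]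
    split_ifs with h1 h2
    · linarith
    · linarith [hp0 h1]
    · linarith
  · intro hx
    have hx0 : 0 ≤ v X := h0 ▸ hmono _ _ (Finset.empty_subset _)
    rw [sum_insert_update hjX, bidUnitDemand, if_pos (by linarith), if_pos (by linarith)]
    linarith [hp0 (by linarith)]
  · intro hx r hr
    have hrR := Finset.mem_of_mem_erase hr
    have := hd r hrR
    have : v {r} ≤ v (insert r X) := hmono _ _ (by simp)
    linarith

/-- A free item worth more than `v X` exists only while `v X = 0`; then she bids all of `b`, and the
winning price is no less. -/
theorem InvUD.other (hmono : ∀ S T, S ⊆ T → v S ≤ v T) (h0 : v ∅ = 0) (h : InvUD v b X R p)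
    {j : Fin m} (hj : j ∈ R) (hjX : j ∉ X) {d : ℝ} (hd : ∀ r ∈ R, v (insert r X) - v X ≤ d)
    {π : ℝ} (hπ : bidUnitDemand b (v X) d ≤ π) :
    InvUD v b X (R.erase j) (Function.update p j π) := by
  refine ⟨?_, ?_, ?_, fun hx r hr => h.free hx r (Finset.mem_of_mem_erase hr)⟩
  · rw [sum_update_of_notMem' hjX]; exact h.pay
  · rw [sum_update_of_notMem' hjX]; exact h.pay_zero
  · intro k hkR hkX hk
    by_cases hkj : k = j
    · subst hkj
      rw [Function.update_self]
      refine le_trans ?_ hπ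
      have hx : v X ≤ 0 := not_lt.1 fun hx => absurd (h.free hx k hj) (not_le.2 hk)
      have hx0 : 0 ≤ v X := h0 ▸ hmono _ _ (Finset.empty_subset _)
      have h1 := hd k hj
      have h2 : v {k} ≤ v (insert k X) := hmono _ _ (by simp)
      rw [bidUnitDemand, if_pos hx, if_neg (by linarith)]
    · rw [Function.update_of_ne hkj]
      exact h.sold k (fun hk' => hkR (Finset.mem_erase.2 ⟨hkj, hk'⟩)) hkX hk

/-- With her own items free of charge and the others at their sale prices, every item worth more
than `v X` costs at least `b`, which is out of reach. -/
theorem InvUD.anyPrice_le (hmono : ∀ S T, S ⊆ T → v S ≤ v T) (h0 : v ∅ = 0)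
    (ht : UnitDemandTest v) (hb : 0 < b) (hb1 : b ≤ 1) (h : InvUD v b X ∅ p) (hp : ∀ j, 0 ≤ p j)
    (hothers : ∑ j ∈ Xᶜ, p j ≤ 1 - b) : anyPrice b v ≤ v X := by
  have hx0 : 0 ≤ v X := h0 ▸ hmono _ _ (Finset.empty_subset _)
  -- `c = 1 - b / 2` is at least the total `1 - b`, stays positive for `b = 1`, and makes `c * b <
  -- b`.
  refine FairAlloc.anyPrice_le h0 hb.le (p := fun j => if j ∈ X then 0 else p j)
    (fun j => by split_ifs; exacts [le_rfl, hp j]) (c := 1 - b / 2) (by linarith) ?_ ?_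
  · have : ∑ j, (if j ∈ X then 0 else p j) = ∑ j ∈ Xᶜ, p j := by
      rw [← Finset.sum_add_sum_compl X, Finset.sum_congr rfl fun j hj => if_pos hj,
        Finset.sum_const_zero, zero_add]
      exact Finset.sum_congr rfl fun j hj => if_neg (Finset.mem_compl.1 hj)
    rw [this]
    linarith
  · intro T hT
    refine ht.le h0 hmono hx0 fun j hj => ?_
    by_contra! hlt
    have hjX : j ∉ X := fun hjX => absurd (hmono {j} X (by simpa using hjX)) (not_le.2 hlt)
    have h1 := h.sold j (by simp) hjX hlt
    have h2 := Finset.single_le_sum (f := fun j => if j ∈ X then 0 else p j)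
      (fun j _ => by split_ifs; exacts [le_rfl, hp j]) hj
    simp only [hjX, if_false] at h2
    nlinarith

/-! #### Failure -/

/-- If the own payments and the payments of the others are bounded, then all prices can be scaled up
so that no bundle of a price close to `b` is affordable. -/
theorem anyPrice_le_of_prices (h0 : v ∅ = 0) (hb : 0 < b) (hb1 : b ≤ 1) (hp : ∀ j, 0 ≤ p j)
    (hown : ∑ j ∈ X, p j ≤ 7 / 8 * b) (hothers : ∑ j ∈ Xᶜ, p j ≤ 1 - b) {V : ℝ}
    (hV : ∀ T, ∑ j ∈ T, p j ≤ (1 - b / 8) * b → v T ≤ V) : anyPrice b v ≤ V := by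
  refine anyPrice_le h0 hb.le hp (c := 1 - b / 8) (by linarith) ?_ hV
  rw [← Finset.sum_add_sum_compl X]
  linarith

/-! #### Submodular agents -/

/-- The invariant for a submodular agent. -/
structure InvSub (v : Finset (Fin m) → ℝ) (b z : ℝ) (X R : Finset (Fin m)) (p : Fin m → ℝ) :
    Prop where
  pay : ∑ j ∈ X, p j ≤ b
  pay_early : 3 * v X < z → 2 * z * ∑ j ∈ X, p j ≤ 3 * v X * b
  sold : 3 * v X < z → ∀ j, j ∉ R → j ∉ X →
    b ≤ p j ∨ 3 * b * (v (insert j X) - v X) ≤ 2 * z * p j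
  free : 3 * v X < z → 0 < v X → ∀ r ∈ R, 3 * (v (insert r X) - v X) < z

/-- At the rate 3b/(2z), a bundle and a gain both below z/3 cost less than `b` together. A gain of
z/3 or more arises only while `v X = 0` (`free`), when nothing has been paid. Decreasing marginals
preserve the bounds for items sold earlier. -/
theorem InvSub.own (hmono : ∀ S T, S ⊆ T → v S ≤ v T) (h0 : v ∅ = 0) (hsub : IsSubmodular v)
    (hb : 0 < b) (h : InvSub v b z X R p) {j : Fin m} (hj : j ∈ R) (hjX : j ∉ X) {d : ℝ}
    (hd : ∀ r ∈ R, v (insert r X) - v X ≤ d) (hjd : v (insert j X) - v X = d) :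
    InvSub v b z (insert j X) (R.erase j) (Function.update p j (bidSubmodular b z (v X) d)) := by
  have hd0 : v X ≤ v (insert j X) := hmono _ _ (Finset.subset_insert _ _)
  have hx0 : 0 ≤ v X := h0 ▸ hmono _ _ (Finset.empty_subset _)
  have hp := h.pay
  refine ⟨?_, ?_, ?_, ?_⟩
  · rw [sum_insert_update hjX, bidSubmodular]
    split_ifs with h1 h2
    · linarith
    · have hz : 0 < z := by linarith
      have h3 := h.pay_early (by linarith)
      rcases hx0.lt_or_eq with hx | hx
      · have := h.free (by linarith) hx j hj
        linarith
      · rw [← hx] at h3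
        have : ∑ k ∈ X, p k ≤ 0 := by
          by_contra! hc
          have := mul_pos (mul_pos two_pos hz) hc
          linarith
        linarith
    · have hz : 0 < z := by linarith
      have h3 := h.pay_early (by linarith)
      have h4 : 2 * z * (∑ k ∈ X, p k + 3 * d * b / (2 * z)) ≤ 2 * z * b := by
        have : 2 * z * (3 * d * b / (2 * z)) = 3 * d * b := by field_simp
        rw [mul_add, this]
        nlinarith
      exact le_of_mul_le_mul_left h4 (by positivity)
  · intro hx
    have hz : 0 < z := by linarith
    have h3 := h.pay_early (by linarith)
    rw [sum_insert_update hjX, bidSubmodular, if_neg (by linarith), if_neg (by linarith)]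
    have : 2 * z * (3 * d * b / (2 * z)) = 3 * d * b := by field_simp
    rw [mul_add, this]
    have h5 : v (insert j X) = v X + d := by linarith
    rw [h5]
    linarith
  · intro hx k hkR hkX
    simp only [Finset.mem_insert, not_or] at hkX
    rw [Function.update_of_ne hkX.1]
    refine (h.sold (by linarith) k (fun hk' => hkR (Finset.mem_erase.2 ⟨hkX.1, hk'⟩)) hkX.2).imp id
      fun h' => le_trans ?_ h'
    have := marginal_anti hsub hmono (Finset.subset_insert j X) k
    exact mul_le_mul_of_nonneg_left this (by positivity)
  · intro hx hx' r hr
    have hrR := Finset.mem_of_mem_erase hr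
    have h1 := marginal_anti hsub hmono (Finset.subset_insert j X) r
    have := hd r hrR
    rcases hx0.lt_or_eq with hx1 | hx1
    · have := h.free (by linarith) hx1 r hrR
      linarith
    · linarith

theorem InvSub.other (hmono : ∀ S T, S ⊆ T → v S ≤ v T) (h0 : v ∅ = 0)
    (hb : 0 < b) (h : InvSub v b z X R p) {j : Fin m} (hj : j ∈ R) (hjX : j ∉ X) {d : ℝ}
    (hd : ∀ r ∈ R, v (insert r X) - v X ≤ d) {π : ℝ} (hπ : bidSubmodular b z (v X) d ≤ π) :
    InvSub v b z X (R.erase j) (Function.update p j π) := by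
  have hx0 : 0 ≤ v X := h0 ▸ hmono _ _ (Finset.empty_subset _)
  refine ⟨?_, ?_, ?_, fun hx hx' r hr => h.free hx hx' r (Finset.mem_of_mem_erase hr)⟩
  · rw [sum_update_of_notMem' hjX]; exact h.pay
  · rw [sum_update_of_notMem' hjX]; exact h.pay_early
  · intro hx k hkR hkX
    have hz : 0 < z := by linarith
    by_cases hkj : k = j
    · subst hkj
      rw [Function.update_self]
      rw [bidSubmodular, if_neg (by linarith)] at hπ
      split_ifs at hπ with h1
      · exact .inl hπ
      · right
        have h2 : 2 * z * (3 * d * b / (2 * z)) = 3 * d * b := by field_simp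
        have h3 := mul_le_mul_of_nonneg_left hπ (by positivity : 0 ≤ 2 * z)
        have h4 := mul_le_mul_of_nonneg_left (hd k hj) (by positivity : 0 ≤ 3 * b)
        linarith
    · rw [Function.update_of_ne hkj]
      exact h.sold hx k (fun hk' => hkR (Finset.mem_erase.2 ⟨hkj, hk'⟩)) hkX

/-- On failure she has paid less than b/2. An affordable `T` has no item of price `b`, so its
marginals over `X` add up to at most (2z/3)(1 - b/8); with `v X` below z/3 this gives less than (1 -
b/12)z. -/
theorem InvSub.anyPrice_le (hmono : ∀ S T, S ⊆ T → v S ≤ v T) (h0 : v ∅ = 0)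
    (hsub : IsSubmodular v) (hb : 0 < b) (hb1 : b ≤ 1) (h : InvSub v b z X ∅ p)
    (hp : ∀ j, 0 ≤ p j) (hothers : ∑ j ∈ Xᶜ, p j ≤ 1 - b) (hfail : 3 * v X < z) :
    anyPrice b v ≤ (1 - b / 50) * z := by
  have hx0 : 0 ≤ v X := h0 ▸ hmono _ _ (Finset.empty_subset _)
  have hz : 0 < z := by linarith
  refine anyPrice_le_of_prices h0 hb hb1 hp ?_ hothers fun T hT => ?_
  · have := h.pay_early hfail
    have h2 : 2 * z * ∑ j ∈ X, p j ≤ 2 * z * (7 / 8 * b) := by nlinarith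
    exact le_of_mul_le_mul_left h2 (by positivity)
  · have h1 := le_add_sum_marginals hsub X T
    have h2 : v T ≤ v (X ∪ T) := hmono _ _ Finset.subset_union_right
    have h3 : ∀ j ∈ T, 3 * b * (v (insert j X) - v X) ≤ 2 * z * p j := by
      intro j hj
      by_cases hjX : j ∈ X
      · rw [Finset.insert_eq_self.2 hjX, sub_self, mul_zero]
        exact mul_nonneg (by positivity) (hp j)
      · refine (h.sold hfail j (by simp) hjX).resolve_left fun hbp => ?_
        have := Finset.single_le_sum (f := p) (fun j _ => hp j) hj
        nlinarith
    have h4 := Finset.sum_le_sum h3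
    rw [← Finset.mul_sum, ← Finset.mul_sum] at h4
    have h5 : 2 * z * ∑ j ∈ T, p j ≤ 2 * z * ((1 - b / 8) * b) :=
      mul_le_mul_of_nonneg_left hT (by positivity)
    have h6 : b * (3 * ∑ j ∈ T, (v (insert j X) - v X)) ≤ b * (2 * z * (1 - b / 8)) := by linarith
    have h7 := le_of_mul_le_mul_left h6 hb
    nlinarith

end Invariants

end FairAlloc

end

/-! ### Additive agents: three fifths of the target. -/

noncomputable section

namespace FairAlloc

/-! #### Additive agents: bundles and prices -/

section Numeric

variable {m : ℕ} {a q : Fin m → ℝ} {T : Finset (Fin m)} {b : ℝ}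

theorem sum_le_card_mul {F : Finset (Fin m)} {α : ℝ} (h : ∀ j ∈ F, a j ≤ α) :
    ∑ j ∈ F, a j ≤ F.card * α := by
  simpa using Finset.sum_le_card_nsmul F a α h

theorem card_mul_le_sum {F : Finset (Fin m)} {α : ℝ} (h : ∀ j ∈ F, α ≤ a j) :
    F.card * α ≤ ∑ j ∈ F, a j := by
  simpa using Finset.card_nsmul_le_sum F a α h

/-- Here `a` is value in units of the target and `q` price in units of the budget. Two items with `q
≥ 1/2` are not affordable; with one, the value is at most 3/5 + (4/5)(1/2 - b/8) = 1 - b/10. -/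
theorem sum_le_of_one_big (hb : 0 < b) (hT : ∑ j ∈ T, q j ≤ 1 - b / 8) (hq : ∀ j ∈ T, 0 ≤ q j)
    (h : ∀ j ∈ T, a j ≤ 3 / 5 ∧ 1 / 2 ≤ q j ∨ a j ≤ 4 / 5 * q j) :
    ∑ j ∈ T, a j ≤ 1 - b / 50 := by
  classical
  have hsa := Finset.sum_filter_add_sum_filter_not T (fun j => a j ≤ 4 / 5 * q j) a
  have hsq := Finset.sum_filter_add_sum_filter_not T (fun j => a j ≤ 4 / 5 * q j) q
  have h1 : ∑ j ∈ T with a j ≤ 4 / 5 * q j, a j ≤ 4 / 5 * ∑ j ∈ T with a j ≤ 4 / 5 * q j, q j := by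
    rw [Finset.mul_sum]
    exact Finset.sum_le_sum fun j hj => (Finset.mem_filter.1 hj).2
  have h0 : 0 ≤ ∑ j ∈ T with a j ≤ 4 / 5 * q j, q j :=
    Finset.sum_nonneg fun j hj => hq j (Finset.mem_filter.1 hj).1
  set H := T.filter fun j => ¬ a j ≤ 4 / 5 * q j with hH
  have hbig : ∀ j ∈ H, a j ≤ 3 / 5 ∧ 1 / 2 ≤ q j := fun j hj =>
    (h j (Finset.mem_filter.1 hj).1).resolve_right (Finset.mem_filter.1 hj).2
  have h2 := sum_le_card_mul fun j hj => (hbig j hj).1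
  have h3 := card_mul_le_sum fun j hj => (hbig j hj).2
  have h4 : (H.card : ℝ) < 2 := by linarith
  have h5 : (H.card : ℝ) ≤ 1 := by
    have : H.card < 2 := by exact_mod_cast h4
    exact_mod_cast Nat.lt_succ_iff.1 this
  linarith

/-- When the late phase starts, `e` is the distance to the goal 3/5, `β` the remaining fraction of
the budget, and `u` a bound for the items still unsold. The alternatives are: big items, items sold
before, items sold later for at least `β`, and cheap items, whose value per price 2e/β is at most
4/5. -/
theorem sum_le_of_late {e β u : ℝ} (hb : 0 < b) (hb1 : b ≤ 1) (he : 0 < e) (he1 : e ≤ 1 / 5)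
    (hβ : β = 1 / 4 + 5 / 4 * e) (hu : u ≤ 3 / 10 - e / 2)
    (hT : ∑ j ∈ T, q j ≤ 1 - b / 8) (hq : ∀ j ∈ T, 0 ≤ q j)
    (h : ∀ j ∈ T, a j ≤ 3 / 5 ∧ 1 / 2 ≤ q j ∨ a j ≤ 4 / 5 * q j ∧ 5 / 4 * u ≤ q j ∨
      a j ≤ u ∧ β ≤ q j ∨ β * a j ≤ 2 * e * q j) :
    ∑ j ∈ T, a j ≤ 1 - b / 50 := by
  classical
  have hsmall : ∀ x y, 0 ≤ y → β * x ≤ 2 * e * y → x ≤ 4 / 5 * y := by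
    intro x y hy hxy
    have h1 : 2 * e * y ≤ β * (4 / 5 * y) := by nlinarith
    exact le_of_mul_le_mul_left (hxy.trans h1) (by linarith)
  -- In the first case an item worth at most `u` and sold for at least `β` also has value at most
  -- 4/5 of its price. The second case forces e < 1/15.
  rcases le_or_gt u (4 / 5 * β) with hu1 | hu1
  · refine sum_le_of_one_big hb hT hq fun j hj => ?_
    rcases h j hj with h1 | h1 | h1 | h1
    · exact .inl h1
    · exact .inr h1.1
    · exact .inr (by linarith)
    · exact .inr (hsmall _ _ (hq j hj) h1)
  have he2 : e < 1 / 15 := by linarith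
  set H := T.filter fun j => a j ≤ 3 / 5 ∧ 1 / 2 ≤ q j with hH
  set T₁ := T.filter fun j => ¬ (a j ≤ 3 / 5 ∧ 1 / 2 ≤ q j) with hT₁
  set Lg := T₁.filter fun j => a j ≤ 4 / 5 * q j ∧ 5 / 4 * u ≤ q j with hLg
  set T₂ := T₁.filter fun j => ¬ (a j ≤ 4 / 5 * q j ∧ 5 / 4 * u ≤ q j) with hT₂
  set C := T₂.filter fun j => a j ≤ u ∧ β ≤ q j with hC
  set S := T₂.filter fun j => ¬ (a j ≤ u ∧ β ≤ q j) with hS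
  have sa1 : ∑ j ∈ H, a j + ∑ j ∈ T₁, a j = ∑ j ∈ T, a j :=
    Finset.sum_filter_add_sum_filter_not _ _ _
  have sq1 : ∑ j ∈ H, q j + ∑ j ∈ T₁, q j = ∑ j ∈ T, q j :=
    Finset.sum_filter_add_sum_filter_not _ _ _
  have sa2 : ∑ j ∈ Lg, a j + ∑ j ∈ T₂, a j = ∑ j ∈ T₁, a j :=
    Finset.sum_filter_add_sum_filter_not _ _ _
  have sq2 : ∑ j ∈ Lg, q j + ∑ j ∈ T₂, q j = ∑ j ∈ T₁, q j :=
    Finset.sum_filter_add_sum_filter_not _ _ _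
  have sa3 : ∑ j ∈ C, a j + ∑ j ∈ S, a j = ∑ j ∈ T₂, a j :=
    Finset.sum_filter_add_sum_filter_not _ _ _
  have sq3 : ∑ j ∈ C, q j + ∑ j ∈ S, q j = ∑ j ∈ T₂, q j :=
    Finset.sum_filter_add_sum_filter_not _ _ _
  have hHa : ∑ j ∈ H, a j ≤ H.card * (3 / 5) :=
    sum_le_card_mul fun j hj => (Finset.mem_filter.1 hj).2.1
  have hHq : H.card * (1 / 2) ≤ ∑ j ∈ H, q j :=
    card_mul_le_sum fun j hj => (Finset.mem_filter.1 hj).2.2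
  have hLa : ∑ j ∈ Lg, a j ≤ 4 / 5 * ∑ j ∈ Lg, q j := by
    rw [Finset.mul_sum]
    exact Finset.sum_le_sum fun j hj => (Finset.mem_filter.1 hj).2.1
  have hLa0 : ∑ j ∈ Lg, a j ≤ Lg.card * (4 / 5) := by
    refine sum_le_card_mul fun j hj => (Finset.mem_filter.1 hj).2.1.trans ?_
    have := Finset.single_le_sum hq (Finset.mem_filter.1 (Finset.mem_filter.1 hj).1).1
    linarith
  have hLq : Lg.card * (5 / 4 * u) ≤ ∑ j ∈ Lg, q j :=
    card_mul_le_sum fun j hj => (Finset.mem_filter.1 hj).2.2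
  have hCa : ∑ j ∈ C, a j ≤ C.card * u :=
    sum_le_card_mul fun j hj => (Finset.mem_filter.1 hj).2.1
  have hCq : C.card * β ≤ ∑ j ∈ C, q j :=
    card_mul_le_sum fun j hj => (Finset.mem_filter.1 hj).2.2
  have hmem : ∀ j ∈ S, j ∈ T ∧ β * a j ≤ 2 * e * q j := by
    intro j hj
    obtain ⟨hj, h3⟩ := Finset.mem_filter.1 hj
    obtain ⟨hj, h2⟩ := Finset.mem_filter.1 hj
    obtain ⟨hj, h1⟩ := Finset.mem_filter.1 hj
    exact ⟨hj, (((h j hj).resolve_left h1).resolve_left h2).resolve_left h3⟩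
  have hSq : 0 ≤ ∑ j ∈ S, q j := Finset.sum_nonneg fun j hj => hq j (hmem j hj).1
  have hSa : β * ∑ j ∈ S, a j ≤ 2 * e * ∑ j ∈ S, q j := by
    rw [Finset.mul_sum, Finset.mul_sum]
    exact Finset.sum_le_sum fun j hj => (hmem j hj).2
  have hSa' := hsmall _ _ hSq hSa
  generalize ∑ j ∈ S, a j = AS at *
  generalize ∑ j ∈ S, q j = QS at *
  generalize ∑ j ∈ C, a j = AC at *
  generalize ∑ j ∈ C, q j = QC at *
  generalize ∑ j ∈ Lg, a j = AL at *
  generalize ∑ j ∈ Lg, q j = QL at *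
  generalize ∑ j ∈ H, a j = AH at *
  generalize ∑ j ∈ H, q j = QH at *
  generalize H.card = nh at *
  generalize Lg.card = nl at *
  generalize C.card = nc at *
  have hnl : (0 : ℝ) ≤ nl := Nat.cast_nonneg _
  have hnc : (0 : ℝ) ≤ nc := Nat.cast_nonneg _
  have hlq4 : (nl : ℝ) * (1 / 4) ≤ QL := by nlinarith
  have hcq4 : (nc : ℝ) * (1 / 4) ≤ QC := by nlinarith
  -- Items of the first three types cost at least 1/2, 1/4 and 1/4, and all prices add up to less
  -- than 1.
  have hcount : 2 * nh + nl + nc < 4 := by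
    have : (2 * nh + nl + nc : ℝ) < 4 := by linarith
    exact_mod_cast this
  have hh : nh ≤ 1 := by omega
  have hc : nc ≤ 3 := by omega
  interval_cases nh
  · interval_cases nc
    · norm_num at *; linarith
    · norm_num at *; linarith
    · norm_num at *; linarith
    -- Three items of value at most 3/10 - e/2 leave price at most 1/4 ≤ β for the cheap ones, which
    -- then add at most 2e: in total 9/10 + e/2.
    · have : nl = 0 := by omega
      subst this
      norm_num at *
      have h1 : QS ≤ 1 / 4 := by linarith
      have h2 : β * AS ≤ β * (2 * e) := by nlinarith
      have h3 := le_of_mul_le_mul_left h2 (by linarith)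
      linarith
  · have hc1 : nc ≤ 1 := by omega
    interval_cases nc
    · norm_num at *; linarith
    -- The cheap items share price at most 1/2 - β = β - 5e/2, hence add at most 2e - 5e²/β ≤ 2e -
    -- 15e², as β ≤ 1/3. The total 9/10 + 3e/2 - 15e² peaks at e = 1/20, whence the square in `h4`.
    · have : nl = 0 := by omega
      subst this
      norm_num at *
      have h1 : QS ≤ β - 5 / 2 * e := by linarith
      have k1 : 2 * e * QS ≤ 2 * e * (β - 5 / 2 * e) :=
        mul_le_mul_of_nonneg_left h1 (by linarith)
      have k2 : e ^ 2 * β ≤ e ^ 2 * (1 / 3) :=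
        mul_le_mul_of_nonneg_left (by linarith) (by positivity)
      have h2 : β * AS ≤ β * (2 * e - 15 * e ^ 2) := by linarith
      have h3 := le_of_mul_le_mul_left h2 (by linarith)
      have h4 := sq_nonneg (20 * e - 1)
      linarith

end Numeric

section Invariants

variable {m : ℕ} {v : Finset (Fin m) → ℝ} {b z : ℝ} {X R : Finset (Fin m)} {p : Fin m → ℝ}

/-! #### Additive agents: the invariant -/

/-- The linear piece reaches b/2 exactly at d = 2z/5, where the first step begins. By monotonicity
the bid on the best free item dominates the bids that the other free items would get. -/
theorem earlyBid_mono (hb : 0 < b) (hz : 0 < z) {d d' : ℝ} (h : d ≤ d') :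
    earlyBid b z d ≤ earlyBid b z d' := by
  have key : ∀ d, 5 * d ≤ 2 * z → 5 * d * b / (4 * z) ≤ b / 2 := fun d hd => by
    rw [div_le_div_iff₀ (by positivity) two_pos]
    nlinarith
  simp only [earlyBid]
  split_ifs <;> first | linarith | skip
  · exact (key d (by linarith)).trans (by linarith)
  · exact key d (by linarith)
  · gcongr

theorem earlyBid_nonneg (hb : 0 < b) (hz : 0 < z) {d : ℝ} (hd : 0 ≤ d) : 0 ≤ earlyBid b z d := by
  simp only [earlyBid]
  split_ifs <;> positivity

/-- The invariant for an additive agent whose bundle was `X₀` and whose remaining budget was `β`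
when she had reached two fifths of `z`; at that time the items in `D` had been sold, and `u` bounds
the values of the other items. -/
structure Late (v : Finset (Fin m) → ℝ) (b z : ℝ) (X R : Finset (Fin m)) (p : Fin m → ℝ)
    (x₀ β : ℝ) (D X₀ : Finset (Fin m)) (u : ℝ) : Prop where
  sub : X₀ ⊆ X
  subD : X₀ ⊆ D
  disj : Disjoint D R
  u_nonneg : 0 ≤ u
  value : x₀ = v X₀
  value_le : 2 * z ≤ 5 * x₀
  pos : 0 < β
  pay : ∑ j ∈ X₀, p j ≤ b - β
  own : ∀ j ∈ X, j ∉ X₀ → j ∉ D ∧ 5 * v {j} < 3 * z - 5 * x₀ ∧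
    2 * (3 * z - 5 * x₀) * p j = 5 * v {j} * β ∧ ∀ r ∈ R, v {r} ≤ v {j}
  free : ∀ r ∈ R, v {r} ≤ u
  before : ∀ j ∈ D, earlyBid b z (v {j}) ≤ p j ∧ earlyBid b z u ≤ p j
  after : ∀ j, j ∉ R → j ∉ D → v {j} ≤ u ∧ (3 * z - 5 * x₀ ≤ 5 * v {j} → β ≤ p j) ∧
    (5 * v {j} < 3 * z - 5 * x₀ → 5 * v {j} * β ≤ 2 * (3 * z - 5 * x₀) * p j)
  kind : β = b / 2 ∧ u ≤ x₀ ∨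
    4 * z * β = b * (4 * z - 5 * x₀) ∧ 2 * u ≤ x₀

/-- The invariant for an additive agent. -/
structure InvAdd (v : Finset (Fin m) → ℝ) (b z : ℝ) (X R : Finset (Fin m)) (p : Fin m → ℝ)
    (x₀ β : ℝ) : Prop where
  pay : ∑ j ∈ X, p j ≤ b
  early_own : 5 * v X < 2 * z → ∀ j ∈ X, 4 * z * p j = 5 * v {j} * b ∧ ∀ r ∈ R, v {r} ≤ v {j}
  early : 5 * v X < 2 * z → ∀ j, j ∉ R → earlyBid b z (v {j}) ≤ p j ∧
    ∀ r ∈ R, earlyBid b z (v {r}) ≤ p j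
  late : 2 * z ≤ 5 * v X → 5 * v X < 3 * z → ∃ D X₀ u, Late v b z X R p x₀ β D X₀ u

theorem IsAdditive.val_insert (hadd : IsAdditive v) {j : Fin m} (hj : j ∉ X) :
    v (insert j X) = v X + v {j} := by
  rw [hadd (insert j X), Finset.sum_insert hj, ← hadd X, add_comm]

theorem InvAdd.pay_eq (hadd : IsAdditive v) (h : InvAdd v b z X R p x₀ β) (hx : 5 * v X < 2 * z) :
    4 * z * ∑ j ∈ X, p j = 5 * v X * b := by
  rw [Finset.mul_sum, Finset.sum_congr rfl fun j hj => (h.early_own hx j hj).1, hadd X,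
    Finset.mul_sum, Finset.sum_mul]

theorem le_of_mem (hmono : ∀ S T, S ⊆ T → v S ≤ v T) {j : Fin m} (hj : j ∈ X) : v {j} ≤ v X :=
  hmono _ _ (by simpa using hj)

/-- Items are bought in decreasing order of value. So either 2z/5 is reached by a first item of that
size, for b/2, or by a smaller item that makes up at most half of the bundle; these are the two
alternatives of `kind`. -/
theorem InvAdd.own_early {x₀ β : ℝ} (hmono : ∀ S T, S ⊆ T → v S ≤ v T) (h0 : v ∅ = 0)
    (hadd : IsAdditive v) (hb : 0 < b) (h : InvAdd v b z X R p x₀ β) {j : Fin m} (hj : j ∈ R)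
    (hjX : j ∉ X) (hXR : Disjoint X R) (hd : ∀ r ∈ R, v {r} ≤ v {j}) (hx : 5 * v X < 2 * z) :
    InvAdd v b z (insert j X) (R.erase j) (Function.update p j (earlyBid b z (v {j})))
      (v (insert j X)) (budgetAfter b z (v (insert j X)) (v {j})) := by
  have hx0 : 0 ≤ v X := h0 ▸ hmono _ _ (Finset.empty_subset _)
  have hd0 : 0 ≤ v {j} := h0 ▸ hmono _ _ (Finset.empty_subset _)
  have hz : 0 < z := by linarith
  have hx' := hadd.val_insert hjX
  have hpay := h.pay_eq hadd hx
  have hne : ∀ k ∈ X, v {j} ≤ v X := fun k hk =>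
    ((h.early_own hx k hk).2 j hj).trans (le_of_mem hmono hk)
  -- An earlier item would be at least as valuable and would have brought `v X` to 2z/5 already.
  have hempty : 2 * z ≤ 5 * v {j} → X = ∅ := fun hd => by
    refine Finset.eq_empty_of_forall_notMem fun k hk => ?_
    linarith [hne k hk]
  have hsold : ∀ k, k ∉ R.erase j → k ≠ j → k ∉ R := fun k hk hkj hkR =>
    hk (Finset.mem_erase.2 ⟨hkj, hkR⟩)
  have hD : ∀ k, k ∉ R.erase j →
      earlyBid b z (v {k}) ≤ Function.update p j (earlyBid b z (v {j})) k ∧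
      earlyBid b z (v {j}) ≤ Function.update p j (earlyBid b z (v {j})) k := by
    intro k hk
    by_cases hkj : k = j
    · subst hkj
      rw [Function.update_self]
      exact ⟨le_rfl, le_rfl⟩
    · rw [Function.update_of_ne hkj]
      have := h.early hx k (hsold k hk hkj)
      exact ⟨this.1, this.2 j hj⟩
  have hbid : 5 * v {j} < 2 * z → 4 * z * earlyBid b z (v {j}) = 5 * v {j} * b := by
    intro hlt
    rw [earlyBid, if_neg (by linarith), if_neg (by linarith)]
    field_simp
  have hpay' : 5 * v {j} < 2 * z →
      4 * z * ∑ k ∈ insert j X, Function.update p j (earlyBid b z (v {j})) k =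
        5 * v (insert j X) * b := by
    intro hlt
    rw [sum_insert_update hjX, mul_add, hpay, hbid hlt, hx']
    ring
  refine ⟨?_, ?_, ?_, ?_⟩
  · rcases le_or_gt (2 * z) (5 * v {j}) with hle | hlt
    · have hX := hempty hle
      subst hX
      rw [sum_insert_update hjX, earlyBid, Finset.sum_empty]
      split_ifs <;> linarith
    · have h1 := hpay' hlt
      have h2 : 4 * z * ∑ k ∈ insert j X, Function.update p j (earlyBid b z (v {j})) k ≤
          4 * z * b := by rw [h1]; nlinarith
      exact le_of_mul_le_mul_left h2 (by positivity)
  · intro hlt k hk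
    rcases Finset.mem_insert.1 hk with rfl | hkX
    · rw [Function.update_self]
      exact ⟨hbid (by linarith), fun r hr => hd r (Finset.mem_of_mem_erase hr)⟩
    · have hkj : k ≠ j := by rintro rfl; exact hjX hkX
      rw [Function.update_of_ne hkj]
      exact ⟨(h.early_own hx k hkX).1,
        fun r hr => (h.early_own hx k hkX).2 r (Finset.mem_of_mem_erase hr)⟩
  · intro hlt k hk
    exact ⟨(hD k hk).1, fun r hr =>
      (earlyBid_mono hb hz (hd r (Finset.mem_of_mem_erase hr))).trans (hD k hk).2⟩
  · intro hle hlt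
    -- The late phase starts here: `D` consists of all items sold so far, `j` included, `X₀` is the
    -- present bundle, and `u = v {j}` bounds the free items.
    have hbase : ∀ β', 0 < β' →
        ∑ k ∈ insert j X, Function.update p j (earlyBid b z (v {j})) k ≤ b - β' →
        (β' = b / 2 ∧ v {j} ≤ v (insert j X) ∨
          4 * z * β' = b * (4 * z - 5 * v (insert j X)) ∧ 2 * v {j} ≤ v (insert j X)) →
        Late v b z (insert j X) (R.erase j) (Function.update p j (earlyBid b z (v {j})))
          (v (insert j X)) β' ((R.erase j)ᶜ) (insert j X) (v {j}) := by
      intro β' hβ hs hk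
      refine ⟨subset_rfl, fun k hk => ?_, disjoint_compl_left, hd0, rfl, hle, hβ, hs,
        fun k hk hk' => absurd hk hk', fun r hr => hd r (Finset.mem_of_mem_erase hr),
        fun k hk => hD k (Finset.mem_compl.1 hk),
        fun k hk hk' => absurd (Finset.mem_compl.2 hk) hk', hk⟩
      rw [Finset.mem_compl, Finset.mem_erase, not_and]
      rintro hkj hkR
      rcases Finset.mem_insert.1 hk with rfl | hkX
      · exact hkj rfl
      · exact Finset.disjoint_left.1 hXR hkX hkR
    refine ⟨_, _, _, hbase _ ?_ ?_ ?_⟩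
    · rw [budgetAfter]
      split_ifs
      · positivity
      · refine mul_pos hb (sub_pos.2 ?_)
        rw [div_lt_one (by positivity)]
        linarith
    · rcases le_or_gt (2 * z) (5 * v {j}) with hle' | hlt'
      · have hX := hempty hle'
        subst hX
        rw [h0, zero_add] at hx'
        rw [hx'] at hlt
        rw [budgetAfter, if_pos hle', sum_insert_update hjX, Finset.sum_empty, earlyBid,
          if_neg (by linarith), if_pos hle']
        linarith
      · have h1 := hpay' hlt'
        rw [budgetAfter, if_neg (by linarith)]
        have h2 : 4 * z * ∑ k ∈ insert j X, Function.update p j (earlyBid b z (v {j})) k ≤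
            4 * z * (b - b * (1 - 5 * v (insert j X) / (4 * z))) := by
          rw [h1]
          field_simp
          linarith
        exact le_of_mul_le_mul_left h2 (by positivity)
    · rcases le_or_gt (2 * z) (5 * v {j}) with hle' | hlt'
      · exact .inl ⟨by rw [budgetAfter, if_pos hle'], by linarith⟩
      · refine .inr ⟨?_, ?_⟩
        · rw [budgetAfter, if_neg (by linarith)]
          field_simp
        -- The item `j` alone is worth less than 2z/5, so an earlier one exists, of at least the
        -- same value.
        · obtain ⟨k, hk⟩ : X.Nonempty := by
            rw [Finset.nonempty_iff_ne_empty]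
            rintro rfl
            rw [h0] at hx'
            linarith
          linarith [hne k hk]

theorem InvAdd.other_early {x₀ β : ℝ} (hmono : ∀ S T, S ⊆ T → v S ≤ v T) (h0 : v ∅ = 0)
    (hb : 0 < b) (h : InvAdd v b z X R p x₀ β) {j : Fin m} (hj : j ∈ R)
    (hjX : j ∉ X) {d : ℝ} (hd : ∀ r ∈ R, v {r} ≤ d) (hx : 5 * v X < 2 * z)
    {π : ℝ} (hπ : earlyBid b z d ≤ π) :
    InvAdd v b z X (R.erase j) (Function.update p j π) x₀ β := by
  have hx0 : 0 ≤ v X := h0 ▸ hmono _ _ (Finset.empty_subset _)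
  have hz : 0 < z := by linarith
  refine ⟨?_, ?_, ?_, fun hle _ => by linarith⟩
  · rw [sum_update_of_notMem' hjX]; exact h.pay
  · intro _ k hk
    have hkj : k ≠ j := by rintro rfl; exact hjX hk
    rw [Function.update_of_ne hkj]
    exact ⟨(h.early_own hx k hk).1,
      fun r hr => (h.early_own hx k hk).2 r (Finset.mem_of_mem_erase hr)⟩
  · intro _ k hk
    by_cases hkj : k = j
    · subst hkj
      rw [Function.update_self]
      exact ⟨(earlyBid_mono hb hz (hd k hj)).trans hπ, fun r hr =>
        (earlyBid_mono hb hz (hd r (Finset.mem_of_mem_erase hr))).trans hπ⟩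
    · rw [Function.update_of_ne hkj]
      have := h.early hx k fun hkR => hk (Finset.mem_erase.2 ⟨hkj, hkR⟩)
      exact ⟨this.1, fun r hr => this.2 r (Finset.mem_of_mem_erase hr)⟩

/-- With e = (3z - 5x₀)/5 the distance to the goal, late purchases cost β/(2e) per unit of value:
short of the goal, less than half of `β` is spent. -/
theorem Late.sum_eq {x₀ β u : ℝ} {D X₀ : Finset (Fin m)} (hadd : IsAdditive v)
    (h : Late v b z X R p x₀ β D X₀ u) :
    2 * (3 * z - 5 * x₀) * ∑ j ∈ X \ X₀, p j = 5 * (v X - x₀) * β := by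
  have h1 : v X - x₀ = ∑ j ∈ X \ X₀, v {j} := by
    rw [hadd X, h.value, hadd X₀, ← Finset.sum_sdiff h.sub]
    ring
  rw [h1, Finset.mul_sum, Finset.mul_sum, Finset.sum_mul]
  refine Finset.sum_congr rfl fun j hj => ?_
  obtain ⟨hj, hj'⟩ := Finset.mem_sdiff.1 hj
  exact (h.own j hj hj').2.2.1

theorem Late.own_small {x₀ β u : ℝ} {D X₀ : Finset (Fin m)} (h : Late v b z X R p x₀ β D X₀ u)
    {j : Fin m} (hj : j ∈ R) (hjX : j ∉ X) (hd : ∀ r ∈ R, v {r} ≤ v {j})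
    (hlt : 5 * v {j} < 3 * z - 5 * x₀) {π : ℝ}
    (hπ : 2 * (3 * z - 5 * x₀) * π = 5 * v {j} * β) :
    Late v b z (insert j X) (R.erase j) (Function.update p j π) x₀ β D X₀ u := by
  have hjD : j ∉ D := Finset.disjoint_right.1 h.disj hj
  have hjX₀ : j ∉ X₀ := fun h' => hjX (h.sub h')
  refine ⟨h.sub.trans (Finset.subset_insert _ _), h.subD,
    h.disj.mono_right (Finset.erase_subset _ _), h.u_nonneg, h.value, h.value_le, h.pos, ?_, ?_,
    fun r hr => h.free r (Finset.mem_of_mem_erase hr), ?_, ?_, h.kind⟩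
  · rw [sum_update_of_notMem' hjX₀]; exact h.pay
  · intro k hk hkX₀
    rcases Finset.mem_insert.1 hk with rfl | hkX
    · rw [Function.update_self]
      exact ⟨hjD, hlt, hπ, fun r hr => hd r (Finset.mem_of_mem_erase hr)⟩
    · have hkj : k ≠ j := by rintro rfl; exact hjX hkX
      rw [Function.update_of_ne hkj]
      obtain ⟨h1, h2, h3, h4⟩ := h.own k hkX hkX₀
      exact ⟨h1, h2, h3, fun r hr => h4 r (Finset.mem_of_mem_erase hr)⟩
  · intro k hk
    rw [Function.update_of_ne (by rintro rfl; exact hjD hk)]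
    exact h.before k hk
  · intro k hkR hkD
    by_cases hkj : k = j
    · subst hkj
      rw [Function.update_self]
      exact ⟨h.free k hj, fun h' => absurd hlt (not_lt.2 h'), fun _ => hπ.ge⟩
    · rw [Function.update_of_ne hkj]
      exact h.after k (fun h' => hkR (Finset.mem_erase.2 ⟨hkj, h'⟩)) hkD

/-- An item that bridges the whole distance from `x₀` to the goal is bought with all of `β`. Nothing
of `β` has been spent then: an earlier late purchase would have been at least as valuable and would
have reached the goal. -/
theorem InvAdd.own_late {x₀ β : ℝ} (hmono : ∀ S T, S ⊆ T → v S ≤ v T) (h0 : v ∅ = 0)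
    (hadd : IsAdditive v) (h : InvAdd v b z X R p x₀ β) {j : Fin m} (hj : j ∈ R)
    (hjX : j ∉ X) (hd : ∀ r ∈ R, v {r} ≤ v {j}) (hx : 2 * z ≤ 5 * v X) (hx3 : 5 * v X < 3 * z) :
    InvAdd v b z (insert j X) (R.erase j) (Function.update p j (lateBid z x₀ β (v {j}))) x₀ β := by
  obtain ⟨D, X₀, u, hL⟩ := h.late hx hx3
  have hd0 : 0 ≤ v {j} := h0 ▸ hmono _ _ (Finset.empty_subset _)
  have hx' := hadd.val_insert hjX
  have hxx : x₀ ≤ v X := hL.value ▸ hmono _ _ hL.sub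
  have hE : 0 < 3 * z - 5 * x₀ := by linarith
  have hsplit := Finset.sum_sdiff (f := p) hL.sub
  have hpay := hL.pay
  have hβ := hL.pos
  rcases le_or_gt (3 * z - 5 * x₀) (5 * v {j}) with hle | hlt
  · have hX : X = X₀ := by
      refine Finset.Subset.antisymm (fun k hk => ?_) hL.sub
      by_contra hk'
      obtain ⟨-, h1, -, h2⟩ := hL.own k hk hk'
      linarith [h2 j hj]
    rw [lateBid, if_pos hle]
    refine ⟨?_, fun h' => by linarith, fun h' => by linarith, fun _ h' => by linarith⟩
    rw [sum_insert_update hjX, hX]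
    linarith
  · have hπ : 2 * (3 * z - 5 * x₀) * lateBid z x₀ β (v {j}) = 5 * v {j} * β := by
      rw [lateBid, if_neg (not_le.2 hlt)]
      field_simp
    refine ⟨?_, fun h' => by linarith, fun h' => by linarith, fun _ _ =>
      ⟨D, X₀, u, hL.own_small hj hjX hd hlt hπ⟩⟩
    have h1 := hL.sum_eq hadd
    have h2 : 2 * (3 * z - 5 * x₀) * (∑ k ∈ X \ X₀, p k + lateBid z x₀ β (v {j})) ≤
        2 * (3 * z - 5 * x₀) * β := by
      rw [mul_add, h1, hπ]
      nlinarith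
    have h3 := le_of_mul_le_mul_left h2 (by linarith)
    rw [sum_insert_update hjX]
    linarith

theorem InvAdd.other_late {x₀ β : ℝ} (hmono : ∀ S T, S ⊆ T → v S ≤ v T) (h0 : v ∅ = 0)
    (h : InvAdd v b z X R p x₀ β) {j : Fin m} (hj : j ∈ R)
    (hjX : j ∉ X) {d : ℝ} (hd : ∀ r ∈ R, v {r} ≤ d) (hx : 2 * z ≤ 5 * v X)
    (hx3 : 5 * v X < 3 * z) {π : ℝ} (hπ : lateBid z x₀ β d ≤ π) :
    InvAdd v b z X (R.erase j) (Function.update p j π) x₀ β := by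
  obtain ⟨D, X₀, u, hL⟩ := h.late hx hx3
  have hd0 : 0 ≤ v {j} := h0 ▸ hmono _ _ (Finset.empty_subset _)
  have hxx : x₀ ≤ v X := hL.value ▸ hmono _ _ hL.sub
  have hE : 0 < 3 * z - 5 * x₀ := by linarith
  have hβ := hL.pos
  have hjD : j ∉ D := Finset.disjoint_right.1 hL.disj hj
  have hdj := hd j hj
  refine ⟨?_, fun h' => by linarith, fun h' => by linarith, fun _ _ => ⟨D, X₀, u, ?_⟩⟩
  · rw [sum_update_of_notMem' hjX]; exact h.pay
  refine ⟨hL.sub, hL.subD, hL.disj.mono_right (Finset.erase_subset _ _), hL.u_nonneg, hL.value,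
    hL.value_le, hL.pos, ?_, ?_, fun r hr => hL.free r (Finset.mem_of_mem_erase hr), ?_, ?_,
    hL.kind⟩
  · rw [sum_update_of_notMem' fun h' => hjX (hL.sub h')]; exact hL.pay
  · intro k hk hkX₀
    rw [Function.update_of_ne (by rintro rfl; exact hjX hk)]
    obtain ⟨h1, h2, h3, h4⟩ := hL.own k hk hkX₀
    exact ⟨h1, h2, h3, fun r hr => h4 r (Finset.mem_of_mem_erase hr)⟩
  · intro k hk
    rw [Function.update_of_ne (by rintro rfl; exact hjD hk)]
    exact hL.before k hk
  · intro k hkR hkD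
    by_cases hkj : k = j
    · subst hkj
      rw [Function.update_self]
      refine ⟨hL.free k hj, fun h' => ?_, fun h' => ?_⟩
      · rwa [lateBid, if_pos (by linarith)] at hπ
      · have h2 : 2 * (3 * z - 5 * x₀) * lateBid z x₀ β d ≤ 2 * (3 * z - 5 * x₀) * π :=
          mul_le_mul_of_nonneg_left hπ (by linarith)
        refine le_trans ?_ h2
        rw [lateBid]
        split_ifs with h3
        · nlinarith
        · have : 2 * (3 * z - 5 * x₀) * (5 * d * β / (2 * (3 * z - 5 * x₀))) = 5 * d * β := by
            field_simp
          rw [this]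
          nlinarith
    · rw [Function.update_of_ne hkj]
      exact hL.after k (fun h' => hkR (Finset.mem_erase.2 ⟨hkj, h'⟩)) hkD

theorem InvAdd.own {x₀ β : ℝ} (hmono : ∀ S T, S ⊆ T → v S ≤ v T) (h0 : v ∅ = 0)
    (hadd : IsAdditive v) (hb : 0 < b) (h : InvAdd v b z X R p x₀ β) {j : Fin m} (hj : j ∈ R)
    (hjX : j ∉ X) (hXR : Disjoint X R) {d : ℝ} (hd : ∀ r ∈ R, v (insert r X) - v X ≤ d)
    (hjd : v (insert j X) - v X = d) :
    InvAdd v b z (insert j X) (R.erase j) (Function.update p j (bidAdditive b z (v X) x₀ β d))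
      (if 5 * v X < 2 * z then v (insert j X) else x₀)
      (if 5 * v X < 2 * z then budgetAfter b z (v (insert j X)) d else β) := by
  have hx' := hadd.val_insert hjX
  have hd0 : 0 ≤ v {j} := h0 ▸ hmono _ _ (Finset.empty_subset _)
  have hx0 : 0 ≤ v X := h0 ▸ hmono _ _ (Finset.empty_subset _)
  obtain rfl : d = v {j} := by linarith
  have hd' : ∀ r ∈ R, v {r} ≤ v {j} := fun r hr => by
    have h1 := hd r hr
    rw [hadd.val_insert (Finset.disjoint_right.1 hXR hr)] at h1
    linarith
  rw [bidAdditive]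
  rcases lt_or_ge (5 * v X) (2 * z) with h2 | h2
  · rw [if_neg (by linarith), if_neg (by linarith), if_pos h2, if_pos h2]
    exact h.own_early hmono h0 hadd hb hj hjX hXR hd' h2
  · rw [if_neg (not_lt.2 h2), if_neg (not_lt.2 h2), if_pos h2]
    split_ifs with h3
    · refine ⟨?_, fun h' => by linarith, fun h' => by linarith, fun _ h' => by linarith⟩
      rw [sum_insert_update hjX, add_zero]
      exact h.pay
    · exact h.own_late hmono h0 hadd hj hjX hd' h2 (by linarith)

theorem InvAdd.other {x₀ β : ℝ} (hmono : ∀ S T, S ⊆ T → v S ≤ v T) (h0 : v ∅ = 0)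
    (hadd : IsAdditive v) (hb : 0 < b) (h : InvAdd v b z X R p x₀ β) {j : Fin m} (hj : j ∈ R)
    (hXR : Disjoint X R) {d : ℝ} (hd : ∀ r ∈ R, v (insert r X) - v X ≤ d) {π : ℝ}
    (hπ : bidAdditive b z (v X) x₀ β d ≤ π) :
    InvAdd v b z X (R.erase j) (Function.update p j π) x₀ β := by
  have hjX : j ∉ X := Finset.disjoint_right.1 hXR hj
  have hx0 : 0 ≤ v X := h0 ▸ hmono _ _ (Finset.empty_subset _)
  have hd' : ∀ r ∈ R, v {r} ≤ d := fun r hr => by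
    have h1 := hd r hr
    rw [hadd.val_insert (Finset.disjoint_right.1 hXR hr)] at h1
    linarith
  rw [bidAdditive] at hπ
  rcases lt_or_ge (5 * v X) (2 * z) with h2 | h2
  · rw [if_neg (by linarith), if_neg (by linarith)] at hπ
    exact h.other_early hmono h0 hb hj hjX hd' h2 hπ
  · rw [if_pos h2] at hπ
    split_ifs at hπ with h3
    · refine ⟨?_, fun h' => by linarith, fun h' => by linarith, fun _ h' => by linarith⟩
      rw [sum_update_of_notMem' hjX]
      exact h.pay
    · exact h.other_late hmono h0 hj hjX hd' h2 (by linarith) hπ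

/-- Early failure means payments below b/2. Late failure means at most b - β before and β/2 after
the change of phase, with β ≥ b/4; this is the source of 7/8. For the values, one big item suffices
as a model, except after a late phase reached by several small items. -/
theorem InvAdd.anyPrice_le {x₀ β : ℝ} (hmono : ∀ S T, S ⊆ T → v S ≤ v T) (h0 : v ∅ = 0)
    (hadd : IsAdditive v) (hb : 0 < b) (hb1 : b ≤ 1) (h : InvAdd v b z X ∅ p x₀ β)
    (hp : ∀ j, 0 ≤ p j) (hothers : ∑ j ∈ Xᶜ, p j ≤ 1 - b) (hfail : 5 * v X < 3 * z) :
    anyPrice b v ≤ (1 - b / 50) * z := by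
  have hx0 : 0 ≤ v X := h0 ▸ hmono _ _ (Finset.empty_subset _)
  have hz : 0 < z := by linarith
  have hown : ∑ j ∈ X, p j ≤ 7 / 8 * b := by
    rcases lt_or_ge (5 * v X) (2 * z) with h2 | h2
    · have h1 := h.pay_eq hadd h2
      have h3 : 4 * z * ∑ j ∈ X, p j ≤ 4 * z * (7 / 8 * b) := by nlinarith
      exact le_of_mul_le_mul_left h3 (by positivity)
    · obtain ⟨D, X₀, u, hL⟩ := h.late h2 hfail
      have hxx : x₀ ≤ v X := hL.value ▸ hmono _ _ hL.sub
      have hβ := hL.pos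
      have h1 := hL.sum_eq hadd
      have h3 : 2 * (3 * z - 5 * x₀) * ∑ j ∈ X \ X₀, p j ≤ 2 * (3 * z - 5 * x₀) * (β / 2) := by
        rw [h1]
        nlinarith
      have h4 := le_of_mul_le_mul_left h3 (by linarith)
      -- In the second alternative `β` is b(1 - 5x₀/(4z)), and x₀ < 3z/5.
      have h5 : b / 4 ≤ β := by
        rcases hL.kind with h6 | h6
        · linarith
        · have h7 : z * b ≤ z * (4 * β) := by nlinarith
          linarith [le_of_mul_le_mul_left h7 hz]
      have := hL.pay
      rw [← Finset.sum_sdiff hL.sub]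
      linarith
  refine anyPrice_le_of_prices h0 hb hb1 hp hown hothers fun T hT => ?_
  have hlt : ∀ j ∈ T, p j < b := fun j hj => by
    have := Finset.single_le_sum (f := p) (fun j _ => hp j) hj
    nlinarith
  have hT' : ∑ j ∈ T, p j / b ≤ 1 - b / 8 := by
    rw [← Finset.sum_div, div_le_iff₀ hb]
    exact hT
  have hq : ∀ j ∈ T, 0 ≤ p j / b := fun j _ => div_nonneg (hp j) hb.le
  suffices ∑ j ∈ T, v {j} / z ≤ 1 - b / 50 by
    rw [← Finset.sum_div, div_le_iff₀ hz] at this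
    rwa [hadd T]
  -- An affordable item costs less than `b`, which excludes the top branch of the bid.
  have hE : ∀ j, earlyBid b z (v {j}) ≤ p j → p j < b →
      v {j} / z ≤ 3 / 5 ∧ 1 / 2 ≤ p j / b ∨ v {j} / z ≤ 4 / 5 * (p j / b) := by
    intro j hj hjb
    rw [earlyBid] at hj
    split_ifs at hj with h1 h2
    · linarith
    · left
      rw [div_le_iff₀ hz, le_div_iff₀ hb]
      constructor <;> linarith
    · right
      rw [div_le_iff₀ (by positivity)] at hj
      rw [div_le_iff₀ hz, ← mul_div_assoc, div_mul_eq_mul_div, le_div_iff₀ hb]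
      linarith
  rcases lt_or_ge (5 * v X) (2 * z) with h2 | h2
  · exact sum_le_of_one_big hb hT' hq fun j hj => hE j (h.early h2 j (by simp)).1 (hlt j hj)
  obtain ⟨D, X₀, u, hL⟩ := h.late h2 hfail
  have hxx : x₀ ≤ v X := hL.value ▸ hmono _ _ hL.sub
  have hyz : x₀ / z * z = x₀ := div_mul_cancel₀ _ hz.ne'
  set y := x₀ / z with hy
  have hy1 : y < 3 / 5 := by rw [hy, div_lt_iff₀ hz]; linarith
  have hy2 : 2 / 5 ≤ y := by rw [hy, le_div_iff₀ hz]; linarith [hL.value_le]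
  have hsmall : ∀ j, 5 * v {j} * β ≤ 2 * (3 * z - 5 * x₀) * p j →
      β / b * (v {j} / z) ≤ 2 * (3 / 5 - y) * (p j / b) := by
    intro j hj
    rw [div_mul_div_comm, ← mul_div_assoc, div_le_div_iff₀ (by positivity) hb]
    rw [← hyz] at hj
    nlinarith
  rcases hL.kind with ⟨hβ, hu⟩ | ⟨hβ, hu⟩
  · refine sum_le_of_one_big hb hT' hq fun j hj => ?_
    by_cases hjD : j ∈ D
    · exact hE j (hL.before j hjD).1 (hlt j hj)
    · obtain ⟨h3, h4, h5⟩ := hL.after j (by simp) hjD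
      rcases le_or_gt (3 * z - 5 * x₀) (5 * v {j}) with h6 | h6
      · left
        have := h4 h6
        rw [div_le_iff₀ hz, le_div_iff₀ hb]
        constructor <;> linarith
      · right
        have h7 := hsmall j (h5 h6)
        have h8 : β / b = 1 / 2 := by rw [hβ]; field_simp
        rw [h8] at h7
        nlinarith [hq j hj]
  · have hβb : β / b = 1 / 4 + 5 / 4 * (3 / 5 - y) := by
      rw [hy]
      field_simp
      linarith
    have hu' : u / z ≤ 3 / 10 - (3 / 5 - y) / 2 := by
      rw [div_le_iff₀ hz]
      linarith
    refine sum_le_of_late hb hb1 (by linarith) (by linarith) hβb hu' hT' hq fun j hj => ?_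
    by_cases hjD : j ∈ D
    · obtain ⟨h3, h4⟩ := hL.before j hjD
      rcases hE j h3 (hlt j hj) with h5 | h5
      · exact .inl h5
      · refine .inr (.inl ⟨h5, ?_⟩)
        -- Since u ≤ x₀/2 < 3z/10, the bid on `u` lies in the linear branch.
        rw [earlyBid, if_neg (by linarith), if_neg (by linarith), div_le_iff₀ (by positivity)] at h4
        rw [← mul_div_assoc, div_le_div_iff₀ hz hb]
        linarith
    · obtain ⟨h3, h4, h5⟩ := hL.after j (by simp) hjD
      rcases le_or_gt (3 * z - 5 * x₀) (5 * v {j}) with h6 | h6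
      · exact .inr (.inr (.inl ⟨by gcongr, by gcongr; exact h4 h6⟩))
      · exact .inr (.inr (.inr (hsmall j (h5 h6))))

end Invariants

end FairAlloc

end

/-! ### The game among all agents, and the reduction of targets. -/

noncomputable section

namespace FairAlloc

/-! ### The bidding game -/

open Classical in
/-- The class of a submodular valuation: `2` for unit-demand, `1` for additive, `0` otherwise. -/
def classOf {m : ℕ} (v : Finset (Fin m) → ℝ) : ℕ :=
  if UnitDemandTest v then 2 else if ∑ j, v {j} ≤ v Finset.univ then 1 else 0

/-- The bid of an agent of class `c`. -/
def bid (c : ℕ) (b z x x₀ β d : ℝ) : ℝ :=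
  if c = 2 then bidUnitDemand b x d
  else if c = 1 then bidAdditive b z x x₀ β d else bidSubmodular b z x d

/-- The invariant of an agent of class `c`. -/
def AgentInv {m : ℕ} (c : ℕ) (v : Finset (Fin m) → ℝ) (b z : ℝ) (X R : Finset (Fin m))
    (p : Fin m → ℝ) (x₀ β : ℝ) : Prop :=
  if c = 2 then InvUD v b X R p else if c = 1 then InvAdd v b z X R p x₀ β else InvSub v b z X R p

section Agent

variable {m : ℕ} {v : Finset (Fin m) → ℝ} {b z x₀ β : ℝ} {X R : Finset (Fin m)} {p : Fin m → ℝ}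

theorem isAdditive_of_classOf (h0 : v ∅ = 0) (hsub : IsSubmodular v) (h : classOf v = 1) :
    IsAdditive v := by
  rw [classOf] at h
  split_ifs at h with h1 h2
  · omega
  · exact isAdditive_of_sum_le h0 hsub h2

theorem test_of_classOf (h : classOf v = 2) : UnitDemandTest v := by
  rw [classOf] at h
  split_ifs at h with h1 h2
  · exact h1
  · omega

theorem AgentInv.pay {c : ℕ} (h : AgentInv c v b z X R p x₀ β) : ∑ j ∈ X, p j ≤ b := by
  rw [AgentInv] at h
  split_ifs at h
  exacts [h.pay, h.pay, h.pay]

theorem AgentInv.init (h0 : v ∅ = 0) (hb : 0 < b) (c : ℕ) :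
    AgentInv c v b z ∅ Finset.univ 0 0 0 := by
  rw [AgentInv]
  split_ifs
  · exact ⟨by simpa using hb.le, by simp, by simp, by simp [h0]⟩
  · exact ⟨by simpa using hb.le, by simp, by simp, fun h1 h2 => by rw [h0] at h1 h2; linarith⟩
  · exact ⟨by simpa using hb.le, by simp [h0], by simp, by simp [h0]⟩

theorem AgentInv.own (hmono : ∀ S T, S ⊆ T → v S ≤ v T) (h0 : v ∅ = 0) (hsub : IsSubmodular v)
    (hb : 0 < b) (h : AgentInv (classOf v) v b z X R p x₀ β) {j : Fin m} (hj : j ∈ R)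
    (hXR : Disjoint X R) {d : ℝ} (hd : ∀ r ∈ R, v (insert r X) - v X ≤ d)
    (hjd : v (insert j X) - v X = d) :
    AgentInv (classOf v) v b z (insert j X) (R.erase j)
      (Function.update p j (bid (classOf v) b z (v X) x₀ β d))
      (if 5 * v X < 2 * z then v (insert j X) else x₀)
      (if 5 * v X < 2 * z then budgetAfter b z (v (insert j X)) d else β) := by
  have hjX : j ∉ X := Finset.disjoint_right.1 hXR hj
  rw [AgentInv] at h ⊢
  rw [bid]
  split_ifs at h with h1 h2
  · rw [if_pos h1, if_pos h1]
    exact h.own hmono h0 hjX hd hjd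
  · rw [if_neg h1, if_neg h1, if_pos h2, if_pos h2]
    exact h.own hmono h0 (isAdditive_of_classOf h0 hsub h2) hb hj hjX hXR hd hjd
  · rw [if_neg h1, if_neg h1, if_neg h2, if_neg h2]
    exact h.own hmono h0 hsub hb hj hjX hd hjd

theorem AgentInv.other (hmono : ∀ S T, S ⊆ T → v S ≤ v T) (h0 : v ∅ = 0) (hsub : IsSubmodular v)
    (hb : 0 < b) (h : AgentInv (classOf v) v b z X R p x₀ β) {j : Fin m} (hj : j ∈ R)
    (hXR : Disjoint X R) {d : ℝ} (hd : ∀ r ∈ R, v (insert r X) - v X ≤ d) {π : ℝ}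
    (hπ : bid (classOf v) b z (v X) x₀ β d ≤ π) :
    AgentInv (classOf v) v b z X (R.erase j) (Function.update p j π) x₀ β := by
  have hjX : j ∉ X := Finset.disjoint_right.1 hXR hj
  rw [AgentInv] at h ⊢
  rw [bid] at hπ
  split_ifs at h with h1 h2
  · rw [if_pos h1] at hπ ⊢
    exact h.other hmono h0 hj hjX hd hπ
  · rw [if_neg h1, if_pos h2] at hπ ⊢
    exact h.other hmono h0 (isAdditive_of_classOf h0 hsub h2) hb hj hXR hd hπ
  · rw [if_neg h1, if_neg h2] at hπ ⊢
    exact h.other hmono h0 hb hj hjX hd hπ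

/-- Needed twice: prices must be non-negative, and every round must have a winner although the
record starts at -1. -/
theorem AgentInv.bid_nonneg (hmono : ∀ S T, S ⊆ T → v S ≤ v T) (h0 : v ∅ = 0) {c : ℕ}
    (hb : 0 < b) (h : AgentInv c v b z X R p x₀ β) {d : ℝ} (hd : 0 ≤ d) :
    0 ≤ bid c b z (v X) x₀ β d := by
  have hx0 : 0 ≤ v X := h0 ▸ hmono _ _ (Finset.empty_subset _)
  rw [AgentInv] at h
  rw [bid]
  split_ifs at h ⊢ with h1 h2
  · rw [bidUnitDemand]
    split_ifs <;> linarith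
  · rw [bidAdditive]
    split_ifs with h3 h4
    · exact le_rfl
    · obtain ⟨D, X₀, u, hL⟩ := h.late h4 (not_le.1 h3)
      have hxx : x₀ ≤ v X := hL.value ▸ hmono _ _ hL.sub
      have := hL.pos
      rw [lateBid]
      split_ifs with h5
      · exact this.le
      · exact div_nonneg (by positivity) (by linarith)
    · exact earlyBid_nonneg hb (by linarith) hd
  · rw [bidSubmodular]
    split_ifs with h3 h4
    · exact le_rfl
    · exact hb.le
    · have : 0 < z := by linarith
      positivity

/-- An agent of class `c` is satisfied with a bundle of value `x`, given the target `z`. -/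
def Satisfied (c : ℕ) (z x : ℝ) : Prop := c = 2 ∨ c = 1 ∧ 3 * z ≤ 5 * x ∨ c ≠ 1 ∧ z ≤ 3 * x

theorem AgentInv.anyPrice_le_of_not_satisfied (hmono : ∀ S T, S ⊆ T → v S ≤ v T) (h0 : v ∅ = 0)
    (hsub : IsSubmodular v) (hb : 0 < b) (hb1 : b ≤ 1)
    (h : AgentInv (classOf v) v b z X ∅ p x₀ β) (hp : ∀ j, 0 ≤ p j)
    (hothers : ∑ j ∈ Xᶜ, p j ≤ 1 - b) (hfail : ¬ Satisfied (classOf v) z (v X)) :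
    anyPrice b v ≤ (1 - b / 50) * z := by
  simp only [Satisfied, not_or, not_and, not_le, ne_eq] at hfail
  rw [AgentInv, if_neg hfail.1] at h
  split_ifs at h with h2
  · exact h.anyPrice_le hmono h0 (isAdditive_of_classOf h0 hsub h2) hb hb1 hp hothers
      (hfail.2.1 h2)
  · exact h.anyPrice_le hmono h0 hsub hb hb1 hp hothers (hfail.2.2 h2)

theorem AgentInv.anyPrice_le_of_unitDemand (hmono : ∀ S T, S ⊆ T → v S ≤ v T) (h0 : v ∅ = 0)
    (hb : 0 < b) (hb1 : b ≤ 1)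
    (h : AgentInv (classOf v) v b z X ∅ p x₀ β) (hp : ∀ j, 0 ≤ p j)
    (hothers : ∑ j ∈ Xᶜ, p j ≤ 1 - b) (hc : classOf v = 2) : anyPrice b v ≤ v X := by
  rw [AgentInv, if_pos hc] at h
  exact h.anyPrice_le hmono h0 (test_of_classOf hc) hb hb1 hp hothers

end Agent

section Game

variable {n m : ℕ} {I : Instance n m}

theorem Instance.ent_le_one (I : Instance n m) (i : Fin n) : I.ent i ≤ 1 := by
  rw [← I.ent_sum]
  exact Finset.single_le_sum (fun i _ => (I.ent_pos i).le) (Finset.mem_univ i)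

theorem Instance.val_nonneg (I : Instance n m) (i : Fin n) (S : Finset (Fin m)) :
    0 ≤ I.val i S := I.val_empty i ▸ I.val_mono i _ _ (Finset.empty_subset _)

/-- The items with owner `i`; items with owner `n` are free. -/
def owned (own : Fin m → ℕ) (i : ℕ) : Finset (Fin m) := Finset.univ.filter fun j => own j = i

theorem mem_owned {own : Fin m → ℕ} {i : ℕ} {j : Fin m} : j ∈ owned own i ↔ own j = i := by
  simp [owned]

theorem disjoint_owned {own : Fin m → ℕ} {i i' : ℕ} (h : i ≠ i') :
    Disjoint (owned own i) (owned own i') :=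
  Finset.disjoint_left.2 fun _ hj hj' => h ((mem_owned.1 hj).symm.trans (mem_owned.1 hj'))

theorem owned_update_self {own : Fin m → ℕ} {i : ℕ} {j : Fin m} :
    owned (Function.update own j i) i = insert j (owned own i) := by
  ext k
  rw [Finset.mem_insert, mem_owned, mem_owned]
  by_cases h : k = j
  · subst h; simp
  · simp [h]

theorem owned_update_of_ne {own : Fin m → ℕ} {i i' : ℕ} (hi : i' ≠ i) {j : Fin m} :
    owned (Function.update own j i) i' = (owned own i').erase j := by
  ext k
  rw [Finset.mem_erase, mem_owned, mem_owned]
  by_cases h : k = j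
  · subst h; simp [hi.symm]
  · simp [h]

/-- What agent `i` gains if the item `j` is added to her bundle. -/
def gain (I : Instance n m) (own : Fin m → ℕ) (i : Fin n) (j : Fin m) : ℝ :=
  I.val i (insert j (owned own i)) - I.val i (owned own i)

theorem gain_nonneg (own : Fin m → ℕ) (i : Fin n) (j : Fin m) :
    0 ≤ gain I own i j :=
  sub_nonneg.2 (I.val_mono i _ _ (Finset.subset_insert _ _))

/-- The bid of agent `i` in the bidding game with targets `z`. -/
def gameBid (I : Instance n m) (z : Fin n → ℝ) (own : Fin m → ℕ) (x₀ β : Fin n → ℝ) (i : Fin n)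
    (d : ℝ) : ℝ :=
  bid (classOf (I.val i)) (I.ent i) (z i) (I.val i (owned own i)) (x₀ i) (β i) d

/-- The invariant of the bidding game, where `p j` is the price at which `j` was sold. -/
structure GameInv (I : Instance n m) (z : Fin n → ℝ) (own : Fin m → ℕ) (x₀ β : Fin n → ℝ)
    (p : Fin m → ℝ) : Prop where
  nonneg : ∀ j, 0 ≤ p j
  agent : ∀ i : Fin n, AgentInv (classOf (I.val i)) (I.val i) (I.ent i) (z i) (owned own i)
    (owned own n) p (x₀ i) (β i)

theorem GameInv.init (I : Instance n m) (z : Fin n → ℝ) :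
    GameInv I z (fun _ => n) 0 0 0 := by
  refine ⟨fun _ => le_rfl, fun i => ?_⟩
  have h1 : owned (fun _ : Fin m => n) i = ∅ := by simp [owned, i.isLt.ne']
  have h2 : owned (fun _ : Fin m => n) n = Finset.univ := by simp [owned]
  rw [h1, h2]
  exact AgentInv.init (I.val_empty i) (I.ent_pos i) _

/-- The sale price is the winner's own bid and at least the bid of each other agent on her best
item; the invariants of the agents require no more. -/
theorem GameInv.step (hsub : ∀ i, IsSubmodular (I.val i)) {z : Fin n → ℝ} {own : Fin m → ℕ}
    {x₀ β : Fin n → ℝ} {p : Fin m → ℝ} (h : GameInv I z own x₀ β p) {i : Fin n} {j : Fin m}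
    (hj : own j = n) (hmax : ∀ r, own r = n → gain I own i r ≤ gain I own i j)
    (hwin : ∀ i', ∃ d, (∀ r, own r = n → gain I own i' r ≤ d) ∧
      gameBid I z own x₀ β i' d ≤ gameBid I z own x₀ β i (gain I own i j)) :
    GameInv I z (Function.update own j i)
      (Function.update x₀ i (if 5 * I.val i (owned own i) < 2 * z i then
        I.val i (insert j (owned own i)) else x₀ i))
      (Function.update β i (if 5 * I.val i (owned own i) < 2 * z i then
        budgetAfter (I.ent i) (z i) (I.val i (insert j (owned own i))) (gain I own i j) else β i))
      (Function.update p j (gameBid I z own x₀ β i (gain I own i j))) := by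
  have hjR : j ∈ owned own n := mem_owned.2 hj
  refine ⟨fun k => ?_, fun i' => ?_⟩
  · by_cases hk : k = j
    · subst hk
      rw [Function.update_self]
      exact (h.agent i).bid_nonneg (I.val_mono i) (I.val_empty i) (I.ent_pos i) (gain_nonneg _ _ _)
    · rw [Function.update_of_ne hk]
      exact h.nonneg k
  · rw [owned_update_of_ne i.isLt.ne']
    have hdis : Disjoint (owned own i') (owned own n) := disjoint_owned i'.isLt.ne
    by_cases hi : i' = i
    · subst hi
      rw [owned_update_self, Function.update_self, Function.update_self]
      exact (h.agent i').own (I.val_mono i') (I.val_empty i') (hsub i') (I.ent_pos i') hjR hdis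
        (fun r hr => hmax r (mem_owned.1 hr)) rfl
    · have hne : (i' : ℕ) ≠ i := fun h => hi (Fin.ext h)
      rw [owned_update_of_ne hne, Function.update_of_ne hi, Function.update_of_ne hi,
        Finset.erase_eq_of_notMem (Finset.disjoint_right.1 hdis hjR)]
      obtain ⟨d, hd, hbid⟩ := hwin i'
      exact (h.agent i').other (I.val_mono i') (I.val_empty i') (hsub i') (I.ent_pos i') hjR hdis
        (fun r hr => hd r (mem_owned.1 hr)) hbid

/-- The bundles partition the items, each agent pays at most her entitlement, and the entitlements
add up to one. -/
theorem GameInv.others {z : Fin n → ℝ} {own : Fin m → ℕ}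
    {x₀ β : Fin n → ℝ} {p : Fin m → ℝ} (h : GameInv I z own x₀ β p) (hown : ∀ j, own j < n)
    (i : Fin n) : ∑ j ∈ (owned own i)ᶜ, p j ≤ 1 - I.ent i := by
  have h1 : ∑ i' : Fin n, ∑ j ∈ owned own i', p j = ∑ j, p j := by
    rw [← Finset.sum_fiberwise Finset.univ (fun j => (⟨own j, hown j⟩ : Fin n)) p]
    refine Finset.sum_congr rfl fun i' _ => Finset.sum_congr ?_ fun _ _ => rfl
    ext j
    simp [owned, Fin.ext_iff]
  rw [← Finset.sum_add_sum_compl (owned own i), ← Finset.add_sum_erase _ _ (Finset.mem_univ i)] at h1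
  have h2 := I.ent_sum
  rw [← Finset.add_sum_erase _ _ (Finset.mem_univ i)] at h2
  have h3 : ∑ i' ∈ Finset.univ.erase i, ∑ j ∈ owned own i', p j ≤
      ∑ i' ∈ Finset.univ.erase i, I.ent i' :=
    Finset.sum_le_sum fun i' _ => (h.agent i').pay
  linarith

theorem GameInv.aps_le_of_not_satisfied (hsub : ∀ i, IsSubmodular (I.val i)) {z : Fin n → ℝ}
    {own : Fin m → ℕ} {x₀ β : Fin n → ℝ} {p : Fin m → ℝ} (h : GameInv I z own x₀ β p)
    (hown : ∀ j, own j < n) {i : Fin n}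
    (hi : ¬ Satisfied (classOf (I.val i)) (z i) (I.val i (owned own i))) :
    I.aps i ≤ (1 - I.ent i / 50) * z i := by
  have h1 := h.agent i
  have h2 : owned own n = ∅ :=
    Finset.filter_eq_empty_iff.2 fun j _ => (hown j).ne
  rw [h2] at h1
  exact h1.anyPrice_le_of_not_satisfied (I.val_mono i) (I.val_empty i) (hsub i) (I.ent_pos i)
    (I.ent_le_one i) h.nonneg (h.others hown i) hi

theorem GameInv.aps_le_of_unitDemand {z : Fin n → ℝ}
    {own : Fin m → ℕ} {x₀ β : Fin n → ℝ} {p : Fin m → ℝ} (h : GameInv I z own x₀ β p)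
    (hown : ∀ j, own j < n) {i : Fin n} (hi : classOf (I.val i) = 2) :
    I.aps i ≤ I.val i (owned own i) := by
  have h1 := h.agent i
  have h2 : owned own n = ∅ :=
    Finset.filter_eq_empty_iff.2 fun j _ => (hown j).ne
  rw [h2] at h1
  exact h1.anyPrice_le_of_unitDemand (I.val_mono i) (I.val_empty i) (I.ent_pos i)
    (I.ent_le_one i) h.nonneg (h.others hown i) hi

/-! ### Targets -/

open Classical in
/-- The initial target of agent `i`. -/
def initialTarget (I : Instance n m) (i : Fin n) : ℝ :=
  if 1 ≤ I.ent i * (posItems (I.val i)).card then I.val i Finset.univ else 0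

/-- The factor by which an unsatisfied agent reduces her target. -/
def reduction (m : ℕ) : ℝ := (50 * m - 1) / (50 * m)

/-- The target 0 is used only where the share is 0; any bundle meets it, so it is never reduced. -/
theorem aps_le_initialTarget (hsub : ∀ i, IsSubmodular (I.val i)) (i : Fin n) :
    I.aps i ≤ initialTarget I i := by
  rw [initialTarget]
  split_ifs with h
  · exact anyPrice_le_univ (I.val_empty i) (I.val_mono i) (I.ent_pos i).le
  · exact anyPrice_le_zero (I.val_empty i) (hsub i) (I.ent_pos i).le (not_le.1 h)

/-- The inverse of the factor is 1 + 1/(50m - 1), and its power with exponent 50m is at least 2 by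
Bernoulli's inequality. -/
theorem reduction_pow_le (hm : 0 < m) (k : ℕ) : reduction m ^ (50 * m * k) ≤ (1 / 2) ^ k := by
  have h50 : (1 : ℝ) < 50 * m := by
    have : (1 : ℝ) ≤ m := by exact_mod_cast hm
    linarith
  rw [pow_mul]
  have h0 : 0 < reduction m := div_pos (by linarith) (by linarith)
  refine pow_le_pow_left₀ (by positivity) ?_ k
  have h1 : (2 : ℝ) ≤ (1 + 1 / (50 * m - 1)) ^ (50 * m) := by
    refine le_trans ?_ (one_add_mul_le_pow (by
      have : 0 ≤ 1 / (50 * (m : ℝ) - 1) := one_div_nonneg.2 (by linarith)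
      linarith) _)
    push_cast
    have : 1 ≤ 50 * (m : ℝ) * (1 / (50 * m - 1)) := by
      rw [mul_one_div, le_div_iff₀ (by linarith)]
      linarith
    linarith
  have h2 : 1 + 1 / (50 * (m : ℝ) - 1) = (reduction m)⁻¹ := by
    have h3 : 50 * (m : ℝ) - 1 ≠ 0 := by linarith
    have h4 : 50 * (m : ℝ) ≠ 0 := by linarith
    rw [reduction, inv_div]
    field_simp
    ring
  rw [h2, inv_pow] at h1
  rw [one_div]
  exact le_inv_of_le_inv₀ (by positivity) h1

/-- A target that is at least the AnyPrice share has been reduced only a few times. -/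
theorem reductions_le {k : ℕ}
    (hk : ∀ i S, 0 < I.val i S → I.val i Finset.univ ≤ 2 ^ k * I.val i S) {i : Fin n} {r : ℕ}
    (hpos : 0 < initialTarget I i) (h : I.aps i ≤ initialTarget I i * reduction m ^ r) :
    r ≤ 50 * m * k := by
  rw [initialTarget] at hpos h
  split_ifs at hpos h with h1
  · have hm : 0 < m := by
      rcases Nat.eq_zero_or_pos m with rfl | hm
      · rw [Finset.univ_eq_empty, I.val_empty] at hpos
        exact absurd hpos (lt_irrefl _)
      · exact hm
    have h50 : (1 : ℝ) < 50 * m := by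
      have : (1 : ℝ) ≤ m := by exact_mod_cast hm
      linarith
    have hr0 : 0 < reduction m := div_pos (by linarith) (by linarith)
    have hr1 : reduction m < 1 := (div_lt_one (by linarith)).2 (by linarith)
    have h2 : I.val i Finset.univ / 2 ^ k ≤ I.aps i :=
      le_anyPrice_of_posItems h1 fun j hj => (div_le_iff₀' (by positivity)).2 (hk i _ hj)
    by_contra! hlt
    have h3 : reduction m ^ r < (1 / 2) ^ k :=
      (pow_lt_pow_right_of_lt_one₀ hr0 hr1 hlt).trans_le (reduction_pow_le hm k)
    have h4 := mul_lt_mul_of_pos_left h3 hpos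
    rw [one_div, inv_pow, ← div_eq_mul_inv] at h4
    linarith
  · exact absurd hpos (lt_irrefl _)

/-- A positive initial target implies `b * m ≥ 1`, so the gap b/50 is at least 1/(50m). Hence tiny
entitlements do not slow the algorithm down. -/
theorem aps_le_reduced {z : ℝ} {i : Fin n} (hz : 0 ≤ z) (hpos : 0 < initialTarget I i)
    (h : I.aps i ≤ (1 - I.ent i / 50) * z) : I.aps i ≤ z * reduction m := by
  rw [initialTarget] at hpos
  split_ifs at hpos with h1
  · have h2 := one_le_mul_of_posItems (I.ent_pos i).le h1
    have hm : (0 : ℝ) < m := by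
      by_contra! hm
      nlinarith [I.ent_pos i]
    refine h.trans ?_
    rw [mul_comm]
    refine mul_le_mul_of_nonneg_left ?_ hz
    rw [reduction, le_div_iff₀ (by positivity)]
    nlinarith
  · exact absurd hpos (lt_irrefl _)

end Game

end FairAlloc

end

/-! ### The program, and verification of the classification of agents. -/

noncomputable section

namespace FairAlloc

/-! ### The program

Arrays of natural numbers: `0` number of agents, `1` number of items, `2` owners, `3` classes,
`4` queried set, `5`, `6`, `7`, `8` loop counters (`7` runs over agents), `9` number of valuable
items, `10` result of the unit-demand test, `11` best item, `12` winner, `13` item sold,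
`14` repetition flag. Arrays of numbers: `0` entitlements, `1` targets, `2` values of bundles,
`3` and `4` memory of additive agents, `5` values of items, `6` answer, `7` sum of the values of the
items, `9` best gain, `10` bid, `11` highest bid, `12` gain of the winner. -/

/-- Cell `0` of the array `a` of natural numbers. -/
def ig (a : ℕ) : IExpr := .get a (.const 0)

/-- Cell `0` of the array `a` of numbers. -/
def ng (a : ℕ) : NExpr := .get a (.const 0)

/-- The cell of the current agent in the array `a` of numbers. -/
def ag (a : ℕ) : NExpr := .get a (ig 7)

/-- A constant number. -/
def nc (k : ℕ) : NExpr := .ofIdx (.const k)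

def BExpr.eq (e f : IExpr) : BExpr := .and (.ile e f) (.ile f e)

def BExpr.or (b c : BExpr) : BExpr := .not (.and (.not b) (.not c))

@[simp] theorem ig_eval (a : ℕ) (s : Store) : (ig a).eval s = s.idx a 0 := by rfl

@[simp] theorem ng_eval (a : ℕ) (s : Store) : (ng a).eval s = s.num a 0 := by rfl

@[simp] theorem ag_eval (a : ℕ) (s : Store) : (ag a).eval s = s.num a (s.idx 7 0) := by rfl

@[simp] theorem nc_eval (k : ℕ) (s : Store) : (nc k).eval s = (k : ℝ) := by rfl

@[simp] theorem BExpr.eq_eval (e f : IExpr) (s : Store) :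
    (BExpr.eq e f).eval s ↔ e.eval s = f.eval s := by
  simp only [BExpr.eq, BExpr.eval]
  omega

@[simp] theorem BExpr.or_eval (b c : BExpr) (s : Store) :
    (BExpr.or b c).eval s ↔ b.eval s ∨ c.eval s := by
  simp only [BExpr.or, BExpr.eval]
  tauto

/-- Writes the set of the items that satisfy `cond` into array `4`. -/
def buildSet (cond : BExpr) : Prog :=
  forLoop 5 1 (.ite cond (.setIdx 4 (ig 5) (.const 1)) (.setIdx 4 (ig 5) (.const 0)))

/-- Asks the current agent for the value of the set of the items that satisfy `cond`. -/
def ask (cond : BExpr) : Prog := .seq (buildSet cond) (.query 6 (.const 0) (ig 7) 4)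

@[simp] theorem ask_modI (cond : BExpr) : (ask cond).modI = [5, 4, 4, 5] := by rfl

@[simp] theorem ask_modN (cond : BExpr) : (ask cond).modN = [6] := by rfl

/-- The values of the single items, their sum, and the number of items of positive value. -/
def singles : Prog :=
  .seq (.setIdx 9 (.const 0) (.const 0)) (.seq (.setNum 7 (.const 0) (nc 0))
    (forLoop 6 1 (.seq (ask (.eq (ig 5) (ig 6))) (.seq (.setNum 5 (ig 6) (ng 6))
      (.seq (.setNum 7 (.const 0) (.add (ng 7) (ng 6)))
        (.ite (.nle (ng 6) (nc 0)) .skip (.setIdx 9 (.const 0) (.add (ig 9) (.const 1)))))))))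

/-- The test for unit-demand valuations. -/
def unitDemandTest : Prog :=
  .seq (.setIdx 10 (.const 0) (.const 1))
    (forLoop 6 1 (.seq (ask (.nle (.get 5 (ig 5)) (.get 5 (ig 6))))
      (.ite (.nle (ng 6) (.get 5 (ig 6))) .skip (.setIdx 10 (.const 0) (.const 0)))))

/-- Class and initial target of the current agent. -/
def classifyAgent : Prog :=
  .seq singles (.seq unitDemandTest (.seq (ask (.ile (.const 0) (.const 0)))
    (.seq (.ite (.ile (.const 1) (ig 10)) (.setIdx 3 (ig 7) (.const 2))
        (.ite (.nle (ng 7) (ng 6)) (.setIdx 3 (ig 7) (.const 1)) (.setIdx 3 (ig 7) (.const 0))))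
      (.ite (.nle (nc 1) (.mul (ag 0) (.ofIdx (ig 9)))) (.setNum 1 (ig 7) (ng 6))
        (.setNum 1 (ig 7) (nc 0))))))

def classify : Prog := forLoop 7 0 classifyAgent

/-- The free item with the greatest gain for the current agent. -/
def bestItem : Prog :=
  .seq (.setNum 9 (.const 0) (.sub (nc 0) (nc 1)))
    (forLoop 6 1 (.ite (.eq (.get 2 (ig 6)) (ig 0))
      (.seq (ask (.or (.eq (.get 2 (ig 5)) (ig 7)) (.eq (ig 5) (ig 6))))
        (.ite (.nle (.sub (ng 6) (ag 2)) (ng 9)) .skip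
          (.seq (.setNum 9 (.const 0) (.sub (ng 6) (ag 2))) (.setIdx 11 (.const 0) (ig 6)))))
      .skip))

/-- The bid of the current agent. -/
def computeBid : Prog :=
  let bidIs (x : NExpr) : Prog := .setNum 10 (.const 0) x
  .ite (.ile (.const 2) (.get 3 (ig 7)))
    (.ite (.nle (ag 2) (nc 0)) (.ite (.nle (ng 9) (nc 0)) (bidIs (nc 0)) (bidIs (ag 0)))
      (bidIs (nc 0)))
    (.ite (.ile (.const 1) (.get 3 (ig 7)))
      (.ite (.nle (.mul (nc 3) (ag 1)) (.mul (nc 5) (ag 2))) (bidIs (nc 0))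
        (.ite (.nle (.mul (nc 2) (ag 1)) (.mul (nc 5) (ag 2)))
          (.ite (.nle (.sub (.mul (nc 3) (ag 1)) (.mul (nc 5) (ag 3))) (.mul (nc 5) (ng 9)))
            (bidIs (ag 4))
            (bidIs (.div (.mul (.mul (nc 5) (ng 9)) (ag 4))
              (.mul (nc 2) (.sub (.mul (nc 3) (ag 1)) (.mul (nc 5) (ag 3)))))))
          (.ite (.nle (.mul (nc 3) (ag 1)) (.mul (nc 5) (ng 9))) (bidIs (ag 0))
            (.ite (.nle (.mul (nc 2) (ag 1)) (.mul (nc 5) (ng 9))) (bidIs (.div (ag 0) (nc 2)))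
              (bidIs (.div (.mul (.mul (nc 5) (ng 9)) (ag 0)) (.mul (nc 4) (ag 1))))))))
      (.ite (.nle (ag 1) (.mul (nc 3) (ag 2))) (bidIs (nc 0))
        (.ite (.nle (ag 1) (.mul (nc 3) (ng 9))) (bidIs (ag 0))
          (bidIs (.div (.mul (.mul (nc 3) (ng 9)) (ag 0)) (.mul (nc 2) (ag 1)))))))

/-- The highest bid. -/
def bidding : Prog :=
  forLoop 7 0 (.seq bestItem (.seq computeBid (.ite (.nle (ng 10) (ng 11)) .skip
    (.seq (.setNum 11 (.const 0) (ng 10)) (.seq (.setIdx 12 (.const 0) (ig 7))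
      (.seq (.setIdx 13 (.const 0) (ig 11)) (.setNum 12 (.const 0) (ng 9))))))))

/-- The sale of an item to the winner. -/
def sell : Prog :=
  let wg (a : ℕ) : NExpr := .get a (ig 12)
  .seq (.setIdx 2 (ig 13) (ig 12))
    (.seq (.ite (.nle (.mul (nc 2) (wg 1)) (.mul (nc 5) (wg 2))) .skip
        (.seq (.setNum 3 (ig 12) (.add (wg 2) (ng 12)))
          (.ite (.nle (.mul (nc 2) (wg 1)) (.mul (nc 5) (ng 12)))
            (.setNum 4 (ig 12) (.div (wg 0) (nc 2)))
            (.setNum 4 (ig 12) (.mul (wg 0) (.sub (nc 1)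
              (.div (.mul (nc 5) (.add (wg 2) (ng 12))) (.mul (nc 4) (wg 1)))))))))
      (.setNum 2 (ig 12) (.add (wg 2) (ng 12))))

/-- The record starts at -1, so that a highest bid of zero still wins and every round sells an item.
-/
def round : Prog := .seq (.setNum 11 (.const 0) (.sub (nc 0) (nc 1))) (.seq bidding sell)

def reset : Prog :=
  .seq (forLoop 7 0 (.seq (.setNum 2 (ig 7) (nc 0)) (.seq (.setNum 3 (ig 7) (nc 0))
    (.setNum 4 (ig 7) (nc 0))))) (forLoop 6 1 (.setIdx 2 (ig 6) (ig 0)))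

/-- The bidding game. -/
def play : Prog := .seq reset (forLoop 8 1 round)

/-- The reduction of the targets of the unsatisfied agents. -/
def adjust : Prog :=
  let reduce : Prog := .seq (.setNum 1 (ig 7) (.mul (ag 1)
    (.div (.sub (.mul (nc 50) (.ofIdx (ig 1))) (nc 1)) (.mul (nc 50) (.ofIdx (ig 1))))))
    (.setIdx 14 (.const 0) (.const 1))
  .seq (.setIdx 14 (.const 0) (.const 0))
    (forLoop 7 0 (.ite (.ile (.const 2) (.get 3 (ig 7))) .skip
      (.ite (.ile (.const 1) (.get 3 (ig 7)))
        (.ite (.nle (.mul (nc 3) (ag 1)) (.mul (nc 5) (ag 2))) .skip reduce)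
        (.ite (.nle (ag 1) (.mul (nc 3) (ag 2))) .skip reduce))))

/-- The allocation algorithm. -/
def allocate : Prog :=
  .seq classify (.seq (.setIdx 14 (.const 0) (.const 1))
    (.loop (.ile (.const 1) (ig 14)) (.seq play adjust)))

/-! ### Verification -/

/-- A budget that an additive agent may remember. -/
def IsBudget {n m : ℕ} (I : Instance n m) (i : Fin n) (z β : ℝ) : Prop :=
  β = 0 ∨ ∃ S T U, β = budgetAfter (I.ent i) z (I.val i S) (I.val i T - I.val i U)

/-- The numbers that the program writes satisfy `K`, as long as the targets satisfy `Z`. -/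
structure Admissible {n m : ℕ} (I : Instance n m) (K : ℝ → Prop) (N : ℕ)
    (Z : Fin n → ℝ → Prop) : Prop where
  n_le : n ≤ N
  m_le : m ≤ N
  two_le : 2 ≤ N
  zero : K 0
  neg : K (0 - 1)
  val : ∀ i S, K (I.val i S)
  diff : ∀ i S T, K (I.val i S - I.val i T)
  sum : ∀ i (S : Finset (Fin m)), K (∑ j ∈ S, I.val i {j})
  target : ∀ i z, Z i z → K z
  budget : ∀ i z β, Z i z → IsBudget I i z β → K β
  bid : ∀ i z β, Z i z → IsBudget I i z β → ∀ c S T U V,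
    K (bid c (I.ent i) z (I.val i S) (I.val i T) β (I.val i U - I.val i V))

section

variable {n m : ℕ} {I : Instance n m} {K : ℝ → Prop} {N : ℕ} {Z : Fin n → ℝ → Prop}

theorem wp_intro_seq {O : ℕ → (ℕ → ℕ) → ℝ} {c d : Prog} {Q : Store → Prop} {s : Store}
    (h : wp O K N c (fun s' => wp O K N d Q s') s) : wp O K N (.seq c d) Q s := h

/-- The test is evaluated while array `4` is being filled; `Frame` gives the caller the contents of
all the arrays that this leaves alone. -/
theorem wp_ask (hA : Admissible I K N Z) {cond : BExpr} {s : Store} (hm : s.idx 1 0 = m)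
    (i : Fin n) (hi : s.idx 7 0 = i) (S : Finset (Fin m))
    (hcond : ∀ s1, Frame (ask cond) s s1 → ∀ k : Fin m, s1.idx 5 0 = k →
      (cond.eval s1 ↔ k ∈ S)) :
    wp I.oracle K N (ask cond) (fun s' => s'.num 6 0 = I.val i S) s := by
  have h2 := hA.two_le
  refine wp_seq (fun s' => ∀ k : Fin m, s'.idx 4 k = if k ∈ S then 1 else 0) ?_ ?_
  · refine wp_forLoop
      (fun k s' => ∀ j : Fin m, (j : ℕ) < k → s'.idx 4 j = if j ∈ S then 1 else 0) m hm hA.m_le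
      (by simp [Prog.modI]) (by simp [Prog.modI]) (by norm_num) (by simp) ?_ ?_
    · intro k hk s1 hf hc hJ
      have hcs := hcond s1 (hf.weaken (by simp [ask, buildSet, Prog.modI])
        (by simp [ask, buildSet, forLoop, Prog.modN])) ⟨k, hk⟩ hc
      have hstep : ∀ x : ℕ, (x = if (⟨k, hk⟩ : Fin m) ∈ S then 1 else 0) →
          ∀ j : Fin m, (j : ℕ) < k + 1 → ((s1.putIdx 4 k x).putIdx 5 0 (k + 1)).idx 4 j =
            if j ∈ S then 1 else 0 := by
        intro x hx j hj
        by_cases hjk : (j : ℕ) = k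
        · have : j = ⟨k, hk⟩ := Fin.ext hjk
          subst this
          simpa using hx
        · simpa [hjk] using hJ j (by omega)
      simp only [wp, IExpr.eval, ig_eval, hc]
      refine ⟨fun h => ⟨by omega, hstep 1 ?_⟩, fun h => ⟨by omega, hstep 0 ?_⟩⟩
      · rw [if_pos (hcs.1 h)]
      · rw [if_neg (fun h' => h (hcs.2 h'))]
    · intro s1 _ hJ k
      exact hJ k k.isLt
  · intro s' hf hS
    have hi' : s'.idx 7 0 = i := by
      rw [hf.idx 7 (by simp [buildSet, forLoop, Prog.modI]), hi]
    have hO : I.oracle (s'.idx 7 0) (s'.idx 4) = I.val i S := by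
      rw [hi', Instance.oracle, dif_pos i.isLt]
      congr 1
      ext k
      simp [hS k]
    simp only [wp, IExpr.eval, ig_eval, hO]
    exact ⟨hA.val i S, by simp⟩

theorem wp_singles (hA : Admissible I K N Z) {s : Store} (hm : s.idx 1 0 = m)
    (i : Fin n) (hi : s.idx 7 0 = i) :
    wp I.oracle K N singles (fun s' => (∀ j : Fin m, s'.num 5 j = I.val i {j}) ∧
      s'.num 7 0 = ∑ j, I.val i {j} ∧ s'.idx 9 0 = (posItems (I.val i)).card) s := by
  classical
  have h2 := hA.two_le
  refine ⟨Nat.zero_le _, by simpa using hA.zero, ?_⟩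
  refine wp_forLoop (fun k s' => (∀ j : Fin m, (j : ℕ) < k → s'.num 5 j = I.val i {j}) ∧
      s'.num 7 0 = ∑ j with (j : Fin m).val < k, I.val i {j} ∧
      s'.idx 9 0 = (Finset.univ.filter fun j : Fin m => (j : ℕ) < k ∧ 0 < I.val i {j}).card) m
      (by simpa using hm) hA.m_le
      (by simp [Prog.modI]) (by simp [Prog.modI]) (by norm_num) (by simp [IExpr.eval]) ?_ ?_
  · rintro k hk s1 hf hc ⟨hJ1, hJ2, hJ3⟩
    have hm1 : s1.idx 1 0 = m := by rw [hf.idx 1 (by decide)]; simpa using hm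
    have hi1 : s1.idx 7 0 = i := by rw [hf.idx 7 (by decide)]; simpa using hi
    have hins : (Finset.univ.filter fun j : Fin m => (j : ℕ) < k + 1) =
        insert ⟨k, hk⟩ (Finset.univ.filter fun j : Fin m => (j : ℕ) < k) := by
      ext j
      simp only [Finset.mem_filter, Finset.mem_univ, true_and, Finset.mem_insert, Fin.ext_iff]
      omega
    refine wp_seq _ (wp_ask hA hm1 i hi1 {⟨k, hk⟩} ?_) ?_
    · intro s2 hf2 k' hk'
      have : s2.idx 6 0 = k := by rw [hf2.idx 6 (by simp), hc]
      simp [hk', this, Fin.ext_iff]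
    · intro s2 hf2 hy
      have e6 : s2.idx 6 0 = k := by rw [hf2.idx 6 (by simp), hc]
      have e9 := congrFun (hf2.idx 9 (by simp)) 0
      have n5 := hf2.num 5 (by simp)
      have n7 := hf2.num 7 (by simp)
      have hsum : s2.num 7 0 + s2.num 6 0 =
          ∑ j with (j : Fin m).val < k + 1, I.val i {j} := by
        rw [n7, hJ2, hy, hins, Finset.sum_insert (by simp), add_comm]
      have h5 : ∀ j : Fin m, (j : ℕ) < k + 1 →
          (if (j : ℕ) = k then s2.num 6 0 else s2.num 5 j) = I.val i {j} := by
        intro j hj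
        split_ifs with h
        · have : j = ⟨k, hk⟩ := Fin.ext h
          rw [this, hy]
        · rw [n5]
          exact hJ1 j (by omega)
      have hcard : (Finset.univ.filter fun j : Fin m => (j : ℕ) < k + 1 ∧ 0 < I.val i {j}).card =
          (Finset.univ.filter fun j : Fin m => (j : ℕ) < k ∧ 0 < I.val i {j}).card +
            if 0 < s2.num 6 0 then 1 else 0 := by
        rw [← Finset.filter_filter, hins, ← Finset.filter_filter, Finset.filter_insert, hy]
        split_ifs with h
        · rw [Finset.card_insert_of_notMem (by simp)]
        · rw [add_zero]
      -- Natural numbers that are written must stay below `N`; this counter counts some of the first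
      -- `k` items.
      have hle : s1.idx 9 0 + 1 ≤ m := by
        rw [hJ3]
        calc _ ≤ (Finset.univ.filter fun j : Fin m => (j : ℕ) < k).card + 1 := by
              gcongr
              exact fun h => h.1
          _ = (Finset.univ.filter fun j : Fin m => (j : ℕ) < k + 1).card := by
              rw [hins, Finset.card_insert_of_notMem (by simp)]
          _ ≤ m := (Finset.card_le_univ _).trans (Fintype.card_fin m).le
      have hmN := hA.m_le
      simp only [wp, NExpr.eval, IExpr.eval, BExpr.eval, ig_eval, ng_eval, nc_eval, e6,
        Store.putNum_num, Store.putNum_idx]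
      simp only [Store.putIdx_idx, Store.putIdx_num, Store.putNum_num, Store.putNum_idx]
      norm_num [-Order.lt_add_one_iff]
      refine ⟨hy ▸ hA.val _ _, hsum ▸ hA.sum _ _, fun h => ⟨h5, hsum, ?_⟩,
        fun h => ⟨by omega, h5, hsum, ?_⟩⟩
      · rw [hcard, if_neg (not_lt.2 h), e9, hJ3, add_zero]
      · rw [hcard, if_pos h, e9, hJ3]
  · rintro s1 _ ⟨hJ1, hJ2, hJ3⟩
    refine ⟨fun j => hJ1 j j.isLt, by simpa using hJ2, by simpa [posItems] using hJ3⟩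

theorem wp_unitDemandTest (hA : Admissible I K N Z) {s : Store} (hm : s.idx 1 0 = m)
    (i : Fin n) (hi : s.idx 7 0 = i) (ha : ∀ j : Fin m, s.num 5 j = I.val i {j}) :
    wp I.oracle K N unitDemandTest (fun s' => 1 ≤ s'.idx 10 0 ↔ UnitDemandTest (I.val i)) s := by
  have h2 := hA.two_le
  refine ⟨by simp only [IExpr.eval]; omega, ?_⟩
  refine wp_forLoop (fun k s' => 1 ≤ s'.idx 10 0 ↔ ∀ j : Fin m, (j : ℕ) < k →
      I.val i (Finset.univ.filter fun k => I.val i {k} ≤ I.val i {j}) ≤ I.val i {j}) m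
      (by simpa using hm) hA.m_le
      (by simp [Prog.modI]) (by simp [Prog.modI]) (by norm_num) (by simp [IExpr.eval]) ?_ ?_
  · rintro k hk s1 hf hc hJ
    have hm1 : s1.idx 1 0 = m := by rw [hf.idx 1 (by decide)]; simpa using hm
    have hi1 : s1.idx 7 0 = i := by rw [hf.idx 7 (by decide)]; simpa using hi
    have ha1 : ∀ j : Fin m, s1.num 5 j = I.val i {j} := by
      intro j
      rw [hf.num 5 (by decide)]
      exact ha j
    refine wp_seq _ (wp_ask hA hm1 i hi1
      (Finset.univ.filter fun k' => I.val i {k'} ≤ I.val i {⟨k, hk⟩}) ?_) ?_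
    · intro s2 hf2 k' hk'
      have e6 : s2.idx 6 0 = (⟨k, hk⟩ : Fin m) := by rw [hf2.idx 6 (by simp), hc]
      have n5 := hf2.num 5 (by simp)
      rw [Finset.mem_filter, ← ha1, ← ha1]
      simp only [BExpr.eval, NExpr.eval, ig_eval, hk', e6, n5, Finset.mem_univ, true_and]
    · intro s2 hf2 hy
      have e6 : s2.idx 6 0 = (⟨k, hk⟩ : Fin m) := by rw [hf2.idx 6 (by simp), hc]
      have n5 := hf2.num 5 (by simp)
      have e10 := congrFun (hf2.idx 10 (by simp)) 0
      have hiff : (∀ j : Fin m, (j : ℕ) < k + 1 →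
          I.val i (Finset.univ.filter fun k => I.val i {k} ≤ I.val i {j}) ≤ I.val i {j}) ↔
          (1 ≤ s2.idx 10 0 ∧ s2.num 6 0 ≤ s2.num 5 (s2.idx 6 0)) := by
        rw [e10, hJ, hy, e6, n5, ha1]
        constructor
        · exact fun h => ⟨fun j hj => h j (by omega), h ⟨k, hk⟩ (by simp)⟩
        · rintro ⟨h3, h4⟩ j hj
          rcases Nat.lt_succ_iff_lt_or_eq.1 hj with h | h
          · exact h3 j h
          · have : j = ⟨k, hk⟩ := Fin.ext h
            rw [this]
            exact h4
      simp only [wp, NExpr.eval, IExpr.eval, BExpr.eval, ig_eval, ng_eval, hiff]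
      simp only [Store.putIdx_idx]
      norm_num
      exact ⟨fun h _ => h, fun h _ => h⟩
  · intro s1 _ hJ
    rw [hJ]
    exact ⟨fun h j => h j j.isLt, fun h j _ => h j⟩

theorem wp_classify (hA : Admissible I K N Z) (hZ : ∀ i, Z i (initialTarget I i)) {s : Store}
    (hn : s.idx 0 0 = n) (hm : s.idx 1 0 = m) (he : ∀ i : Fin n, s.num 0 i = I.ent i) :
    wp I.oracle K N classify (fun s' => ∀ i : Fin n, s'.idx 3 i = classOf (I.val i) ∧
      s'.num 1 i = initialTarget I i) s := by
  classical
  have h2 := hA.two_le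
  refine wp_forLoop (fun k s' => ∀ i : Fin n, (i : ℕ) < k → s'.idx 3 i = classOf (I.val i) ∧
      s'.num 1 i = initialTarget I i) n hn hA.n_le (by decide) (by decide) (by norm_num)
      (by simp) ?_ (fun s1 _ h i => h i i.isLt)
  intro k hk s1 hf hc hJ
  have hm1 : s1.idx 1 0 = m := by rw [hf.idx 1 (by decide)]; exact hm
  have he1 : s1.num 0 (⟨k, hk⟩ : Fin n) = I.ent ⟨k, hk⟩ := by
    rw [hf.num 0 (by decide)]
    exact he ⟨k, hk⟩
  refine wp_seq _ (wp_singles hA hm1 ⟨k, hk⟩ hc) ?_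
  rintro s2 hf2 ⟨ha, hsum, hP⟩
  have hm2 : s2.idx 1 0 = m := by rw [hf2.idx 1 (by decide)]; exact hm1
  have hc2 : s2.idx 7 0 = k := by rw [hf2.idx 7 (by decide)]; exact hc
  refine wp_seq _ (wp_unitDemandTest hA hm2 ⟨k, hk⟩ hc2 ha) ?_
  intro s3 hf3 hud
  have hm3 : s3.idx 1 0 = m := by rw [hf3.idx 1 (by decide)]; exact hm2
  have hc3 : s3.idx 7 0 = k := by rw [hf3.idx 7 (by decide)]; exact hc2
  refine wp_seq _ (wp_ask hA hm3 ⟨k, hk⟩ hc3 Finset.univ (by simp [BExpr.eval])) ?_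
  intro s4 hf4 hy
  have hc4 : s4.idx 7 0 = k := by rw [hf4.idx 7 (by simp)]; exact hc3
  have e10 : s4.idx 10 0 = s3.idx 10 0 := by rw [hf4.idx 10 (by simp)]
  have e9 : s4.idx 9 0 = (posItems (I.val ⟨k, hk⟩)).card := by
    rw [hf4.idx 9 (by simp), hf3.idx 9 (by decide), hP]
  have n7 : s4.num 7 0 = ∑ j, I.val ⟨k, hk⟩ {j} := by
    rw [hf4.num 7 (by simp), hf3.num 7 (by decide), hsum]
  have n0 : s4.num 0 k = I.ent ⟨k, hk⟩ := by
    rw [hf4.num 0 (by simp), hf3.num 0 (by decide), hf2.num 0 (by decide)]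
    exact he1
  have e3 : s4.idx 3 = s1.idx 3 := by
    rw [hf4.idx 3 (by simp), hf3.idx 3 (by decide), hf2.idx 3 (by decide)]
  have n1 : s4.num 1 = s1.num 1 := by
    rw [hf4.num 1 (by simp), hf3.num 1 (by decide), hf2.num 1 (by decide)]
  have hK := hA.target _ _ (hZ ⟨k, hk⟩)
  have hc' : classOf (I.val ⟨k, hk⟩) ≤ N := by
    rw [classOf]
    split_ifs <;> omega
  have key : ∀ c t, c = classOf (I.val ⟨k, hk⟩) → t = initialTarget I ⟨k, hk⟩ →
      ∀ i : Fin n, (i : ℕ) < k + 1 →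
        (((s4.putIdx 3 k c).putNum 1 k t).putIdx 7 0 (k + 1)).idx 3 i = classOf (I.val i) ∧
        (((s4.putIdx 3 k c).putNum 1 k t).putIdx 7 0 (k + 1)).num 1 i = initialTarget I i := by
    rintro c t rfl rfl i hi
    by_cases hik : (i : ℕ) = k
    · have : i = ⟨k, hk⟩ := Fin.ext hik
      subst this
      simp
    · simpa [hik, e3, n1] using hJ i (by omega)
  have hset : ∀ c, c = classOf (I.val ⟨k, hk⟩) → c ≤ N ∧
      wp I.oracle K N (.ite (.nle (nc 1) (.mul (ag 0) (.ofIdx (ig 9)))) (.setNum 1 (ig 7) (ng 6))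
        (.setNum 1 (ig 7) (nc 0))) (fun s2 => ∀ i : Fin n, (i : ℕ) < k + 1 →
        (s2.putIdx 7 0 (k + 1)).idx 3 i = classOf (I.val i) ∧
        (s2.putIdx 7 0 (k + 1)).num 1 i = initialTarget I i) (s4.putIdx 3 k c) := by
    intro c hcl
    refine ⟨hcl ▸ hc', ?_⟩
    simp only [wp, NExpr.eval, BExpr.eval, ig_eval, ng_eval, nc_eval, ag_eval]
    simp only [Store.putIdx_idx, Store.putIdx_num]
    norm_num
    rw [hc4, n0, e9, hy]
    constructor
    · intro h
      have ht : I.val ⟨k, hk⟩ Finset.univ = initialTarget I ⟨k, hk⟩ := by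
        rw [initialTarget, if_pos h]
      exact ⟨hA.val _ _, by simpa using key c _ hcl ht⟩
    · intro h
      have ht : 0 = initialTarget I ⟨k, hk⟩ := by
        rw [initialTarget, if_neg (not_le.2 h)]
      exact ⟨hA.zero, by simpa using key c _ hcl ht⟩
  refine wp_intro_seq ?_
  simp only [wp, NExpr.eval, IExpr.eval, BExpr.eval, ig_eval, ng_eval, hc4]
  simp only [wp, NExpr.eval, BExpr.eval] at hset
  rw [e10, hud, n7, hy]
  exact ⟨fun h => hset 2 (by rw [classOf, if_pos h]), fun h =>
    ⟨fun h' => hset 1 (by rw [classOf, if_neg h, if_pos h']),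
      fun h' => hset 0 (by rw [classOf, if_neg h, if_neg h'])⟩⟩

end

end FairAlloc

end

/-! ### Verification of one round: best item, bid, winner, sale. -/

noncomputable section

namespace FairAlloc

section

variable {n m : ℕ} {I : Instance n m} {K : ℝ → Prop} {N : ℕ} {Z : Fin n → ℝ → Prop}
  {z : Fin n → ℝ} {own : Fin m → ℕ} {x₀ β : Fin n → ℝ} {p : Fin m → ℝ}

/-- The parts of the store that do not change during a game. -/
structure BaseState (I : Instance n m) (z : Fin n → ℝ) (s : Store) : Prop where
  agents : s.idx 0 0 = n
  items : s.idx 1 0 = m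
  ent : ∀ i : Fin n, s.num 0 i = I.ent i
  cls : ∀ i : Fin n, s.idx 3 i = classOf (I.val i)
  target : ∀ i : Fin n, s.num 1 i = z i

/-- The store during a game. -/
structure GameState (I : Instance n m) (z : Fin n → ℝ) (own : Fin m → ℕ) (x₀ β : Fin n → ℝ)
    (s : Store) : Prop extends BaseState I z s where
  owner : ∀ j : Fin m, s.idx 2 j = own j
  value : ∀ i : Fin n, s.num 2 i = I.val i (owned own i)
  base : ∀ i : Fin n, s.num 3 i = x₀ i
  budget : ∀ i : Fin n, s.num 4 i = β i

theorem BaseState.frame {c : Prog} {s s' : Store} (h : BaseState I z s) (hf : Frame c s s')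
    (hI : 0 ∉ c.modI ∧ 1 ∉ c.modI ∧ 3 ∉ c.modI) (hN : 0 ∉ c.modN ∧ 1 ∉ c.modN) :
    BaseState I z s' := by
  obtain ⟨h0, h1, h3⟩ := hI
  refine ⟨?_, ?_, ?_, ?_, ?_⟩
  · rw [hf.idx _ h0]; exact h.agents
  · rw [hf.idx _ h1]; exact h.items
  · rw [hf.num _ hN.1]; exact h.ent
  · rw [hf.idx _ h3]; exact h.cls
  · rw [hf.num _ hN.2]; exact h.target

theorem GameState.frame {c : Prog} {s s' : Store} (h : GameState I z own x₀ β s)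
    (hf : Frame c s s') (hI : ∀ a ≤ 3, a ∉ c.modI) (hN : ∀ a ≤ 4, a ∉ c.modN) :
    GameState I z own x₀ β s' := by
  refine ⟨h.toBaseState.frame hf ⟨hI _ (by norm_num), hI _ (by norm_num), hI _ (by norm_num)⟩
    ⟨hN _ (by norm_num), hN _ (by norm_num)⟩, ?_, ?_, ?_, ?_⟩
  · rw [hf.idx _ (hI _ (by norm_num))]; exact h.owner
  · rw [hf.num _ (hN _ (by norm_num))]; exact h.value
  · rw [hf.num _ (hN _ (by norm_num))]; exact h.base
  · rw [hf.num _ (hN _ (by norm_num))]; exact h.budget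

/-- The record -1 lies below every gain, so once a free item has been seen it is replaced by a true
gain. -/
theorem wp_bestItem (hA : Admissible I K N Z) {s : Store} (h : GameState I z own x₀ β s)
    (i : Fin n) (hi : s.idx 7 0 = i) (hfree : ∃ j, own j = n) :
    wp I.oracle K N bestItem (fun s' => ∃ j : Fin m, own j = n ∧ s'.idx 11 0 = j ∧
      s'.num 9 0 = gain I own i j ∧ ∀ r, own r = n → gain I own i r ≤ gain I own i j) s := by
  have hmN := hA.m_le
  refine ⟨by simpa [NExpr.eval] using hA.neg, ?_⟩
  refine wp_forLoop (fun k s' => (∀ r : Fin m, (r : ℕ) < k → own r = n →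
      gain I own i r ≤ s'.num 9 0) ∧ (s'.num 9 0 = -1 ∨ ∃ j : Fin m, own j = n ∧ s'.idx 11 0 = j ∧
      s'.num 9 0 = gain I own i j)) m h.items hmN
      (by simp [Prog.modI]) (by simp [Prog.modI]) (by norm_num)
      (by simp [NExpr.eval, IExpr.eval]) ?_ ?_
  · rintro k hk s1 hf hc ⟨hJ1, hJ2⟩
    have hS : GameState I z own x₀ β s1 := by
      refine GameState.frame (s := s) (c := bestItem) h ?_ (by decide) (by decide)
      exact Frame.trans (s' := s.putNum 9 0 (0 - 1)) ⟨fun a _ => by rfl, fun a ha =>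
        Store.putNum_num_of_ne _ (fun h' => ha (by rw [h']; decide)) _ _⟩
        ((by simpa [NExpr.eval, IExpr.eval] using hf : Frame _ (s.putNum 9 0 (0 - 1)) s1).weaken
          (by decide) (by decide))
    have hi1 : s1.idx 7 0 = i := by rw [hf.idx 7 (by decide)]; simpa using hi
    have ho : s1.idx 2 k = own ⟨k, hk⟩ := hS.owner ⟨k, hk⟩
    refine ⟨fun hb => ?_, fun hb => ?_⟩
    · have hb' : own ⟨k, hk⟩ = n := by
        simpa [IExpr.eval, hc, ho, hS.agents] using hb
      refine wp_seq _ (wp_ask hA hS.items i hi1 (insert ⟨k, hk⟩ (owned own i)) ?_) ?_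
      · intro s2 hf2 k' hk'
        have e6 : s2.idx 6 0 = k := by rw [hf2.idx 6 (by simp), hc]
        have e7 : s2.idx 7 0 = i := by rw [hf2.idx 7 (by simp), hi1]
        have e2 := hf2.idx 2 (by simp)
        simp [IExpr.eval, hk', e6, e7, e2, hS.owner, mem_owned, Fin.ext_iff, or_comm]
      · intro s2 hf2 hy
        have e6 : s2.idx 6 0 = k := by rw [hf2.idx 6 (by simp), hc]
        have e7 : s2.idx 7 0 = i := by rw [hf2.idx 7 (by simp), hi1]
        have e11 := hf2.idx 11 (by simp)
        have n9 := hf2.num 9 (by simp)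
        have hg : s2.num 6 0 - s2.num 2 (s2.idx 7 0) = gain I own i ⟨k, hk⟩ := by
          rw [hy, e7, hf2.num 2 (by simp), hS.value, gain]
        simp only [wp, NExpr.eval, IExpr.eval, BExpr.eval, ig_eval, ng_eval, ag_eval, hg, n9]
        simp only [Store.putIdx_idx, Store.putIdx_num, Store.putNum_num, Store.putNum_idx, e6]
        norm_num [-Order.lt_add_one_iff, n9, e11]
        refine ⟨fun hle => ⟨fun r hr hrf => ?_, hJ2⟩, fun hlt => ⟨hA.diff _ _ _, by omega,
          fun r hr hrf => ?_, .inr ⟨⟨k, hk⟩, hb', rfl, rfl⟩⟩⟩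
        · rcases Nat.lt_succ_iff_lt_or_eq.1 hr with h' | h'
          · exact hJ1 r h' hrf
          · obtain rfl : r = ⟨k, hk⟩ := Fin.ext h'
            exact hle
        · rcases Nat.lt_succ_iff_lt_or_eq.1 hr with h' | h'
          · exact (hJ1 r h' hrf).trans hlt.le
          · obtain rfl : r = ⟨k, hk⟩ := Fin.ext h'
            exact le_rfl
    · have hb' : own ⟨k, hk⟩ ≠ n := by
        simpa [IExpr.eval, hc, ho, hS.agents] using hb
      simp only [wp, Store.putIdx_num, Store.putIdx_idx]
      norm_num [-Order.lt_add_one_iff]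
      refine ⟨fun r hr hrf => ?_, hJ2⟩
      rcases Nat.lt_succ_iff_lt_or_eq.1 hr with h' | h'
      · exact hJ1 r h' hrf
      · obtain rfl : r = ⟨k, hk⟩ := Fin.ext h'
        exact absurd hrf hb'
  · rintro s1 _ ⟨hJ1, hJ2⟩
    obtain ⟨r, hr⟩ := hfree
    rcases hJ2 with hJ2 | ⟨j, hj, hj1, hj2⟩
    · have := hJ1 r r.isLt hr
      have := gain_nonneg (I := I) own i r
      linarith
    · exact ⟨j, hj, hj1, hj2, fun r hr => hj2 ▸ hJ1 r r.isLt hr⟩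

theorem wp_computeBid (hA : Admissible I K N Z) {s : Store} (h : GameState I z own x₀ β s)
    (i : Fin n) (hi : s.idx 7 0 = i) (hZ : Z i (z i)) (hx : ∃ T, x₀ i = I.val i T)
    (hβ : IsBudget I i (z i) (β i)) {j : Fin m} (hd : s.num 9 0 = gain I own i j) :
    wp I.oracle K N computeBid
      (fun s' => s'.num 10 0 = gameBid I z own x₀ β i (gain I own i j)) s := by
  obtain ⟨T, hT⟩ := hx
  have hK := hA.bid i (z i) (β i) hZ hβ (classOf (I.val i)) (owned own i) T
    (insert j (owned own i)) (owned own i)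
  rw [← hT] at hK
  change K (gameBid I z own x₀ β i (gain I own i j)) at hK
  have key : ∀ y, y = gameBid I z own x₀ β i (gain I own i j) → K y ∧
      (s.putNum 10 0 y).num 10 0 = gameBid I z own x₀ β i (gain I own i j) := by
    rintro y rfl
    exact ⟨hK, by simp⟩
  have hc2 : classOf (I.val i) ≤ 2 := by rw [classOf]; split_ifs <;> norm_num
  simp only [computeBid, wp, NExpr.eval, IExpr.eval, BExpr.eval, ig_eval, ng_eval, ag_eval, nc_eval,
    hi, h.cls, h.ent, h.target, h.value, h.base, h.budget, hd, Nat.cast_ofNat, Nat.cast_zero]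
  simp only [gameBid, bid, bidUnitDemand, bidAdditive, lateBid, earlyBid, bidSubmodular] at key
  refine ⟨fun h1 => ?_, fun h1 => ⟨fun h2 => ?_, fun h2 => ?_⟩⟩
  · have hc : classOf (I.val i) = 2 := by omega
    simp only [gameBid, bid, hc, bidUnitDemand, if_true] at key ⊢
    refine ⟨fun h3 => ⟨fun h4 => ?_, fun h4 => ?_⟩, fun h3 => ?_⟩ <;> refine key _ ?_ <;>
      simp only [h3, if_true, if_false]
    · rw [if_pos h4]
    · rw [if_neg h4]
  · have hc : classOf (I.val i) = 1 := by omega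
    simp only [gameBid, bid, hc, bidAdditive, lateBid, earlyBid, if_true] at key ⊢
    norm_num only [if_false] at key ⊢
    refine ⟨fun h3 => ?_, fun h3 => ⟨fun h4 => ⟨fun h5 => ?_, fun h5 => ?_⟩,
      fun h4 => ⟨fun h5 => ?_, fun h5 => ⟨fun h6 => ?_, fun h6 => ?_⟩⟩⟩⟩ <;> refine key _ ?_
    · rw [if_pos h3]
    · rw [if_neg h3, if_pos h4, if_pos h5]
    · rw [if_neg h3, if_pos h4, if_neg h5]
    · rw [if_neg h3, if_neg h4, if_pos h5]
    · rw [if_neg h3, if_neg h4, if_neg h5, if_pos h6]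
    · rw [if_neg h3, if_neg h4, if_neg h5, if_neg h6]
  · have hc : classOf (I.val i) = 0 := by omega
    simp only [gameBid, bid, hc, bidSubmodular] at key ⊢
    norm_num only [if_false] at key ⊢
    refine ⟨fun h3 => ?_, fun h3 => ⟨fun h4 => ?_, fun h4 => ?_⟩⟩ <;> refine key _ ?_
    · rw [if_pos h3]
    · rw [if_neg h3, if_pos h4]
    · rw [if_neg h3, if_neg h4]

/-- The memories of the additive agents are admissible. -/
def GoodMemory (I : Instance n m) (z x₀ β : Fin n → ℝ) : Prop :=
  ∀ i, (∃ T, x₀ i = I.val i T) ∧ IsBudget I i (z i) (β i)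

/-- The condition `0 ≤ d` in the loop invariant makes each bid non-negative, so the initial record
-1 cannot survive the first agent. -/
theorem wp_bidding (hA : Admissible I K N Z) {s : Store} (h : GameState I z own x₀ β s)
    (hZ : ∀ i, Z i (z i)) (hmem : GoodMemory I z x₀ β) (hg : GameInv I z own x₀ β p)
    (hfree : ∃ j, own j = n) (hbb : s.num 11 0 = -1) :
    wp I.oracle K N bidding (fun s' => ∃ (i : Fin n) (j : Fin m), own j = n ∧ s'.idx 12 0 = i ∧
      s'.idx 13 0 = j ∧ s'.num 12 0 = gain I own i j ∧
      (∀ r, own r = n → gain I own i r ≤ gain I own i j) ∧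
      ∀ i', ∃ d, (∀ r, own r = n → gain I own i' r ≤ d) ∧
        gameBid I z own x₀ β i' d ≤ gameBid I z own x₀ β i (gain I own i j)) s := by
  have hnN := hA.n_le
  have hmN := hA.m_le
  refine wp_forLoop (fun k s' => (∀ i' : Fin n, (i' : ℕ) < k → ∃ d, 0 ≤ d ∧
      (∀ r, own r = n → gain I own i' r ≤ d) ∧ gameBid I z own x₀ β i' d ≤ s'.num 11 0) ∧
      (s'.num 11 0 = -1 ∨ ∃ (i : Fin n) (j : Fin m), own j = n ∧ s'.idx 12 0 = i ∧
      s'.idx 13 0 = j ∧ s'.num 12 0 = gain I own i j ∧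
      (∀ r, own r = n → gain I own i r ≤ gain I own i j) ∧
      s'.num 11 0 = gameBid I z own x₀ β i (gain I own i j))) n h.agents hnN
      (by decide) (by decide) (by norm_num) (by simp [hbb]) ?_ ?_
  · rintro k hk s1 hf hc ⟨hJ1, hJ2⟩
    have hS : GameState I z own x₀ β s1 := h.frame hf (by decide) (by decide)
    refine wp_seq _ (wp_bestItem hA hS ⟨k, hk⟩ hc hfree) ?_
    rintro s2 hf2 ⟨j, hj, h11, h9, hmax⟩
    have hS2 := hS.frame hf2 (by decide) (by decide)
    have hc2 : s2.idx 7 0 = k := by rw [hf2.idx 7 (by decide), hc]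
    refine wp_seq _ (wp_computeBid hA hS2 ⟨k, hk⟩ hc2 (hZ _) (hmem _).1 (hmem _).2 h9) ?_
    intro s3 hf3 hbid
    have hc3 : s3.idx 7 0 = k := by rw [hf3.idx 7 (by decide), hc2]
    have h11' : s3.idx 11 0 = j := by rw [hf3.idx 11 (by decide), h11]
    have h9' : s3.num 9 0 = gain I own ⟨k, hk⟩ j := by rw [hf3.num 9 (by decide), h9]
    have e12 : s3.idx 12 = s1.idx 12 := by rw [hf3.idx 12 (by decide), hf2.idx 12 (by decide)]
    have e13 : s3.idx 13 = s1.idx 13 := by rw [hf3.idx 13 (by decide), hf2.idx 13 (by decide)]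
    have n11 : s3.num 11 = s1.num 11 := by rw [hf3.num 11 (by decide), hf2.num 11 (by decide)]
    have n12 : s3.num 12 = s1.num 12 := by rw [hf3.num 12 (by decide), hf2.num 12 (by decide)]
    obtain ⟨T, hT⟩ := (hmem ⟨k, hk⟩).1
    have hK : K (gameBid I z own x₀ β ⟨k, hk⟩ (gain I own ⟨k, hk⟩ j)) := by
      rw [gameBid, hT]
      exact hA.bid _ _ _ (hZ _) (hmem _).2 _ _ _ _ _
    simp only [wp, IExpr.eval, BExpr.eval, ig_eval, ng_eval, hbid, n11]
    simp only [Store.putIdx_idx, Store.putIdx_num, Store.putNum_num, Store.putNum_idx]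
    norm_num [-Order.lt_add_one_iff, n11, n12, e12, e13, hc3, h11', h9']
    have hjm := j.isLt
    refine ⟨fun hle => ⟨fun i' hi' => ?_, hJ2⟩, fun hlt => ⟨hK, by omega, by omega,
      hA.diff _ _ _, fun i' hi' => ?_, .inr ⟨⟨k, hk⟩, j, hj, rfl, rfl, rfl, hmax, rfl⟩⟩⟩
    · rcases Nat.lt_succ_iff_lt_or_eq.1 hi' with h' | h'
      · exact hJ1 i' h'
      · obtain rfl : i' = ⟨k, hk⟩ := Fin.ext h'
        exact ⟨_, gain_nonneg _ _ _, hmax, hle⟩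
    · rcases Nat.lt_succ_iff_lt_or_eq.1 hi' with h' | h'
      · obtain ⟨d, hd0, hd, hdb⟩ := hJ1 i' h'
        exact ⟨d, hd0, hd, hdb.trans hlt.le⟩
      · obtain rfl : i' = ⟨k, hk⟩ := Fin.ext h'
        exact ⟨_, gain_nonneg _ _ _, hmax, le_rfl⟩
  · rintro s1 _ ⟨hJ1, hJ2⟩
    rcases hJ2 with hJ2 | ⟨i, j, hj, h12, h13, n12, hmax, hb⟩
    -- There is an agent, since the entitlements add up to one.
    · have hn : 0 < n := by
        rcases Nat.eq_zero_or_pos n with rfl | hn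
        · have := I.ent_sum
          simp at this
        · exact hn
      obtain ⟨d, hd0, -, hdb⟩ := hJ1 ⟨0, hn⟩ hn
      have := (hg.agent ⟨0, hn⟩).bid_nonneg (I.val_mono _) (I.val_empty _) (I.ent_pos _) hd0
      rw [gameBid, hJ2] at hdb
      linarith
    · refine ⟨i, j, hj, h12, h13, n12, hmax, fun i' => ?_⟩
      obtain ⟨d, -, hd, hdb⟩ := hJ1 i' i'.isLt
      exact ⟨d, hd, hb ▸ hdb⟩

/-- The memories are written before the value of the bundle, because the test for the early phase
refers to the old value. They are kept for all classes, but only additive bids depend on them. -/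
theorem wp_sell (hA : Admissible I K N Z) {s : Store} (h : GameState I z own x₀ β s)
    (hZ : ∀ i, Z i (z i)) {i : Fin n} {j : Fin m} (hj : own j = n)
    (h12 : s.idx 12 0 = i) (h13 : s.idx 13 0 = j) (n12 : s.num 12 0 = gain I own i j) :
    wp I.oracle K N sell (GameState I z (Function.update own j i)
      (Function.update x₀ i (if 5 * I.val i (owned own i) < 2 * z i then
        I.val i (insert j (owned own i)) else x₀ i))
      (Function.update β i (if 5 * I.val i (owned own i) < 2 * z i then
        budgetAfter (I.ent i) (z i) (I.val i (insert j (owned own i))) (gain I own i j)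
        else β i))) s := by
  have hnN := hA.n_le
  have hin := i.isLt
  have hsum : I.val i (owned own i) + gain I own i j = I.val i (insert j (owned own i)) := by
    rw [gain]; ring
  have hB : K (budgetAfter (I.ent i) (z i) (I.val i (insert j (owned own i))) (gain I own i j)) := by
    refine hA.budget i _ _ (hZ i) (.inr ⟨_, _, _, rfl⟩)
  have hval := hA.val i (insert j (owned own i))
  have hfin : ∀ x y, x = (if 5 * I.val i (owned own i) < 2 * z i then
        I.val i (insert j (owned own i)) else x₀ i) →
      y = (if 5 * I.val i (owned own i) < 2 * z i then
        budgetAfter (I.ent i) (z i) (I.val i (insert j (owned own i))) (gain I own i j)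
        else β i) → ∀ s' : Store, s'.idx = (s.putIdx 2 j i).idx → s'.num 0 = s.num 0 →
        s'.num 1 = s.num 1 →
        (∀ i' : Fin n, s'.num 2 i' = if i' = i then I.val i (insert j (owned own i)) else
          s.num 2 i') →
        (∀ i' : Fin n, s'.num 3 i' = if i' = i then x else s.num 3 i') →
        (∀ i' : Fin n, s'.num 4 i' = if i' = i then y else s.num 4 i') →
      GameState I z (Function.update own j i)
      (Function.update x₀ i (if 5 * I.val i (owned own i) < 2 * z i then
        I.val i (insert j (owned own i)) else x₀ i))
      (Function.update β i (if 5 * I.val i (owned own i) < 2 * z i then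
        budgetAfter (I.ent i) (z i) (I.val i (insert j (owned own i))) (gain I own i j)
        else β i)) s' := by
    intro x y hx hy s' hidx hn0 hn1 hn2 hn3 hn4
    rw [← hx, ← hy]
    refine ⟨⟨?_, ?_, ?_, ?_, ?_⟩, ?_, ?_, ?_, ?_⟩
    · simpa [hidx] using h.agents
    · simpa [hidx] using h.items
    · simpa [hn0] using h.ent
    · simpa [hidx] using h.cls
    · simpa [hn1] using h.target
    · intro k
      rw [hidx, Store.putIdx_idx, Function.update_apply]
      simp only [true_and, Fin.ext_iff, h.owner]
    · intro i'
      rw [hn2]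
      by_cases hi : i' = i
      · subst hi
        rw [if_pos rfl, owned_update_self]
      · rw [if_neg hi, h.value, owned_update_of_ne (fun h => hi (Fin.ext h)),
          Finset.erase_eq_of_notMem fun hmem => ?_]
        rw [mem_owned, hj] at hmem
        exact i'.isLt.ne' hmem
    · intro i'
      rw [hn3, Function.update_apply, h.base]
    · intro i'
      rw [hn4, Function.update_apply, h.budget]
  simp only [sell, wp, NExpr.eval, BExpr.eval, ig_eval, ng_eval, nc_eval]
  simp only [Store.putIdx_idx, Store.putIdx_num, Store.putNum_num, Store.putNum_idx]
  norm_num [h12, h13, n12, h.target, h.value, h.ent, hsum]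
  refine ⟨by omega, fun hle => ⟨hval, ?_⟩, fun hlt => ⟨hval, fun hd => ⟨?_, hval, ?_⟩,
    fun hd => ⟨?_, hval, ?_⟩⟩⟩
  · refine hfin _ _ (if_neg (not_lt.2 hle)).symm (if_neg (not_lt.2 hle)).symm _ (by rfl) ?_ ?_ ?_ ?_ ?_
    · rfl
    · rfl
    · simp [Fin.ext_iff]
    · intro i'
      by_cases hi : i' = i <;> simp [hi, h.base]
    · intro i'
      by_cases hi : i' = i <;> simp [hi, h.budget]
  · rw [budgetAfter, if_pos hd] at hB
    exact hB
  · refine hfin _ _ (if_pos hlt).symm (if_pos hlt).symm _ (by rfl) ?_ ?_ ?_ ?_ ?_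
    · rfl
    · rfl
    · simp [Fin.ext_iff]
    · simp [Fin.ext_iff]
    · simp [Fin.ext_iff, budgetAfter, hd]
  · rw [budgetAfter, if_neg (not_le.2 hd)] at hB
    exact hB
  · refine hfin _ _ (if_pos hlt).symm (if_pos hlt).symm _ (by rfl) ?_ ?_ ?_ ?_ ?_
    · rfl
    · rfl
    · simp [Fin.ext_iff]
    · simp [Fin.ext_iff]
    · simp [Fin.ext_iff, budgetAfter, not_le.2 hd]

end

end FairAlloc

end

/-! ### Verification of the whole game and of the outer loop. -/

noncomputable section

namespace FairAlloc

section

variable {n m : ℕ} {I : Instance n m} {K : ℝ → Prop} {N : ℕ} {Z : Fin n → ℝ → Prop}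
  {z : Fin n → ℝ} {own : Fin m → ℕ} {x₀ β : Fin n → ℝ} {p : Fin m → ℝ}

/-- The store after `t` rounds of the game. -/
def Running (I : Instance n m) (z : Fin n → ℝ) (t : ℕ) (s : Store) : Prop :=
  ∃ own x₀ β p, GameState I z own x₀ β s ∧ GameInv I z own x₀ β p ∧ GoodMemory I z x₀ β ∧
    (∀ j, own j ≤ n) ∧ (owned own n).card + t = m

theorem Running.frame {c : Prog} {s s' : Store} {t : ℕ} (h : Running I z t s) (hf : Frame c s s')
    (hI : ∀ a ≤ 3, a ∉ c.modI) (hN : ∀ a ≤ 4, a ∉ c.modN) : Running I z t s' := by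
  obtain ⟨own, x₀, β, p, hS, h⟩ := h
  exact ⟨own, x₀, β, p, hS.frame hf hI hN, h⟩

/-- The prices exist only in the proof: the machine keeps owners, values and the memories. -/
theorem wp_round (hA : Admissible I K N Z) (hsub : ∀ i, IsSubmodular (I.val i))
    (hZ : ∀ i, Z i (z i)) {s : Store} {t : ℕ} (ht : t < m) (h : Running I z t s) :
    wp I.oracle K N round (Running I z (t + 1)) s := by
  obtain ⟨own, x₀, β, p, hS, hg, hmem, hown, hcard⟩ := h
  have hfree : ∃ j, own j = n := by
    obtain ⟨j, hj⟩ := Finset.card_pos.1 (show 0 < (owned own n).card by omega)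
    exact ⟨j, mem_owned.1 hj⟩
  refine wp_seq (c := .setNum 11 (.const 0) (.sub (nc 0) (nc 1))) (fun s' => s'.num 11 0 = -1)
    ⟨by simpa [NExpr.eval] using hA.neg, by simp [NExpr.eval, IExpr.eval]⟩ ?_
  intro s1 hf1 hbb
  have hS1 := hS.frame hf1 (by simp [Prog.modI])
    (fun a ha => by simp only [Prog.modN, List.mem_singleton]; omega)
  refine wp_seq _ (wp_bidding hA hS1 hZ hmem hg hfree hbb) ?_
  rintro s2 hf2 ⟨i, j, hj, h12, h13, n12, hmax, hwin⟩
  have hS2 := hS1.frame hf2 (by decide) (by decide)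
  refine wp_mono (fun s3 hS3 => ?_) (wp_sell hA hS2 hZ hj h12 h13 n12)
  refine ⟨_, _, _, _, hS3, hg.step hsub hj hmax hwin, fun i' => ?_, fun k => ?_, ?_⟩
  · by_cases hi : i' = i
    · subst hi
      rw [Function.update_self, Function.update_self]
      split_ifs
      · exact ⟨⟨_, rfl⟩, .inr ⟨_, _, _, rfl⟩⟩
      · exact hmem i'
    · rw [Function.update_of_ne hi, Function.update_of_ne hi]
      exact hmem i'
  · rw [Function.update_apply]
    split_ifs
    · exact i.isLt.le
    · exact hown k
  · rw [owned_update_of_ne i.isLt.ne', Finset.card_erase_of_mem (mem_owned.2 hj)]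
    have : 0 < (owned own n).card := Finset.card_pos.2 ⟨j, mem_owned.2 hj⟩
    omega

theorem wp_reset (hA : Admissible I K N Z) {s : Store} (h : BaseState I z s) :
    wp I.oracle K N reset (Running I z 0) s := by
  have hnN := hA.n_le
  refine wp_seq (fun s' => ∀ i : Fin n, s'.num 2 i = 0 ∧ s'.num 3 i = 0 ∧ s'.num 4 i = 0) ?_ ?_
  · refine wp_forLoop (fun k s' => ∀ i : Fin n, (i : ℕ) < k →
      s'.num 2 i = 0 ∧ s'.num 3 i = 0 ∧ s'.num 4 i = 0) n h.agents hnN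
      (by decide) (by decide) (by norm_num) (by simp) ?_ (fun s1 _ hJ i => hJ i i.isLt)
    intro k hk s1 hf hc hJ
    simp only [wp, nc_eval, ig_eval, Nat.cast_zero, Store.putNum_idx, hc]
    refine ⟨hA.zero, hA.zero, hA.zero, fun i hi => ?_⟩
    by_cases hik : (i : ℕ) = k
    · simp [hik]
    · simpa [hik] using hJ i (by omega)
  · intro s1 hf1 hnum
    have hB := h.frame hf1 (by decide) (by decide)
    refine wp_mono (fun s2 h2 => ?_) (wp_frame (wp_forLoop (s := s1)
      (Q := fun s' => ∀ j : Fin m, s'.idx 2 j = n) (fun k s' => ∀ j : Fin m, (j : ℕ) < k →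
      s'.idx 2 j = n) m hB.items hA.m_le
      (by decide) (by decide) (by norm_num) (by simp) ?_ (fun s1 _ hJ i => hJ i i.isLt)))
    · obtain ⟨hf2, hown⟩ := h2
      have hB2 := hB.frame hf2 (by decide) (by decide)
      refine ⟨fun _ => n, 0, 0, 0, ⟨hB2, hown, fun i => ?_, fun i => ?_, fun i => ?_⟩,
        .init I z, fun i => ⟨⟨∅, (I.val_empty i).symm⟩, .inl rfl⟩, fun _ => le_rfl, ?_⟩
      · have : owned (fun _ : Fin m => n) i = ∅ := by simp [owned, i.isLt.ne']
        rw [this, I.val_empty, hf2.num 2 (by decide), (hnum i).1]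
      · rw [hf2.num 3 (by decide), (hnum i).2.1, Pi.zero_apply]
      · rw [hf2.num 4 (by decide), (hnum i).2.2, Pi.zero_apply]
      · simp [owned]
    · intro k hk s2 hf2 hc hJ
      have hn2 : s2.idx 0 0 = n := by rw [hf2.idx 0 (by decide)]; exact hB.agents
      simp only [wp, ig_eval, hc, hn2]
      refine ⟨hnN, fun j hj => ?_⟩
      by_cases hjk : (j : ℕ) = k
      · simp [hjk]
      · simpa [hjk] using hJ j (by omega)

theorem wp_play (hA : Admissible I K N Z) (hsub : ∀ i, IsSubmodular (I.val i))
    (hZ : ∀ i, Z i (z i)) {s : Store} (h : BaseState I z s) :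
    wp I.oracle K N play (Running I z m) s := by
  refine wp_seq _ (wp_reset hA h) ?_
  intro s1 hf1 hR
  have hm : s1.idx 1 0 = m := by
    obtain ⟨_, _, _, _, hS, _⟩ := hR
    exact hS.items
  refine wp_forLoop (Running I z) m hm hA.m_le (by decide) (by decide) (by norm_num) ?_ ?_
    (fun _ _ h => h)
  · refine hR.frame (c := .setIdx 8 (.const 0) (.const 0))
      ⟨fun a ha => Store.putIdx_idx_of_ne _ (by simpa [Prog.modI] using ha) _ _, fun a _ => by rfl⟩
      (fun a ha => by simp only [Prog.modI, List.mem_singleton]; omega) (by simp [Prog.modN])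
  · intro k hk s2 _ _ hR2
    refine wp_mono (fun s3 hR3 => ?_) (wp_round hA hsub hZ hk hR2)
    exact hR3.frame (c := .setIdx 8 (.const 0) (.const 0))
      ⟨fun a ha => Store.putIdx_idx_of_ne _ (by simpa [Prog.modI] using ha) _ _, fun a _ => by rfl⟩
      (fun a ha => by simp only [Prog.modI, List.mem_singleton]; omega) (by simp [Prog.modN])

open Classical in
/-- The targets after an adjustment. -/
def adjusted (I : Instance n m) (z : Fin n → ℝ) (own : Fin m → ℕ) (i : Fin n) : ℝ :=
  if Satisfied (classOf (I.val i)) (z i) (I.val i (owned own i)) then z i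
  else z i * reduction m

theorem wp_adjust (hA : Admissible I K N Z) {s : Store} (h : GameState I z own x₀ β s)
    (hZ : ∀ i, ¬ Satisfied (classOf (I.val i)) (z i) (I.val i (owned own i)) →
      Z i (z i * reduction m)) :
    wp I.oracle K N adjust (fun s' => BaseState I (adjusted I z own) s' ∧
      (∀ j : Fin m, s'.idx 2 j = own j) ∧
      (1 ≤ s'.idx 14 0 ↔
        ∃ i, ¬ Satisfied (classOf (I.val i)) (z i) (I.val i (owned own i)))) s := by
  have h2 := hA.two_le
  refine wp_mono (c := adjust) (Q := fun s' => Frame adjust s s' ∧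
    (∀ i : Fin n, s'.num 1 i = adjusted I z own i) ∧ (1 ≤ s'.idx 14 0 ↔
      ∃ i, ¬ Satisfied (classOf (I.val i)) (z i) (I.val i (owned own i)))) ?_ (wp_frame ?_)
  · rintro s' ⟨hf, hz, hflag⟩
    refine ⟨⟨?_, ?_, ?_, ?_, hz⟩, ?_, hflag⟩
    · rw [hf.idx 0 (by decide)]; exact h.agents
    · rw [hf.idx 1 (by decide)]; exact h.items
    · rw [hf.num 0 (by decide)]; exact h.ent
    · rw [hf.idx 3 (by decide)]; exact h.cls
    · rw [hf.idx 2 (by decide)]; exact h.owner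
  refine ⟨Nat.zero_le _, ?_⟩
  refine wp_forLoop (fun k s' => (∀ i : Fin n, s'.num 1 i =
      if (i : ℕ) < k then adjusted I z own i else z i) ∧ (1 ≤ s'.idx 14 0 ↔
      ∃ i : Fin n, (i : ℕ) < k ∧ ¬ Satisfied (classOf (I.val i)) (z i) (I.val i (owned own i)))) n
      (by simpa using h.agents) hA.n_le (by decide) (by decide) (by norm_num)
      ⟨by simpa using h.target, by simp [IExpr.eval]⟩ ?_ ?_
  · rintro k hk s1 hf hc ⟨hJ1, hJ2⟩
    have hcls : s1.idx 3 k = classOf (I.val ⟨k, hk⟩) := by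
      rw [hf.idx 3 (by decide), Store.putIdx_idx_of_ne _ (by norm_num)]
      exact h.cls ⟨k, hk⟩
    have hval : s1.num 2 k = I.val ⟨k, hk⟩ (owned own k) := by
      rw [hf.num 2 (by decide)]
      exact h.value ⟨k, hk⟩
    have hm1 : s1.idx 1 0 = m := by
      rw [hf.idx 1 (by decide), Store.putIdx_idx_of_ne _ (by norm_num)]
      exact h.items
    have hzk : s1.num 1 k = z ⟨k, hk⟩ := by
      rw [hJ1 ⟨k, hk⟩, if_neg (lt_irrefl _)]
    have hc2 : classOf (I.val ⟨k, hk⟩) ≤ 2 := by rw [classOf]; split_ifs <;> norm_num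
    have hskip : Satisfied (classOf (I.val ⟨k, hk⟩)) (z ⟨k, hk⟩) (I.val ⟨k, hk⟩ (owned own k)) →
        (∀ i : Fin n, (s1.putIdx 7 0 (k + 1)).num 1 i =
          if (i : ℕ) < k + 1 then adjusted I z own i else z i) ∧
        (1 ≤ (s1.putIdx 7 0 (k + 1)).idx 14 0 ↔ ∃ i : Fin n, (i : ℕ) < k + 1 ∧
          ¬ Satisfied (classOf (I.val i)) (z i) (I.val i (owned own i))) := by
      intro hs
      refine ⟨fun i => ?_, ?_⟩
      · rw [Store.putIdx_num, hJ1]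
        by_cases hik : (i : ℕ) = k
        · obtain rfl : i = ⟨k, hk⟩ := Fin.ext hik
          rw [if_neg (lt_irrefl _), if_pos (Nat.lt_succ_self _), adjusted, if_pos hs]
        · have : (i : ℕ) < k ↔ (i : ℕ) < k + 1 := by omega
          simp only [this]
      · rw [Store.putIdx_idx_of_ne _ (by norm_num), hJ2]
        refine exists_congr fun i => and_congr_left fun hns => ?_
        have : (i : ℕ) ≠ k := by
          intro hik
          obtain rfl : i = ⟨k, hk⟩ := Fin.ext hik
          exact hns hs
        omega
    have hred : ¬ Satisfied (classOf (I.val ⟨k, hk⟩)) (z ⟨k, hk⟩)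
        (I.val ⟨k, hk⟩ (owned own k)) → K (z ⟨k, hk⟩ * reduction m) ∧ 1 ≤ N ∧
        (∀ i : Fin n, (((s1.putNum 1 k (z ⟨k, hk⟩ * reduction m)).putIdx 14 0 1).putIdx
          7 0 (k + 1)).num 1 i = if (i : ℕ) < k + 1 then adjusted I z own i else z i) ∧
        (1 ≤ (((s1.putNum 1 k (z ⟨k, hk⟩ * reduction m)).putIdx 14 0 1).putIdx
          7 0 (k + 1)).idx 14 0 ↔ ∃ i : Fin n, (i : ℕ) < k + 1 ∧
          ¬ Satisfied (classOf (I.val i)) (z i) (I.val i (owned own i))) := by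
      intro hs
      refine ⟨hA.target _ _ (hZ _ hs), by omega, fun i => ?_, ?_⟩
      · by_cases hik : (i : ℕ) = k
        · obtain rfl : i = ⟨k, hk⟩ := Fin.ext hik
          rw [if_pos (Nat.lt_succ_self _), adjusted, if_neg hs]
          simp
        · have : (i : ℕ) < k ↔ (i : ℕ) < k + 1 := by omega
          simp only [Store.putIdx_num, Store.putNum_num, hik, and_false, if_false, hJ1, this]
      · refine ⟨fun _ => ⟨⟨k, hk⟩, Nat.lt_succ_self _, hs⟩, fun _ => by simp⟩
    have hreq : (50 * (m : ℝ) - 1) / (50 * m) = reduction m := rfl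
    simp only [wp, NExpr.eval, IExpr.eval, BExpr.eval, ig_eval, ag_eval, nc_eval, hc, hcls, hval,
      hm1, hzk, Nat.cast_ofNat, Nat.cast_one, hreq]
    refine ⟨fun h1 => hskip (.inl (by omega)), fun h1 => ⟨fun h3 =>
      ⟨fun h4 => hskip (.inr (.inl ⟨by omega, h4⟩)), fun h4 => hred ?_⟩, fun h3 =>
      ⟨fun h4 => hskip (.inr (.inr ⟨by omega, h4⟩)), fun h4 => hred ?_⟩⟩⟩
    · rintro (h5 | ⟨h5, h6⟩ | ⟨h5, h6⟩)
      exacts [h1 (by omega), h4 h6, h5 (by omega)]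
    · rintro (h5 | ⟨h5, h6⟩ | ⟨h5, h6⟩)
      exacts [h1 (by omega), h3 (by omega), h4 h6]
  · rintro s1 _ ⟨hJ1, hJ2⟩
    refine ⟨fun i => by rw [hJ1, if_pos i.isLt], hJ2.trans ?_⟩
    exact exists_congr fun i => and_iff_right i.isLt

/-- The targets that can occur in the course of the algorithm. -/
def IsTarget (I : Instance n m) (k : ℕ) (i : Fin n) (z : ℝ) : Prop :=
  ∃ r ≤ 50 * m * k, z = initialTarget I i * reduction m ^ r

/-- What the allocation guarantees, in terms of the targets. -/
def Final (I : Instance n m) (own : Fin m → ℕ) : Prop :=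
  (∀ j, own j < n) ∧ ∃ z : Fin n → ℝ, ∀ i, I.aps i ≤ z i ∧
    Satisfied (classOf (I.val i)) (z i) (I.val i (owned own i)) ∧
    (classOf (I.val i) = 2 → I.aps i ≤ I.val i (owned own i))

theorem initialTarget_nonneg (I : Instance n m) (i : Fin n) : 0 ≤ initialTarget I i := by
  rw [initialTarget]
  split_ifs
  exacts [I.val_nonneg i _, le_rfl]

/-- Let `r i` count the reductions of agent `i`. While the flag is set, the number of games played
is at most `∑ i, r i`, and `reductions_le` caps each `r i` because targets stay above the shares. A
cleared flag means that the last game satisfied everybody. -/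
theorem wp_allocate (hsub : ∀ i, IsSubmodular (I.val i)) {k : ℕ}
    (hk : ∀ i S, 0 < I.val i S → I.val i Finset.univ ≤ 2 ^ k * I.val i S)
    (hA : Admissible I K N (IsTarget I k)) (hN : n * (50 * m * k) < N) :
    wp I.oracle K N allocate (fun s => ∃ own, Final I own ∧ ∀ j : Fin m, s.idx 2 j = own j)
      I.input := by
  have h2 := hA.two_le
  have hzero : ∀ i, IsTarget I k i (initialTarget I i) := fun i => ⟨0, Nat.zero_le _, by simp⟩
  refine wp_seq _ (wp_classify hA hzero (by simp [Instance.input]) (by simp [Instance.input])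
    (fun i => by simp [Instance.input])) ?_
  intro s1 hf1 hcl
  have hB : BaseState I (initialTarget I) s1 := by
    refine ⟨?_, ?_, ?_, fun i => (hcl i).1, fun i => (hcl i).2⟩
    · rw [hf1.idx 0 (by decide)]; simp [Instance.input]
    · rw [hf1.idx 1 (by decide)]; simp [Instance.input]
    · rw [hf1.num 0 (by decide)]; intro i; simp [Instance.input]
  refine ⟨by simp only [IExpr.eval]; omega, fun t s => ∃ (z : Fin n → ℝ) (r : Fin n → ℕ),
    BaseState I z s ∧ (∀ i, z i = initialTarget I i * reduction m ^ r i ∧ r i ≤ 50 * m * k ∧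
      I.aps i ≤ z i) ∧ (1 ≤ s.idx 14 0 → t ≤ ∑ i, r i) ∧
      (¬ 1 ≤ s.idx 14 0 → ∃ own, Final I own ∧ ∀ j : Fin m, s.idx 2 j = own j), ?_, ?_⟩
  · refine ⟨initialTarget I, 0, ?_, fun i => ⟨by simp, Nat.zero_le _, aps_le_initialTarget hsub i⟩,
      fun _ => Nat.zero_le _, fun h => absurd ?_ h⟩
    · exact hB.frame (c := .setIdx 14 (.const 0) (.const 1))
        ⟨fun a ha => Store.putIdx_idx_of_ne _ (by simpa [Prog.modI] using ha) _ _,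
          fun a _ => by rfl⟩ (by simp [Prog.modI]) (by simp [Prog.modN])
    · simp [IExpr.eval]
  · rintro t s ⟨z, r, hBs, hz, ht, hfin⟩
    simp only [BExpr.eval, IExpr.eval, ig_eval]
    refine ⟨fun hflag => ⟨?_, ?_⟩, hfin⟩
    · refine (ht hflag).trans_lt (lt_of_le_of_lt ?_ hN)
      calc ∑ i, r i ≤ ∑ _i : Fin n, 50 * m * k := Finset.sum_le_sum fun i _ => (hz i).2.1
        _ = n * (50 * m * k) := by simp
    · have hZ : ∀ i, IsTarget I k i (z i) := fun i => ⟨r i, (hz i).2.1, (hz i).1⟩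
      refine wp_seq _ (wp_play hA hsub hZ hBs) ?_
      rintro s2 hf2 ⟨own, x₀, β, p, hS, hg, hmem, hown, hcard⟩
      have hown' : ∀ j, own j < n := by
        intro j
        refine lt_of_le_of_ne (hown j) fun hj => ?_
        have : 0 < (owned own n).card := Finset.card_pos.2 ⟨j, mem_owned.2 hj⟩
        omega
      have hfail : ∀ i, ¬ Satisfied (classOf (I.val i)) (z i) (I.val i (owned own i)) →
          r i + 1 ≤ 50 * m * k ∧ I.aps i ≤ z i * reduction m := by
        intro i hi
        have h1 := hg.aps_le_of_not_satisfied hsub hown' hi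
        -- A target that is not positive is met by any bundle.
        have hz0 : 0 < z i := by
          by_contra! hle
          have := I.val_nonneg i (owned own i)
          refine hi ?_
          by_cases hc : classOf (I.val i) = 1
          · exact .inr (.inl ⟨hc, by linarith⟩)
          · exact .inr (.inr ⟨hc, by linarith⟩)
        have hpos : 0 < initialTarget I i := by
          refine lt_of_le_of_ne (initialTarget_nonneg I i) fun h0 => ?_
          rw [(hz i).1, ← h0, zero_mul] at hz0
          exact lt_irrefl _ hz0
        have h3 := aps_le_reduced hz0.le hpos h1
        refine ⟨reductions_le hk hpos ?_, h3⟩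
        rwa [(hz i).1, mul_assoc, ← pow_succ] at h3
      refine wp_mono (fun s3 h3 => ?_) (wp_adjust hA hS fun i hi =>
        ⟨r i + 1, (hfail i hi).1, by rw [(hz i).1, pow_succ, mul_assoc]⟩)
      obtain ⟨hB3, hown3, hflag3⟩ := h3
      classical
      refine ⟨adjusted I z own, fun i => if Satisfied (classOf (I.val i)) (z i)
        (I.val i (owned own i)) then r i else r i + 1, hB3, fun i => ?_, fun h => ?_, fun h => ?_⟩
      · rw [adjusted]
        beta_reduce
        split_ifs with hi
        · exact hz i
        · exact ⟨by rw [(hz i).1, pow_succ, mul_assoc], (hfail i hi).1, (hfail i hi).2⟩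
      -- A set flag is due to an agent who has just reduced her target, so the sum of the counts
      -- rises.
      · obtain ⟨i, hi⟩ := hflag3.1 h
        refine Nat.succ_le_of_lt ((ht hflag).trans_lt (Finset.sum_lt_sum (fun i' _ => ?_)
          ⟨i, Finset.mem_univ i, by rw [if_neg hi]; exact Nat.lt_succ_self _⟩))
        split_ifs
        exacts [le_rfl, Nat.le_succ _]
      · have hsat : ∀ i, Satisfied (classOf (I.val i)) (z i) (I.val i (owned own i)) := by
          by_contra! hcon
          exact h (hflag3.2 hcon)
        exact ⟨own, ⟨hown', z, fun i => ⟨(hz i).2.2, hsat i, hg.aps_le_of_unitDemand hown'⟩⟩,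
          hown3⟩

end

end FairAlloc

end

/-! ### Sizes of numbers, running time, and the guarantees. -/

noncomputable section

namespace FairAlloc

/-! ### The complexity of the numbers that the program computes -/

section Levels

variable {w : ℝ → ℕ} {G : ℕ → ℝ → Prop}

/-- Numbers of level `Λ` become the new level 0, so that formulas in values, entitlements and
targets have constant levels such as 14 and 60. The weight plays no role there and is set to zero.
-/
theorem Grading.rescale (hG : Grading w G) (Λ : ℕ) :
    Grading (fun _ => 0) fun a x => G (a * (Λ + 1) + Λ) x where
  mono h hx := hG.mono (by gcongr) hx
  nat {a _} hk := hG.nat (hk.trans (Nat.pow_le_pow_right (by norm_num) (by nlinarith)))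
  add hx hy := hG.mono (by ring_nf; rfl) (hG.add hx hy)
  sub hx hy := hG.mono (by ring_nf; rfl) (hG.sub hx hy)
  mul hx hy := hG.mono (by ring_nf; rfl) (hG.mul hx hy)
  div hx hy := hG.mono (by ring_nf; rfl) (hG.div hx hy)
  weight _ := Nat.zero_le _

theorem Grading.zero (hG : Grading w G) (B : ℕ) : G B 0 := by
  simpa using hG.nat (B := B) (Nat.zero_le _)

theorem Grading.one (hG : Grading w G) (B : ℕ) : G B 1 := by
  simpa using hG.nat (B := B) (Nat.one_le_two_pow)

theorem Grading.sum (hG : Grading w G) {ι : Type*} {a : ℕ} {f : ι → ℝ} (hf : ∀ i, G a (f i))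
    (S : Finset ι) : G (S.card * (a + 1)) (∑ i ∈ S, f i) := by
  classical
  induction S using Finset.induction_on with
  | empty => simpa using hG.zero 0
  | insert i S hi ih =>
    rw [Finset.sum_insert hi, Finset.card_insert_of_notMem hi]
    exact hG.mono (by ring_nf; rfl) (hG.add (hf i) ih)

theorem Grading.pow (hG : Grading w G) {a : ℕ} {x : ℝ} (hx : G a x) (r : ℕ) :
    G (r * (a + 1)) (x ^ r) := by
  induction r with
  | zero => simpa using hG.one 0
  | succ r ih =>
    rw [pow_succ]
    exact hG.mono (by ring_nf; rfl) (hG.mul ih hx)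

theorem Grading.reduction (hG : Grading w G) (m : ℕ) : G (2 * m + 16) (reduction m) := by
  have h1 : G (m + 7) (50 * (m : ℝ)) :=
    hG.mono (by omega) (hG.mul (a := 6) (b := m) (by exact_mod_cast hG.nat (k := 50) (by norm_num))
      (hG.nat Nat.lt_two_pow_self.le))
  exact hG.mono (by omega) (hG.div (hG.sub h1 (hG.one 0)) h1)

theorem Grading.ofNat (hG : Grading w G) (k : ℕ) [k.AtLeastTwo] (hk : k ≤ 8) :
    G 3 (OfNat.ofNat k : ℝ) := by
  have := hG.nat (hk.trans (by norm_num : 8 ≤ 2 ^ 3))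
  rwa [← Nat.cast_ofNat (R := ℝ) (n := k)]

theorem Grading.budgetAfter (hG : Grading w G) {b z x d : ℝ} (hb : G 0 b) (hz : G 0 z)
    (hx : G 0 x) : G 14 (budgetAfter b z x d) := by
  rw [FairAlloc.budgetAfter]
  split_ifs
  · exact hG.mono (by norm_num) (hG.div hb (hG.ofNat 2 (by norm_num)))
  · exact hG.mono (by norm_num) (hG.mul hb (hG.sub (hG.one 0)
      (hG.div (hG.mul (hG.ofNat 5 (by norm_num)) hx) (hG.mul (hG.ofNat 4 (by norm_num)) hz))))

theorem Grading.bid (hG : Grading w G) {b z x x₀ β d : ℝ} (hb : G 0 b) (hz : G 0 z)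
    (hx₀ : G 0 x₀) (hβ : G 14 β) (hd : G 1 d) (c : ℕ) : G 60 (bid c b z x x₀ β d) := by
  have h2 := hG.ofNat 2 (by norm_num)
  have h3 := hG.ofNat 3 (by norm_num)
  have h4 := hG.ofNat 4 (by norm_num)
  have h5 := hG.ofNat 5 (by norm_num)
  rw [FairAlloc.bid, bidUnitDemand, bidSubmodular, bidAdditive, lateBid, earlyBid]
  split_ifs
  any_goals exact hG.zero _
  any_goals exact hG.mono (by norm_num) hb
  any_goals exact hG.mono (by norm_num) hβ
  · exact hG.mono (by norm_num) (hG.div (hG.mul (hG.mul h5 hd) hβ)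
      (hG.mul h2 (hG.sub (hG.mul h3 hz) (hG.mul h5 hx₀))))
  · exact hG.mono (by norm_num) (hG.div hb h2)
  · exact hG.mono (by norm_num) (hG.div (hG.mul (hG.mul h5 hd) hb) (hG.mul h4 hz))
  · exact hG.mono (by norm_num) (hG.div (hG.mul (hG.mul h3 hd) hb) (hG.mul h2 hz))

end Levels

/-- The bound for the number of iterations of the loops of the program. -/
def maxIterations (n m k : ℕ) : ℕ := n * (50 * m * k) + n + m + 2

/-- The bound for the complexity of the targets. -/
def targetLevel (m k L : ℕ) : ℕ := L + 50 * m * k * (2 * m + 17) + 1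

/-- The bound for the complexity of the numbers that the program computes. -/
def maxLevel (n m k L : ℕ) : ℕ :=
  60 * (targetLevel m k L + 1) + targetLevel m k L + m * (L + 1) + maxIterations n m k

/-- A polynomial that bounds `maxLevel n m k L` in terms of `n + m + k + L`. -/
def levelPolynomial : Polynomial ℕ :=
  let X := Polynomial.X
  60 * (X + 50 * X * X * (2 * X + 17) + 1 + 1) + (X + 50 * X * X * (2 * X + 17) + 1) + X * (X + 1) +
    (X * (50 * X * X) + X + X + 2)

theorem maxLevel_le {n m k L s : ℕ} (h : n + m + k + L ≤ s) :
    maxLevel n m k L ≤ levelPolynomial.eval s := by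
  have hn : n ≤ s := by omega
  have hm : m ≤ s := by omega
  have hk : k ≤ s := by omega
  have hL : L ≤ s := by omega
  simp only [levelPolynomial, maxLevel, targetLevel, maxIterations, Polynomial.eval_add,
    Polynomial.eval_mul, Polynomial.eval_X, Polynomial.eval_one, Polynomial.eval_ofNat]
  gcongr

section

variable {n m : ℕ} {I : Instance n m} {w : ℝ → ℕ} {G : ℕ → ℝ → Prop}

/-- Each reduction adds `2 * m + 17` to the level, and their number is at most `50 * m * k`. -/
theorem Grading.target (hG : Grading w G) {L : ℕ} (hval : ∀ i S, G L (I.val i S)) {k : ℕ}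
    {i : Fin n} {z : ℝ} (hz : IsTarget I k i z) : G (targetLevel m k L) z := by
  obtain ⟨r, hr, rfl⟩ := hz
  have h1 : G L (initialTarget I i) := by
    rw [initialTarget]
    split_ifs
    exacts [hval _ _, hG.zero _]
  have h2 : r * (2 * m + 16 + 1) ≤ 50 * m * k * (2 * m + 17) := Nat.mul_le_mul_right _ hr
  exact hG.mono (by rw [targetLevel]; omega) (hG.mul h1 (hG.pow (hG.reduction m) r))

/-- Apart from targets and the sum of the single values, every number written is a fixed formula in
the input and one target. Hence complexity does not accumulate over rounds. -/
theorem Grading.admissible (hG : Grading w G) {L : ℕ} (hval : ∀ i S, G L (I.val i S))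
    (hent : ∀ i, G L (I.ent i)) (k : ℕ) :
    Admissible I (G (maxLevel n m k L)) (maxIterations n m k) (IsTarget I k) := by
  have hL : L ≤ targetLevel m k L := by rw [targetLevel]; omega
  have hR := hG.rescale (targetLevel m k L)
  have hb : ∀ i, G (0 * (targetLevel m k L + 1) + targetLevel m k L) (I.ent i) :=
    fun i => hG.mono (by omega) (hent i)
  have hv : ∀ i S, G (0 * (targetLevel m k L + 1) + targetLevel m k L) (I.val i S) :=
    fun i S => hG.mono (by omega) (hval i S)
  have hz : ∀ {i z}, IsTarget I k i z → G (0 * (targetLevel m k L + 1) + targetLevel m k L) z :=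
    fun h => hG.mono (by omega) (hG.target hval h)
  have hd := fun i S T => hR.sub (hv i S) (hv i T)
  have hβ : ∀ {i z β}, IsTarget I k i z → IsBudget I i z β →
      G (14 * (targetLevel m k L + 1) + targetLevel m k L) β := by
    rintro i z β h (rfl | ⟨S, T, U, rfl⟩)
    · exact hG.zero _
    · exact hR.budgetAfter (hb i) (hz h) (hv i S)
  refine ⟨?_, ?_, ?_, hG.zero _, ?_, fun i S => hG.mono ?_ (hval i S),
    fun i S T => hG.mono ?_ (hd i S T), fun i S => hG.mono ?_ (hG.sum (fun j => hval i {j}) S),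
    fun i z h => hG.mono ?_ (hz h), fun i z β h hB => hG.mono ?_ (hβ h hB),
    fun i z β h hB c S T U V => hG.mono ?_ (hR.bid (hb i) (hz h) (hv i T) (hβ h hB) (hd i U V) c)⟩
  · rw [maxIterations]; omega
  · rw [maxIterations]; omega
  · rw [maxIterations]; omega
  · exact hG.mono (by rw [maxLevel]; omega) (hG.sub (hG.zero 0) (hG.one 0))
  · rw [maxLevel]; omega
  · rw [maxLevel]; omega
  · have := Nat.mul_le_mul_right (L + 1) (card_finset_fin_le S)
    rw [maxLevel]
    omega
  · rw [maxLevel]; omega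
  · rw [maxLevel]; omega
  · rw [maxLevel]; omega

theorem Grading.bdd_input (hG : Grading w G) {L B : ℕ} (hent : ∀ i, G L (I.ent i)) (hL : L ≤ B)
    (hn : n ≤ B) (hm : m ≤ B) : Bdd G B I.input := by
  have h2 : B ≤ 2 ^ B := Nat.lt_two_pow_self.le
  refine ⟨fun a j => ?_, fun a j => ?_⟩
  · simp only [Instance.input]
    split_ifs <;> omega
  · simp only [Instance.input]
    split_ifs
    exacts [hG.mono hL (hent _), hG.zero _]

/-- The run of the program, with its cost. -/
theorem exists_exec_allocate (hG : Grading w G) {L : ℕ} (hval : ∀ i S, G L (I.val i S))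
    (hent : ∀ i, G L (I.ent i)) (hsub : ∀ i, IsSubmodular (I.val i)) {k : ℕ}
    (hk : ∀ i S, 0 < I.val i S → I.val i Finset.univ ≤ 2 ^ k * I.val i S) :
    ∃ s t, Exec w I.oracle allocate I.input s t ∧
      t ≤ allocate.time (maxLevel n m k L) (maxIterations n m k) ∧
      ∃ own, Final I own ∧ ∀ j : Fin m, s.idx 2 j = own j := by
  have hN : maxIterations n m k ≤ maxLevel n m k L := by rw [maxLevel]; omega
  have hB : Bdd G (maxLevel n m k L) I.input := by
    refine hG.bdd_input hent ?_ ?_ ?_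
    · rw [maxLevel, targetLevel]; omega
    · rw [maxLevel, maxIterations]; omega
    · rw [maxLevel, maxIterations]; omega
  obtain ⟨s, t, hs, ht, -, h⟩ := exec_of_wp hG (hN.trans Nat.lt_two_pow_self.le) hB
    (wp_allocate hsub hk (hG.admissible hval hent k) (by rw [maxIterations]; omega))
  exact ⟨s, t, hs, ht, h⟩

/-! ### The guarantees -/

/-- An additive valuation can be classified as unit-demand; it then receives the full share, which
is more than enough. -/
theorem Final.guarantees {own : Fin m → ℕ} (h : Final I own) (i : Fin n) :
    1 / 3 * I.aps i ≤ I.val i (owned own i) ∧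
    (IsAdditive (I.val i) → 3 / 5 * I.aps i ≤ I.val i (owned own i)) ∧
    (IsUnitDemand (I.val i) → I.aps i ≤ I.val i (owned own i)) := by
  obtain ⟨-, z, hz⟩ := h
  obtain ⟨haps, hsat, h2⟩ := hz i
  have hx := I.val_nonneg i (owned own i)
  refine ⟨?_, fun hadd => ?_, fun hud => h2 (if_pos hud.test)⟩
  · rcases hsat with hc | ⟨-, h1⟩ | ⟨-, h0⟩
    · linarith [h2 hc]
    · linarith
    · linarith
  · by_cases hc : classOf (I.val i) = 2
    · linarith [h2 hc]
    · have h1 : classOf (I.val i) = 1 := by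
        rw [classOf] at hc ⊢
        split_ifs at hc ⊢ with ht hs
        · exact absurd rfl hc
        · rfl
        · exact absurd (hadd Finset.univ).ge hs
      rcases hsat with h3 | ⟨-, h3⟩ | ⟨h3, -⟩
      · exact absurd h3 hc
      · linarith
      · exact absurd h1 h3

/-- Some run is needed to define the allocation before any `k` or `L` is given. -/
theorem exists_ratio_bound (I : Instance n m) :
    ∃ k : ℕ, ∀ i S, 0 < I.val i S → I.val i Finset.univ ≤ 2 ^ k * I.val i S := by
  have h : ∀ i S, ∃ k : ℕ, 0 < I.val i S → I.val i Finset.univ ≤ 2 ^ k * I.val i S := by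
    intro i S
    by_cases hS : 0 < I.val i S
    · obtain ⟨k, hk⟩ := pow_unbounded_of_one_lt (I.val i Finset.univ / I.val i S) one_lt_two
      exact ⟨k, fun _ => ((div_lt_iff₀ hS).1 hk).le⟩
    · exact ⟨0, fun h => absurd h hS⟩
  choose f hf using h
  refine ⟨∑ i, ∑ S, f i S, fun i S hS => (hf i S hS).trans ?_⟩
  have h1 : f i S ≤ ∑ T, f i T := Finset.single_le_sum (fun _ _ => Nat.zero_le _)
    (Finset.mem_univ S)
  have h2 : ∑ T, f i T ≤ ∑ i, ∑ T, f i T :=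
    Finset.single_le_sum (f := fun i => ∑ T, f i T) (fun _ _ => Nat.zero_le _) (Finset.mem_univ i)
  gcongr
  exacts [one_le_two, h1.trans h2]

/-- With numerators and denominators at most 2^L, `x` is at most 2^L and a positive `y` is at least
2^(-L). So `k = 2 * L` serves for rational inputs. -/
theorem HasBits.le_two_pow_mul {x y : ℝ} {L : ℕ} (hx : HasBits x L) (hy : HasBits y L)
    (h : 0 < y) : x ≤ 2 ^ (2 * L) * y := by
  obtain ⟨a, d, hd, rfl, ha, -⟩ := hx.fracBits
  obtain ⟨a', d', hd', rfl, -, hq⟩ := hy.fracBits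
  have hd0 : (0 : ℝ) < d := by exact_mod_cast hd
  have hd'0 : (0 : ℝ) < d' := by exact_mod_cast hd'
  have h1 : (1 : ℝ) ≤ a' := by
    have : (0 : ℝ) < a' := by simpa [hd'0] using (div_pos_iff_of_pos_right hd'0).1 h
    exact_mod_cast this
  have h2 : (a : ℝ) ≤ 2 ^ L := by
    have : a ≤ (2 ^ L : ℕ) := (Int.le_natAbs).trans (by exact_mod_cast ha)
    exact_mod_cast this
  have h3 : (d' : ℝ) ≤ 2 ^ L := by exact_mod_cast hq
  have h4 : (a : ℝ) / d ≤ 2 ^ L := by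
    rw [div_le_iff₀ hd0]
    have : (1 : ℝ) ≤ d := by exact_mod_cast hd
    nlinarith [show (0 : ℝ) < 2 ^ L by positivity]
  refine h4.trans ?_
  rw [mul_div_assoc', le_div_iff₀ hd'0, two_mul, pow_add]
  have h5 : (0 : ℝ) < 2 ^ L := by positivity
  calc (2 : ℝ) ^ L * d' ≤ 2 ^ L * 2 ^ L := by gcongr
    _ ≤ 2 ^ L * 2 ^ L * a' := le_mul_of_one_le_right (by positivity) h1

end

end FairAlloc

end

/-! ### Assembly: one allocation, both time bounds. -/

open FairAlloc
theorem corollary4 :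
    ∃ (c : FairAlloc.Prog) (p : Polynomial ℕ), ∀ (n m : ℕ) (I : FairAlloc.Instance n m),
      (∀ i, IsSubmodular (I.val i)) →
      ∃ A : Fin m → Fin n,
        (∀ i, 1 / 3 * I.aps i ≤ I.val i (bundle A i)) ∧
        (∀ i, IsAdditive (I.val i) → 3 / 5 * I.aps i ≤ I.val i (bundle A i)) ∧
        (∀ i, IsUnitDemand (I.val i) → I.aps i ≤ I.val i (bundle A i)) ∧
        (∀ k : ℕ, (∀ i S, 0 < I.val i S → I.val i Finset.univ ≤ 2 ^ k * I.val i S) →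
          ∃ t ≤ p.eval (n + m + k), Outputs unitWeight c I A t) ∧
        (∀ L : ℕ, (∀ i S, HasBits (I.val i S) L) → (∀ i, HasBits (I.ent i) L) →
          ∃ t ≤ p.eval (n + m + L), Outputs bitWeight c I A t) := by
  obtain ⟨p, hp⟩ := allocate.exists_polynomial_time
  -- The factor 3 absorbs `k = 2 * L` in the rational case: `n + m + 2 * L + L ≤ 3 * (n + m + L)`.
  refine ⟨allocate, (p.comp levelPolynomial).comp (3 * Polynomial.X), fun n m I hsub => ?_⟩
  have htime : ∀ {k L s t : ℕ}, n + m + k + L ≤ 3 * s →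
      t ≤ allocate.time (maxLevel n m k L) (maxIterations n m k) →
      t ≤ ((p.comp levelPolynomial).comp (3 * Polynomial.X)).eval s := by
    intro k L s t hs ht
    have h1 := maxLevel_le hs
    simp only [Polynomial.eval_comp, Polynomial.eval_mul, Polynomial.eval_X,
      Polynomial.eval_ofNat]
    exact ht.trans (hp _ _ _ h1 ((by rw [maxLevel]; omega : _ ≤ maxLevel n m k L).trans h1))
  obtain ⟨k₀, hk₀⟩ := exists_ratio_bound I
  obtain ⟨s₀, t₀, hs₀, -, own, hfin, hown⟩ := exists_exec_allocate grading_unitWeight (L := 0)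
    (fun _ _ => trivial) (fun _ => trivial) hsub hk₀
  have hbundle : ∀ i, bundle (fun j => (⟨own j, hfin.1 j⟩ : Fin n)) i = owned own i := by
    intro i
    ext j
    simp [bundle, owned, Fin.ext_iff]
  refine ⟨fun j => ⟨own j, hfin.1 j⟩, ?_⟩
  simp only [hbundle]
  refine ⟨fun i => (hfin.guarantees i).1, fun i => (hfin.guarantees i).2.1,
    fun i => (hfin.guarantees i).2.2, fun k hk => ?_, fun L hval hent => ?_⟩
  · obtain ⟨s, t, hs, ht, -⟩ := exists_exec_allocate grading_unitWeight (L := 0)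
      (fun _ _ => trivial) (fun _ => trivial) hsub hk
    -- The reference run fixes the allocation; determinism transfers the cost bound of this run to
    -- it.
    obtain rfl := hs₀.unique hs
    exact ⟨t, htime (by omega) ht, s₀, hs, hown⟩
  · obtain ⟨s, t, hs, ht, -⟩ := exists_exec_allocate grading_bitWeight
      (fun i S => (hval i S).fracBits) (fun i => (hent i).fracBits) hsub (k := 2 * L)
      fun i S => (hval i Finset.univ).le_two_pow_mul (hval i S)
    obtain rfl := hs₀.unique hs
    exact ⟨t, htime (by omega) ht, s₀, hs, hown⟩
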